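/- Let $n\ge 2$, $p>-n$, and write $z\cdot w=\sum_{l} z_l\overline{w_l}$, $|z|=\sqrt{z\cdot z}$ for $z,w\in\mathbb C^n$. Let $\mathcal O$ be the Hilbert space of all $f\in L^2(S)$, $S=\{x\in\mathbb C^n:|x|=1\}$ with normalized surface measure, whose Poisson extension to the open unit ball is holomorphic (equivalently, $f$ is the $L^2(S)$-limit, as $r\to1^-$, of $x\mapsto F(rx)$ with $F$ holomorphic in the ball). For $\hbar>0$ and $z\in\mathbb C^n$ let $$K_z(x)=\sum_{\ell\ge0}\frac{c_\ell}{\ell!}\Big(\frac{x\cdot z}{\hbar}\Big)^\ell,\qquad c_\ell=\sqrt{\frac{(n)_\ell}{(n+p)_\ell}},\qquad T_\hbar(z,w)=\sum_{\ell\ge0}\frac{(z\cdot w/\hbar^2)^\ell}{\ell!\,(n+p)_\ell},$$ where $(b)_\ell$ is the Pochhammer symbol. With $K_p^{\rm Bes}$ the MacDonald--Bessel function let $$dm(z)=\frac{1}{\Gamma(n+p)}\frac{2}{(\pi\hbar^2)^n}\Big(\frac{|z|}{\hbar}\Big)^pK^{\rm Bes}_p\Big(\frac{2|z|}{\hbar}\Big)\,dz,$$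 $dz$ being Lebesgue measure on $\mathbb C^n$. For a bounded operator $A$ on $\mathcal O$ put $\mathfrak B(A)(z,w)=\langle AK_z,K_w\rangle/\langle K_z,K_w\rangle$ (where the denominator does not vanish) and $\mathfrak B(A)(z)=\mathfrak B(A)(z,z)$; let $\mathcal A_\hbar=\{\mathfrak B(A): A \text{ bounded on }\mathcal O\}$, a set of functions on $\mathbb C^n$. The function $f=\mathfrak B(A)$ on $\mathbb C^n$ determines $f(z,w):=\mathfrak B(A)(z,w)$. For $f_1,f_2\in\mathcal A_\hbar$ define $$(f_1*_pf_2)(z)=\int_{\mathbb C^n} f_1(u,z)\,f_2(z,u)\,\frac{T_\hbar(u,z)\,T_\hbar(z,u)}{T_\hbar(z,z)}\,dm(u).$$ Then this integral converges absolutely, $f_1*_pf_2\in\mathcal A_\hbar$, and: (a) $1\in\mathcal A_\hbar$ and $f*_p1=1*_pf=f$ for all $f\in\mathcal A_\hbar$. (b) $*_p$ is associative on $\mathcal A_\hbar$. (c) Let $\Phi(w)=2|w|$, $g_{i\bar j}=\partial_{\bar j}\partial_i\Phi$ on $\mathbb C^n\setminus\{0\}$, with inverse matrix $g^{\bar ji}$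 ($\sum_j g_{i\bar j}g^{\bar jk}=\delta_{ik}$), and let $R=\sum_{i,j}g^{\bar ji}\partial_i\partial_{\bar j}\log\det(g_{k\bar l})$ be the scalar curvature. Let $z\ne0$ and, for all small $\hbar>0$, let $f_1=f_1^\hbar$, $f_2=f_2^\hbar\in\mathcal A_\hbar$ be such that each of the two families $F_\hbar(u)=f_1^\hbar(u,z)$ and $F_\hbar(u)=f_2^\hbar(z,u)$ grows uniformly in $\hbar$ in the following sense: there are $C\in\mathbb R$ and $\theta<1$ with $$|F_\hbar(u)|\,|T_\hbar(u,z)|\le C e^{C|u|}\big(|T_\hbar(u,z)|+e^{\theta|z|/\hbar}\big)\qquad\text{for all small }\hbar>0\text{ and all } u\in\mathbb C^n$$ (with $F_\hbar(u):=0$ where $T_\hbar(u,z)=0$). Then, as $\hbar\to0^+$, $$f_1*_pf_2(z)=f_1(z)f_2(z)+\hbar\Big[\sum_{i,j}g^{\bar ji}(z)\,\partial_{\bar j}f_1(w,z)\,\partial_if_2(z,w)\big|_{w=z}+f_1(z)f_2(z)\Big(-\frac{(n-1)(n-1+2p)}{4|z|}+\frac R2+\sum_{i,j}g^{\bar ji}(z)\frac{-p-n+\frac12}{2|z|^4}\big(z_j\overline{z_i}-|z|^2\delta_{ij}\big)\Big)\Big]+O(\hbar^2),$$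 where derivatives are with respect to $w$, $\partial_i=\partial/\partial w_i$, $\partial_{\bar j}=\partial/\partial\overline{w_j}$. -/

import Mathlib

open MeasureTheory Filter Topology Asymptotics

namespace BerezinSphere

noncomputable section

/-- Complex `n`-space with its Hermitian norm `|z|`. -/
abbrev Cn (n : ℕ) : Type := EuclideanSpace ℂ (Fin n)

/-- The unit sphere `S^n = {x ∈ ℂⁿ : |x| = 1}`. -/
abbrev Sph (n : ℕ) : Type := Metric.sphere (0 : Cn n) 1

/-- `z ⬝ w = ∑ z_ℓ conj (w_ℓ)`, linear in `z` and antilinear in `w`. -/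
def cdot {n : ℕ} (z w : Cn n) : ℂ := ∑ l, z l * (starRingEnd ℂ) (w l)

/-- Normalized surface measure on the unit sphere. -/
def sphereMeasure (n : ℕ) : Measure (Sph n) :=
  ((volume : Measure (Cn n)).toSphere Set.univ)⁻¹ • (volume : Measure (Cn n)).toSphere

instance sphereMeasure_finite (n : ℕ) : IsFiniteMeasure (sphereMeasure n) := by
  constructor
  by_cases h : (volume : Measure (Cn n)).toSphere Set.univ = 0
  · simp [sphereMeasure, h]
  · simp only [sphereMeasure, Measure.smul_apply, smul_eq_mul]
    rw [ENNReal.inv_mul_cancel h (measure_ne_top _ _)]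
    exact ENNReal.one_lt_top

/-- `F` is holomorphic in the open unit ball and its dilates `x ↦ F (r x)` converge to `f` in
`L²` of the sphere as `r → 1`. Since holomorphic functions are harmonic, this says that `F` solves
the Dirichlet problem with boundary value `f ∈ L²`, so that `F` is the Poisson extension of `f`. -/
def IsHolomorphicExtension {n : ℕ} (f : Sph n → ℂ) (F : Cn n → ℂ) : Prop :=
  DifferentiableOn ℂ F (Metric.ball 0 1) ∧
    Tendsto (fun r : ℝ => eLpNorm (fun x : Sph n => F (r • (x : Cn n)) - f x) 2 (sphereMeasure n))
      (𝓝[<] 1) (𝓝 0)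

theorem dilate_aesm {n : ℕ} {F : Cn n → ℂ} (hF : DifferentiableOn ℂ F (Metric.ball 0 1))
    {r : ℝ} (h0 : 0 < r) (h1 : r < 1) :
    AEStronglyMeasurable (fun x : Sph n => F (r • (x : Cn n))) (sphereMeasure n) := by
  refine Continuous.aestronglyMeasurable ?_
  refine hF.continuousOn.comp_continuous (by fun_prop) fun x => ?_
  have hx : ‖(x : Cn n)‖ = 1 := by simp
  simp [norm_smul, hx, abs_of_pos h0, h1]

theorem eventually_mem_Ioo : ∀ᶠ r : ℝ in 𝓝[<] 1, 0 < r ∧ r < 1 := by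
  filter_upwards [Ioo_mem_nhdsLT (show (0 : ℝ) < 1 by norm_num)] with r hr using hr

/-- The space `𝒪` of all functions in `L²` of the unit sphere whose Poisson extension into the
interior of the sphere is holomorphic. -/
def HolSpace (n : ℕ) : Submodule ℂ (Lp ℂ 2 (sphereMeasure n)) where
  carrier := {f | ∃ F : Cn n → ℂ, IsHolomorphicExtension (f : Sph n → ℂ) F}
  zero_mem' := by
    refine ⟨0, by simp, ?_⟩
    have h : ∀ r : ℝ, eLpNorm (fun x : Sph n => (0 : Cn n → ℂ) (r • (x : Cn n)) -
        ((0 : Lp ℂ 2 (sphereMeasure n)) : Sph n → ℂ) x) 2 (sphereMeasure n) = 0 := by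
      intro r
      rw [eLpNorm_congr_ae (g := fun _ => (0 : ℂ))]
      · simp
      · filter_upwards [Lp.coeFn_zero ℂ 2 (sphereMeasure n)] with x hx
        rw [hx]
        simp
    simp only [h]
    exact tendsto_const_nhds
  add_mem' := by
    rintro f g ⟨F, hF, hF'⟩ ⟨G, hG, hG'⟩
    refine ⟨F + G, hF.add hG, ?_⟩
    have hlim := hF'.add hG'
    rw [add_zero] at hlim
    refine tendsto_of_tendsto_of_tendsto_of_le_of_le' tendsto_const_nhds hlim
      (Eventually.of_forall fun _ => zero_le) ?_
    filter_upwards [eventually_mem_Ioo] with r hr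
    refine le_trans (le_of_eq ?_) (eLpNorm_add_le
      ((dilate_aesm hF hr.1 hr.2).sub (Lp.aestronglyMeasurable f))
      ((dilate_aesm hG hr.1 hr.2).sub (Lp.aestronglyMeasurable g)) (by norm_num))
    refine eLpNorm_congr_ae ?_
    filter_upwards [Lp.coeFn_add f g] with x hx
    simp only [Pi.add_apply, hx]
    ring
  smul_mem' := by
    rintro c f ⟨F, hF, hF'⟩
    refine ⟨c • F, hF.const_smul c, ?_⟩
    have hlim := ENNReal.Tendsto.const_mul (a := ‖c‖ₑ) hF' (Or.inr enorm_ne_top)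
    rw [mul_zero] at hlim
    refine hlim.congr fun r => ?_
    rw [← eLpNorm_const_smul]
    refine eLpNorm_congr_ae ?_
    filter_upwards [Lp.coeFn_smul c f] with x hx
    simp only [Pi.smul_apply, hx, smul_eq_mul]
    ring

/-- The Pochhammer symbol `(b)_ℓ = b (b + 1) ⋯ (b + ℓ - 1) = Γ(b + ℓ) / Γ(b)`. -/
def poch (b : ℝ) (l : ℕ) : ℝ := (ascPochhammer ℝ l).eval b

/-- `c_{ℓ,p}`, the nonnegative number with `c_{ℓ,p}² = (n)_ℓ / (n+p)_ℓ`. -/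
def cohCoeff (n : ℕ) (p : ℝ) (l : ℕ) : ℝ := √(poch n l / poch (n + p) l)

/-- The power series `∑ (c_{ℓ,p} / ℓ!) t^ℓ`. -/
def cohSeries (n : ℕ) (p : ℝ) (t : ℂ) : ℂ :=
  ∑' l : ℕ, ((cohCoeff n p l / (l.factorial : ℝ) : ℝ) : ℂ) * t ^ l

theorem cohCoeff_le (n : ℕ) (p : ℝ) : ∃ M : ℝ, 0 ≤ M ∧ ∀ l, |cohCoeff n p l| ≤ M ^ l := by
  have hlim : Tendsto (fun k : ℕ => ((n : ℝ) + k) / (n + p + k)) atTop (𝓝 1) := by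
    have h1 : Tendsto (fun k : ℕ => 1 - p / (n + p + (k : ℝ))) atTop (𝓝 (1 - 0)) :=
      tendsto_const_nhds.sub (tendsto_const_nhds.div_atTop
        (tendsto_atTop_add_const_left _ _ tendsto_natCast_atTop_atTop))
    rw [sub_zero] at h1
    refine h1.congr' ?_
    have : ∀ᶠ k : ℕ in atTop, 0 < (n + p + (k : ℝ)) :=
      (tendsto_atTop_add_const_left _ (n + p)
        (tendsto_natCast_atTop_atTop (R := ℝ))).eventually_gt_atTop 0
    filter_upwards [this] with k hk
    field_simp
    ring
  obtain ⟨M, hM⟩ := hlim.abs.bddAbove_range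
  have hM' : ∀ k : ℕ, |((n : ℝ) + k) / (n + p + k)| ≤ M := fun k => hM ⟨k, rfl⟩
  have hM0 : 0 ≤ M := (abs_nonneg _).trans (hM' 0)
  refine ⟨√M, Real.sqrt_nonneg _, fun l => ?_⟩
  have key : |poch n l / poch (n + p) l| ≤ M ^ l := by
    induction l with
    | zero => simp [poch]
    | succ k ih =>
      simp only [poch, ascPochhammer_succ_eval] at ih ⊢
      rw [mul_div_mul_comm, abs_mul, pow_succ]
      exact mul_le_mul ih (hM' k) (abs_nonneg _) (by positivity)
  rw [cohCoeff, abs_of_nonneg (Real.sqrt_nonneg _)]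
  calc √(poch n l / poch (n + p) l) ≤ √(M ^ l) := Real.sqrt_le_sqrt ((le_abs_self _).trans key)
    _ = (√M) ^ l := by
      rw [Real.sqrt_eq_iff_mul_self_eq (by positivity) (by positivity), ← mul_pow,
        Real.mul_self_sqrt hM0]

theorem cohSeries_differentiable (n : ℕ) (p : ℝ) : Differentiable ℂ (cohSeries n p) := by
  obtain ⟨M, hM0, hM⟩ := cohCoeff_le n p
  intro t
  have hs : Summable (fun l : ℕ => (M * (‖t‖ + 1)) ^ l / (l.factorial : ℝ)) :=
    Real.summable_pow_div_factorial _
  have hd : DifferentiableOn ℂ (cohSeries n p) (Metric.ball 0 (‖t‖ + 1)) := by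
    refine Complex.differentiableOn_tsum_of_summable_norm hs (fun l => ?_) Metric.isOpen_ball
      fun l w hw => ?_
    · exact (Differentiable.const_mul (by fun_prop) _).differentiableOn
    · have hw' : ‖w‖ ≤ ‖t‖ + 1 := by
        have := mem_ball_zero_iff.1 hw
        exact this.le
      rw [norm_mul, norm_pow, Complex.norm_real, Real.norm_eq_abs, abs_div, Nat.abs_cast,
        mul_pow, div_mul_eq_mul_div]
      have : |cohCoeff n p l| * ‖w‖ ^ l ≤ M ^ l * (‖t‖ + 1) ^ l :=
        mul_le_mul (hM l) (pow_le_pow_left₀ (norm_nonneg _) hw' l) (by positivity) (by positivity)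
      gcongr
  exact hd.differentiableAt (Metric.isOpen_ball.mem_nhds (by simp))

/-- The coherent states `K(x, z) = ∑ (c_{ℓ,p} / ℓ!) (x ⬝ z / ħ)^ℓ`. -/
def cohFun (n : ℕ) (p ħ : ℝ) (x z : Cn n) : ℂ := cohSeries n p (cdot x z / ħ)

theorem cohFun_differentiable (n : ℕ) (p ħ : ℝ) (z : Cn n) :
    Differentiable ℂ fun x => cohFun n p ħ x z := by
  refine (cohSeries_differentiable n p).comp ?_
  unfold cdot
  fun_prop

theorem cohFun_memLp (n : ℕ) (p ħ : ℝ) (z : Cn n) :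
    MemLp (fun x : Sph n => cohFun n p ħ x z) 2 (sphereMeasure n) := by
  have hc : Continuous (fun x : Sph n => cohFun n p ħ x z) :=
    (cohFun_differentiable n p ħ z).continuous.comp continuous_subtype_val
  obtain ⟨C, hC⟩ := (isCompact_univ (X := Sph n)).exists_bound_of_continuousOn hc.continuousOn
  exact MemLp.of_bound hc.aestronglyMeasurable C (ae_of_all _ fun x => hC x trivial)

theorem cohFun_mem (n : ℕ) (p ħ : ℝ) (z : Cn n) :
    (cohFun_memLp n p ħ z).toLp _ ∈ HolSpace n := by
  refine ⟨fun x => cohFun n p ħ x z, (cohFun_differentiable n p ħ z).differentiableOn, ?_⟩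
  have hc : Continuous (fun x => cohFun n p ħ x z) := (cohFun_differentiable n p ħ z).continuous
  have hu : TendstoUniformlyOn (fun (r : ℝ) (x : Cn n) => cohFun n p ħ (r • x) z)
      (fun x => cohFun n p ħ x z) (𝓝 1) (Metric.sphere 0 1) := by
    have h2 : Continuous fun q : ℝ × Cn n => cohFun n p ħ (q.1 • q.2) z := by fun_prop
    intro u hu
    obtain ⟨v, hv, h3⟩ := IsCompact.mem_uniformity_of_prod (isCompact_sphere (0 : Cn n) 1)
      (f := fun (r : ℝ) (x : Cn n) => cohFun n p ħ (r • x) z) (s := Set.univ) (q := (1 : ℝ))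
      h2.continuousOn trivial (symm_le_uniformity hu)
    rw [nhdsWithin_univ] at hv
    filter_upwards [hv] with r hr x hx
    simpa using h3 r hr x hx
  set μ := sphereMeasure n
  rw [ENNReal.tendsto_nhds_zero]
  intro ε hε
  obtain ⟨δ, hδ, hδε⟩ : ∃ δ : ℝ, 0 < δ ∧
      μ Set.univ ^ (2 : ENNReal).toReal⁻¹ * ENNReal.ofReal δ ≤ ε := by
    have hfin : μ Set.univ ^ (2 : ENNReal).toReal⁻¹ ≠ ⊤ :=
      ENNReal.rpow_ne_top_of_nonneg (by positivity) (measure_ne_top _ _)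
    have ht : Tendsto (fun δ : ℝ => μ Set.univ ^ (2 : ENNReal).toReal⁻¹ * ENNReal.ofReal δ)
        (𝓝[>] 0) (𝓝 0) := by
      have h5 : Tendsto (fun δ : ℝ => ENNReal.ofReal δ) (𝓝[>] 0) (𝓝 0) := by
        have := (ENNReal.continuous_ofReal.tendsto 0).mono_left
          (nhdsWithin_le_nhds (s := Set.Ioi (0 : ℝ)))
        simpa using this
      have := ENNReal.Tendsto.const_mul h5 (Or.inr hfin)
      simpa using this
    obtain ⟨δ, h6, h7⟩ := ((ENNReal.tendsto_nhds_zero.1 ht ε hε).and self_mem_nhdsWithin).exists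
    exact ⟨δ, h7, h6⟩
  have h8 := (Metric.tendstoUniformlyOn_iff.1 hu δ hδ).filter_mono
    (nhdsWithin_le_nhds (s := Set.Iio (1 : ℝ)))
  filter_upwards [h8] with r hr
  refine le_trans (eLpNorm_le_of_ae_bound (C := δ) ?_) hδε
  filter_upwards [(cohFun_memLp n p ħ z).coeFn_toLp] with x hx
  rw [hx, ← dist_eq_norm, dist_comm]
  exact (hr x x.2).le

/-- The coherent state `K(·, z)` as an element of `𝒪`. -/
def coh (n : ℕ) (p ħ : ℝ) (z : Cn n) : HolSpace n :=
  ⟨(cohFun_memLp n p ħ z).toLp _, cohFun_mem n p ħ z⟩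

/-- The extended Berezin symbol
`𝔅(A)(z, w) = ⟨A K(·,z), K(·,w)⟩ / ⟨K(·,z), K(·,w)⟩` of a bounded operator `A` on `𝒪`
(Mathlib's inner product is linear in its second argument, so the arguments are interchanged).
It is set to `0` on the exceptional set where the denominator vanishes. -/
def extSymbol (n : ℕ) (p ħ : ℝ) (A : HolSpace n →L[ℂ] HolSpace n) (z w : Cn n) : ℂ :=
  inner ℂ (coh n p ħ w) (A (coh n p ħ z)) / inner ℂ (coh n p ħ w) (coh n p ħ z)

/-- The Berezin symbol `𝔅(A)(z) = 𝔅(A)(z, z)`. -/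
def symbol (n : ℕ) (p ħ : ℝ) (A : HolSpace n →L[ℂ] HolSpace n) (z : Cn n) : ℂ :=
  extSymbol n p ħ A z z

/-- The algebra `𝒜` of Berezin symbols of bounded operators on `𝒪`. -/
def symbolAlgebra (n : ℕ) (p ħ : ℝ) : Set (Cn n → ℂ) := Set.range (symbol n p ħ)

open Classical in
/-- The extension `f(z, w)` of a Berezin symbol `f(z)` off the diagonal: the extended symbol of an
operator whose symbol is `f`. -/
def ext (n : ℕ) (p ħ : ℝ) (f : Cn n → ℂ) : Cn n → Cn n → ℂ :=
  if h : ∃ A, symbol n p ħ A = f then extSymbol n p ħ h.choose else 0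

/-- The MacDonald-Bessel function `K_p(x) = ∫₀^∞ exp (-x cosh t) cosh (p t) dt`, for `x > 0`. -/
def besselK (p x : ℝ) : ℝ :=
  ∫ t in Set.Ioi (0 : ℝ), Real.exp (-x * Real.cosh t) * Real.cosh (p * t)

/-- The measure
`dm(z) = (1 / Γ(n+p)) (2 / (π ħ²)ⁿ) (|z| / ħ)^p K_p(2 |z| / ħ) dz` on `ℂⁿ`. -/
def mMeasure (n : ℕ) (p ħ : ℝ) : Measure (Cn n) :=
  volume.withDensity fun z => ENNReal.ofReal
    (1 / Real.Gamma (n + p) * (2 / (Real.pi * ħ ^ 2) ^ n) * (‖z‖ / ħ) ^ p *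
      besselK p (2 * ‖z‖ / ħ))

/-- The kernel `T(z, w) = ∑ (z ⬝ w / ħ²)^ℓ / (ℓ! (n+p)_ℓ) = ₀F₁(n+p, z ⬝ w / ħ²)`, that is,
`Γ(n+p) (z ⬝ w / ħ²)^((1-n-p)/2) I_{n+p-1}(2 √(z ⬝ w) / ħ)` with its removable singularity at
`z ⬝ w = 0` removed. -/
def kernelT (n : ℕ) (p ħ : ℝ) (z w : Cn n) : ℂ :=
  ∑' l : ℕ, (cdot z w / (ħ : ℂ) ^ 2) ^ l / ((l.factorial : ℂ) * (poch (n + p) l : ℂ))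

/-- The integrand of the star product with respect to the measure `mMeasure`. -/
def starIntegrand (n : ℕ) (p ħ : ℝ) (f₁ f₂ : Cn n → ℂ) (z u : Cn n) : ℂ :=
  ext n p ħ f₁ u z * ext n p ħ f₂ z u *
    (kernelT n p ħ u z * kernelT n p ħ z u / kernelT n p ħ z z)

/-- The star product
`(f₁ * f₂)(z) = ∫ f₁(u, z) f₂(z, u) T(u, z) T(z, u) / T(z, z) dm(u)`. Inserting `mMeasure` and the
expression of `T` through the Bessel function `I_{n+p-1}`, this reads
`2 / ((πħ)ⁿ ħ) ∫ f₁(u,z) f₂(z,u) [|u⬝z| / |z|]^(1-n-p)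
  (I(2√(u⬝z)/ħ) I(2√(z⬝u)/ħ) / I(2|z|/ħ)) |u|^p K_p(2|u|/ħ) du`. -/
def starProd (n : ℕ) (p ħ : ℝ) (f₁ f₂ : Cn n → ℂ) (z : Cn n) : ℂ :=
  ∫ u, starIntegrand n p ħ f₁ f₂ z u ∂(mMeasure n p ħ)

/-- `∂_i f = ∂f/∂w_i = (∂f/∂x_i - i ∂f/∂y_i) / 2`. -/
def dHol {n : ℕ} (i : Fin n) (f : Cn n → ℂ) (w : Cn n) : ℂ :=
  (fderiv ℝ f w (EuclideanSpace.single i 1) -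
    Complex.I * fderiv ℝ f w (EuclideanSpace.single i Complex.I)) / 2

/-- `∂_{j̄} f = ∂f/∂w̄_j = (∂f/∂x_j + i ∂f/∂y_j) / 2`. -/
def dBar {n : ℕ} (j : Fin n) (f : Cn n → ℂ) (w : Cn n) : ℂ :=
  (fderiv ℝ f w (EuclideanSpace.single j 1) +
    Complex.I * fderiv ℝ f w (EuclideanSpace.single j Complex.I)) / 2

/-- The Kähler metric `g_{i j̄} = ∂_{j̄} ∂_i Φ` with potential `Φ(w) = 2 |w|`. -/
def kahlerMetric (n : ℕ) (w : Cn n) : Matrix (Fin n) (Fin n) ℂ :=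
  Matrix.of fun i j => dBar j (dHol i fun v => ((2 * ‖v‖ : ℝ) : ℂ)) w

/-- `g^{j̄ i}`, the coefficients of the inverse matrix: `∑_j g_{i j̄} g^{j̄ k} = δ_{ik}`. -/
def gInv (n : ℕ) (w : Cn n) (j i : Fin n) : ℂ := (kahlerMetric n w)⁻¹ j i

/-- The scalar curvature `R = g^{j̄ i} ∂_i ∂_{j̄} log det g`, with this sign convention. -/
def scalarCurv (n : ℕ) (w : Cn n) : ℂ :=
  ∑ i, ∑ j, gInv n w j i * dHol i (dBar j fun v => Complex.log (kahlerMetric n v).det) w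

/-- The first order coefficient of the star product, for extended symbols `F₁`, `F₂`:
`g^{j̄ i} ∂_{j̄} F₁(w, z) ∂_i F₂(z, w) |_{w = z}
  + F₁(z, z) F₂(z, z) (-(n-1)(n-1+2p) / (4|z|) + R/2
      + g^{j̄ i} ((-p-n+1/2) / (2|z|⁴)) (z_j z̄_i - |z|² δ_{ij}))`. -/
def firstOrder (n : ℕ) (p : ℝ) (F₁ F₂ : Cn n → Cn n → ℂ) (z : Cn n) : ℂ :=
  ∑ i, ∑ j, gInv n z j i * (dBar j (fun w => F₁ w z) z * dHol i (fun w => F₂ z w) z) +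
    F₁ z z * F₂ z z *
      (-(((n : ℂ) - 1) * ((n : ℂ) - 1 + 2 * p)) / (4 * (‖z‖ : ℂ)) + scalarCurv n z / 2 +
        ∑ i, ∑ j, gInv n z j i * ((-(p : ℂ) - n + 1 / 2) / (2 * (‖z‖ : ℂ) ^ 4)) *
          (z j * (starRingEnd ℂ) (z i) - (‖z‖ : ℂ) ^ 2 * if i = j then 1 else 0))

/-- Uniform growth, as `ħ → 0`, of a family `F ħ` of functions of `u ∈ ℂⁿ` (extended symbols with
one argument fixed at `z`): for all small `ħ > 0` and all `u`,
`|F ħ u| |T(u,z)| ≤ C exp (C |u|) (|T(u,z)| + exp (θ |z| / ħ))` with `θ < 1`.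
So `F ħ` is bounded by `2 C exp (C |u|)` where `|T(u,z)| ≥ exp (θ |z| / ħ)`, in particular near
`u = z`; elsewhere (there `F ħ` may have poles, at the zeros of `T(·,z)`) the bound is weaker. -/
def UniformGrowth (n : ℕ) (p : ℝ) (z : Cn n) (F : ℝ → Cn n → ℂ) : Prop :=
  ∃ C θ : ℝ, θ < 1 ∧ ∀ᶠ ħ in 𝓝[>] (0 : ℝ), ∀ u : Cn n,
    ‖F ħ u‖ * ‖kernelT n p ħ u z‖ ≤
      C * Real.exp (C * ‖u‖) * (‖kernelT n p ħ u z‖ + Real.exp (θ * ‖z‖ / ħ))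

end

end BerezinSphere

/-!
The integral transform `h ↦ (u ↦ ⟪K(·, u), h⟫)` maps the closed span of the coherent states
isometrically into the holomorphic functions in `L²(m)`. Everything rests on this isometry.

**The isometry.** The measure `m` is a mixture of complex Gaussian measures (`mMeasure_eq`), so its
radial moments are `(n)_l (n+p)_l ħ^(2l)`, and by unitary invariance the pairing of two power
series in `u ⬝ w` and `u ⬝ z` is again a power series (`UnitaryInvariant.hasSum_integral`). Hence
`⟪K(·, w), K(·, z)⟫ = T(w, z)` (`inner_coh`), and `T` is reproducing for `L²(m)`
(`integral_kernelT_mul_conj`), which is the isometry `integral_transform`. The coherent states span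
`𝒪` (`holSpace_le_cohSpan`): a function orthogonal to them is orthogonal to all functions
`x ↦ (y ⬝ x) ^ l`, hence to the dilates of every function holomorphic in the ball.

**The algebra.** For operators `A₁`, `A₂` put `h₁ = A₁* K(·, z)` and `h₂ = A₂ K(·, z)`. The
extended symbols are `f₁(u, z) = conj (⟪K(·, u), h₁⟫ / T(u, z))` and
`f₂(z, u) = ⟪K(·, u), h₂⟫ / T(u, z)`, so that the integral defining `(f₁ * f₂)(z)` is
`⟪h₁, h₂⟫ / T(z, z)`, the symbol of `A₁ A₂` (`starProd_symbol`). The extension of a symbol off the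
diagonal is unique by analytic continuation from the antidiagonal (`inner_coh_eq_zero_of_diag`).
Unit and associativity are those of composition.

**The expansion.** It remains to expand `⟪h₁, h₂⟫ / T(z, z)` as `ħ → 0`, without any asymptotic
expansion of Bessel functions. With `F = ⟪K(·, u), h⟫ / T(u, z)`, expand `F` at `z` to first
order. This decomposes `h` into a multiple of `K(·, z)`, a vector with transform `(u ⬝ a) T(u, z)`,
where `a` is the gradient of `F`, and a remainder (`exists_decomposition`). The Bessel equation says
that multiplication by `u ⬝ a` is adjoint to `ħ² ∂_a (n + p - 1 + E)` with the Euler operator `E`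
(`exists_gradient_vector`). So all inner products but that of the two remainders are derivatives at
the single point `z` (`exists_inner_eq`), where `E T / T = |z| / ħ + O(1)` (`exists_eulerRatio`); the
first order term is `ħ |z| (a₁ ⬝ a₂ + (a₁ ⬝ z) (z ⬝ a₂) / |z|²)`. The remainders have squared norm
`O(ħ²) T(z, z)`: near `z` their transforms are bounded by `|u - z|² |T(u, z)|`, and the fourth moment
`∫ |u - z|⁴ |T(u, z)|² dm` is a sum of Bessel moments in which the leading terms cancel
(`exists_integral_norm_sub_pow_four_le`); away from `z` the growth condition makes the contribution
exponentially small. The lower bound for `|T(u, z)|` near `z`, needed for the Cauchy estimates, comes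
from the monotonicity of `|₀F₁|` along vertical lines (`norm_theta_re_le`).

**The geometry.** For the potential `2 |w|` the inverse metric is `|w| (δ + w̄_j w_i / |w|²)` and the
scalar curvature is `-n (n - 1) / (2 |w|)`. The three terms without derivatives in the first order
coefficient add up to zero (`firstOrder_eq`), and the remaining one is the expression found above
(`firstOrder_eq_cdot`).
-/

namespace BerezinSphere

noncomputable section

/-! ### The power series `₀F₁` -/

theorem poch_zero (b : ℝ) : poch b 0 = 1 := by simp [poch]

theorem poch_succ (b : ℝ) (l : ℕ) : poch b (l + 1) = poch b l * (b + l) := by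
  simp [poch, ascPochhammer_succ_eval]

theorem poch_succ_left (b : ℝ) (l : ℕ) : poch b (l + 1) = b * poch (b + 1) l := by
  induction l with
  | zero => simp [poch_succ, poch_zero]
  | succ k ih =>
    rw [poch_succ, ih, poch_succ]
    push_cast
    ring

theorem poch_pos {b : ℝ} (hb : 0 < b) (l : ℕ) : 0 < poch b l := by
  induction l with
  | zero => simp [poch_zero]
  | succ k ih =>
    rw [poch_succ]
    positivity

theorem le_poch {b : ℝ} (hb : 0 < b) (l : ℕ) : (min b 1) ^ l * l.factorial ≤ poch b l := by
  induction l with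
  | zero => simp [poch_zero]
  | succ k ih =>
    rw [poch_succ, pow_succ, Nat.factorial_succ]
    push_cast
    have h0 : 0 < min b 1 := lt_min hb one_pos
    have h1 : min b 1 * ((k : ℝ) + 1) ≤ b + k := by
      have h2 : min b 1 * (k : ℝ) ≤ 1 * k := by gcongr; exact min_le_right _ _
      have h3 := min_le_left b 1
      nlinarith
    calc (min b 1) ^ k * min b 1 * (((k : ℝ) + 1) * k.factorial)
        = (min b 1) ^ k * k.factorial * (min b 1 * ((k : ℝ) + 1)) := by ring
      _ ≤ poch b k * (b + k) := mul_le_mul ih h1 (by positivity) (poch_pos hb k).le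

/-- The coefficients of a power series of exponential type. -/
def ExpType (c : ℕ → ℂ) : Prop := ∃ M : ℝ, 0 ≤ M ∧ ∀ l, ‖c l‖ ≤ M ^ l / l.factorial

theorem ExpType.summable {c : ℕ → ℂ} (hc : ExpType c) (r : ℝ) :
    Summable fun l => ‖c l‖ * r ^ l := by
  obtain ⟨M, hM0, hM⟩ := hc
  refine Summable.of_norm_bounded (Real.summable_pow_div_factorial (M * |r|)) fun l => ?_
  rw [norm_mul, norm_norm, norm_pow, Real.norm_eq_abs, mul_pow, ← div_mul_eq_mul_div]
  gcongr
  exact hM l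

theorem ExpType.hasFPowerSeriesOnBall {c : ℕ → ℂ} (hc : ExpType c) (A : Type*) [NormedRing A]
    [NormedAlgebra ℂ A] [CompleteSpace A] :
    HasFPowerSeriesOnBall (FormalMultilinearSeries.ofScalarsSum (E := A) c)
      (FormalMultilinearSeries.ofScalars A c) 0 ⊤ := by
  have hr : (FormalMultilinearSeries.ofScalars A c).radius = ⊤ := by
    refine FormalMultilinearSeries.radius_eq_top_of_summable_norm _ fun r => ?_
    refine (summable_nat_add_iff 1).1 ?_
    refine Summable.of_nonneg_of_le (fun l => by positivity) (fun l => ?_)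
      ((summable_nat_add_iff 1).2 (hc.summable r))
    gcongr
    exact FormalMultilinearSeries.ofScalars_norm_le A c (n := l + 1) (by omega)
  have := (FormalMultilinearSeries.ofScalars A c).hasFPowerSeriesOnBall (by simp [hr])
  rwa [hr] at this

theorem ExpType.contDiff {c : ℕ → ℂ} (hc : ExpType c) (A : Type*) [NormedRing A]
    [NormedAlgebra ℂ A] [CompleteSpace A] (k : WithTop ℕ∞) :
    ContDiff ℂ k (FormalMultilinearSeries.ofScalarsSum (E := A) c) := by
  refine contDiff_iff_contDiffAt.2 fun x => ?_
  exact ((hc.hasFPowerSeriesOnBall A).analyticOnNhd x (by simp)).contDiffAt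

/-- The entire function `₀F₁(b; τ) = ∑ τ ^ l / (l! (b)_l)`. -/
def theta (b : ℝ) (t : ℂ) : ℂ := ∑' l : ℕ, t ^ l / ((l.factorial : ℂ) * (poch b l : ℂ))

/-- The coefficients `1 / (l! (b)_l)` of `theta b`. -/
def thetaCoeff (b : ℝ) (l : ℕ) : ℝ := 1 / (l.factorial * poch b l)

theorem thetaCoeff_pos {b : ℝ} (hb : 0 < b) (l : ℕ) : 0 < thetaCoeff b l := by
  have := poch_pos hb l
  unfold thetaCoeff
  positivity

theorem theta_eq (b : ℝ) (t : ℂ) : theta b t = ∑' l : ℕ, (thetaCoeff b l : ℂ) * t ^ l := by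
  unfold theta thetaCoeff
  congr 1 with l
  push_cast
  ring

theorem thetaCoeff_le {b : ℝ} (hb : 0 < b) (l : ℕ) :
    thetaCoeff b l ≤ ((min b 1)⁻¹) ^ l / (l.factorial * l.factorial) := by
  have h0 : 0 < min b 1 := lt_min hb one_pos
  have := le_poch hb l
  have := poch_pos hb l
  unfold thetaCoeff
  rw [inv_pow, div_le_div_iff₀ (by positivity) (by positivity), inv_mul_eq_div,
    le_div_iff₀ (by positivity)]
  nlinarith [mul_le_mul_of_nonneg_left (le_poch hb l)
    (show (0 : ℝ) ≤ l.factorial by positivity)]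

theorem thetaCoeff_expType {b : ℝ} (hb : 0 < b) : ExpType fun l => (thetaCoeff b l : ℂ) := by
  have h0 : 0 < min b 1 := lt_min hb one_pos
  refine ⟨(min b 1)⁻¹, by positivity, fun l => ?_⟩
  rw [Complex.norm_real, Real.norm_eq_abs, abs_of_pos (thetaCoeff_pos hb l)]
  refine (thetaCoeff_le hb l).trans ?_
  gcongr
  have : (1 : ℝ) ≤ l.factorial := by exact_mod_cast l.factorial_pos
  nlinarith

theorem summable_theta_norm {b : ℝ} (hb : 0 < b) (r : ℝ) :
    Summable fun l => thetaCoeff b l * r ^ l := by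
  have := (thetaCoeff_expType hb).summable r
  simpa [abs_of_pos (thetaCoeff_pos hb _)] using this

theorem summable_theta {b : ℝ} (hb : 0 < b) (t : ℂ) :
    Summable fun l => (thetaCoeff b l : ℂ) * t ^ l := by
  refine Summable.of_norm ?_
  simpa [abs_of_pos (thetaCoeff_pos hb _)] using summable_theta_norm hb ‖t‖

theorem thetaCoeff_succ {b : ℝ} (hb : 0 < b) (l : ℕ) :
    ((l : ℝ) + 1) * thetaCoeff b (l + 1) = thetaCoeff (b + 1) l / b := by
  have := poch_pos (show 0 < b + 1 by linarith) l
  unfold thetaCoeff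
  rw [poch_succ_left, Nat.factorial_succ]
  push_cast
  field_simp

theorem thetaCoeff_succ' {b : ℝ} (hb : 0 < b) (l : ℕ) :
    ((l : ℝ) + 1) * (b + l) * thetaCoeff b (l + 1) = thetaCoeff b l := by
  have := poch_pos hb l
  have h2 : 0 < b + l := by positivity
  unfold thetaCoeff
  rw [poch_succ, Nat.factorial_succ]
  push_cast
  field_simp

theorem hasDerivAt_theta {b : ℝ} (hb : 0 < b) (t : ℂ) :
    HasDerivAt (theta b) (theta (b + 1) t / b) t := by
  have hF : ∀ l : ℕ, ∀ w : ℂ, w ∈ Metric.ball (0 : ℂ) (‖t‖ + 1) →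
      ‖(thetaCoeff b l : ℂ) * w ^ l‖ ≤ thetaCoeff b l * (‖t‖ + 1) ^ l := by
    intro l w hw
    have hw' : ‖w‖ ≤ ‖t‖ + 1 := (mem_ball_zero_iff.1 hw).le
    rw [norm_mul, norm_pow, Complex.norm_real, Real.norm_eq_abs, abs_of_pos (thetaCoeff_pos hb l)]
    have := (thetaCoeff_pos hb l).le
    gcongr
  have hd : ∀ l : ℕ, DifferentiableOn ℂ (fun w : ℂ => (thetaCoeff b l : ℂ) * w ^ l)
      (Metric.ball (0 : ℂ) (‖t‖ + 1)) := fun l => by fun_prop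
  have hmem : t ∈ Metric.ball (0 : ℂ) (‖t‖ + 1) := by simp
  have hdiff := (Complex.differentiableOn_tsum_of_summable_norm (summable_theta_norm hb (‖t‖ + 1))
    hd Metric.isOpen_ball hF).differentiableAt (Metric.isOpen_ball.mem_nhds hmem)
  have hs := Complex.hasSum_deriv_of_summable_norm (summable_theta_norm hb (‖t‖ + 1)) hd
    Metric.isOpen_ball hF hmem
  have hfun : (fun w : ℂ => ∑' l : ℕ, (thetaCoeff b l : ℂ) * w ^ l) = theta b :=
    funext fun w => (theta_eq b w).symm
  rw [hfun] at hdiff hs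
  have hval : deriv (theta b) t = theta (b + 1) t / b := by
    rw [← hs.tsum_eq, hs.summable.tsum_eq_zero_add, theta_eq, ← tsum_div_const]
    simp only [pow_zero, mul_one, deriv_const, zero_add]
    congr 1 with l
    rw [deriv_const_mul_field, deriv_pow_field]
    have := congrArg (fun r : ℝ => (r : ℂ)) (thetaCoeff_succ hb l)
    push_cast at this ⊢
    linear_combination this * t ^ l
  exact hval ▸ hdiff.hasDerivAt

theorem differentiable_theta {b : ℝ} (hb : 0 < b) : Differentiable ℂ (theta b) :=
  fun t => (hasDerivAt_theta hb t).differentiableAt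

/-- The differential equation `τ Θ'' + b Θ' = Θ` of `Θ = ₀F₁(b; ·)`, in contiguous form. -/
theorem theta_contiguous {b : ℝ} (hb : 0 < b) (t : ℂ) :
    t * theta (b + 1 + 1) t / (b * (b + 1)) + theta (b + 1) t = theta b t := by
  have hb1 : 0 < b + 1 := by linarith
  have hb2 : 0 < b + 1 + 1 := by linarith
  simp only [theta_eq]
  rw [(summable_theta hb t).tsum_eq_zero_add, (summable_theta hb1 t).tsum_eq_zero_add,
    mul_div_assoc, ← tsum_div_const, ← tsum_mul_left]
  have h0 : (thetaCoeff b 0 : ℂ) = thetaCoeff (b + 1) 0 := by simp [thetaCoeff, poch_zero]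
  rw [h0, add_left_comm, ← Summable.tsum_add]
  · congr 2 with l
    have h1 := thetaCoeff_succ hb1 l
    have h2 := thetaCoeff_succ' hb l
    have h3 := thetaCoeff_succ' hb1 l
    have h4 := thetaCoeff_succ hb l
    have key : thetaCoeff (b + 1 + 1) l / (b * (b + 1)) + thetaCoeff (b + 1) (l + 1) =
        thetaCoeff b (l + 1) := by
      have h5 : thetaCoeff (b + 1 + 1) l = (b + 1) * (((l : ℝ) + 1) * thetaCoeff (b + 1) (l + 1)) := by
        rw [h1]; field_simp
      have h6 : thetaCoeff b (l + 1) * (l + 1) * b =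
          (l + 1) * (b + 1 + l) * thetaCoeff (b + 1) (l + 1) := by
        rw [h3]
        field_simp at h4
        linarith
      have h7 : thetaCoeff b (l + 1) * b = (b + 1 + l) * thetaCoeff (b + 1) (l + 1) := by
        have : ((l : ℝ) + 1) ≠ 0 := by positivity
        apply mul_left_cancel₀ this
        linarith
      rw [h5]
      field_simp
      linarith
    have key' := congrArg (fun r : ℝ => (r : ℂ)) key
    push_cast at key'
    rw [← key']
    ring
  · exact ((summable_theta hb2 t).div_const _).mul_left _
  · exact (summable_nat_add_iff 1).2 (summable_theta hb1 t)

theorem theta_conj (b : ℝ) (t : ℂ) :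
    theta b ((starRingEnd ℂ) t) = (starRingEnd ℂ) (theta b t) := by
  rw [theta_eq, theta_eq, Complex.conj_tsum]
  simp

/-- The real function `₀F₁(b; y)`. -/
def thetaR (b y : ℝ) : ℝ := ∑' l : ℕ, thetaCoeff b l * y ^ l

theorem theta_ofReal (b y : ℝ) : theta b (y : ℂ) = (thetaR b y : ℂ) := by
  rw [theta_eq, thetaR, Complex.ofReal_tsum]
  simp

theorem thetaR_mono {b : ℝ} (hb : 0 < b) {x y : ℝ} (hx : 0 ≤ x) (hxy : x ≤ y) :
    thetaR b x ≤ thetaR b y := by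
  refine Summable.tsum_le_tsum (fun l => ?_) (summable_theta_norm hb x) (summable_theta_norm hb y)
  have := (thetaCoeff_pos hb l).le
  gcongr

theorem thetaR_zero (b : ℝ) : thetaR b 0 = 1 := by
  rw [thetaR, tsum_eq_single 0 fun l hl => by simp [hl]]
  simp [thetaCoeff, poch_zero]

theorem one_le_thetaR {b : ℝ} (hb : 0 < b) {y : ℝ} (hy : 0 ≤ y) : 1 ≤ thetaR b y :=
  thetaR_zero b ▸ thetaR_mono hb le_rfl hy

theorem norm_theta_le {b : ℝ} (hb : 0 < b) (t : ℂ) : ‖theta b t‖ ≤ thetaR b ‖t‖ := by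
  rw [theta_eq, thetaR]
  have h := summable_theta_norm hb ‖t‖
  refine tsum_of_norm_bounded h.hasSum fun l => ?_
  rw [norm_mul, norm_pow, Complex.norm_real, Real.norm_eq_abs, abs_of_pos (thetaCoeff_pos hb l)]

theorem thetaR_mul_le {b : ℝ} (hb : 0 < b) {x y : ℝ} (hx : 0 ≤ x) (hy : 0 ≤ y) :
    thetaR b (x * y) ≤ Real.exp (x + (min b 1)⁻¹ * y) := by
  have h0 : 0 < min b 1 := lt_min hb one_pos
  have hexp : ∀ t : ℝ, HasSum (fun l : ℕ => t ^ l / l.factorial) (Real.exp t) := fun t => by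
    rw [Real.exp_eq_exp_ℝ]
    exact NormedSpace.expSeries_div_hasSum_exp t
  rw [Real.exp_add, thetaR]
  have h1 := (hexp ((min b 1)⁻¹ * y)).mul_left (Real.exp x)
  refine (Summable.tsum_le_tsum (fun l => ?_) (summable_theta_norm hb _) h1.summable).trans
    h1.tsum_eq.le
  have h2 : x ^ l / l.factorial ≤ Real.exp x :=
    le_hasSum (hexp x) l fun k _ => by positivity
  calc thetaCoeff b l * (x * y) ^ l
      ≤ ((min b 1)⁻¹) ^ l / (l.factorial * l.factorial) * (x * y) ^ l := by
        gcongr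
        exact thetaCoeff_le hb l
    _ = x ^ l / l.factorial * (((min b 1)⁻¹ * y) ^ l / l.factorial) := by
        rw [mul_pow, mul_pow]; field_simp
    _ ≤ Real.exp x * (((min b 1)⁻¹ * y) ^ l / l.factorial) := by gcongr

/-- Along the ray through `τ`, the differential equation gives
`(ρ ^ b Im (Θ' conj Θ))' = - ρ ^ b |Θ'|² Im τ`, which fixes the sign of `Im (Θ' conj Θ)`. -/
theorem im_theta_succ_mul_conj_le {b : ℝ} (hb : 0 < b) {t : ℂ} (ht : 0 ≤ t.im) :
    (theta (b + 1) t * (starRingEnd ℂ) (theta b t)).im ≤ 0 := by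
  have hb1 : 0 < b + 1 := by linarith
  -- up to the factor `b`, `U` and `V` are the derivative and the value of `Θ` at `r t`
  set U : ℝ → ℂ := fun r => theta (b + 1) (r * t) with hU
  set V : ℝ → ℂ := fun r => theta b (r * t) with hV
  have hlin : ∀ r : ℝ, HasDerivAt (fun r : ℝ => (r : ℂ) * t) t r := fun r => by
    simpa using (Complex.ofRealCLM.hasDerivAt (x := r)).mul_const t
  have hUd : ∀ r : ℝ, HasDerivAt U (theta (b + 1 + 1) (r * t) / ((b : ℂ) + 1) * t) r := fun r => by
    have h := (hasDerivAt_theta hb1 (r * t)).comp r (hlin r)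
    exact h.congr_deriv (by push_cast; rfl)
  have hVd : ∀ r : ℝ, HasDerivAt V (U r / b * t) r := fun r => by
    have h := (hasDerivAt_theta hb (r * t)).comp r (hlin r)
    exact h
  set g : ℝ → ℝ := fun r => r ^ b * (U r * (starRingEnd ℂ) (V r)).im with hg
  have hgc : Continuous g := by
    have h1 : Continuous U := continuous_iff_continuousAt.2 fun r => (hUd r).continuousAt
    have h2 : Continuous V := continuous_iff_continuousAt.2 fun r => (hVd r).continuousAt
    exact (Real.continuous_rpow_const hb.le).mul
      (Complex.continuous_im.comp (h1.mul (Complex.continuous_conj.comp h2)))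
  have hgd : ∀ r : ℝ, 0 < r → HasDerivAt g (-(r ^ b * ‖U r‖ ^ 2 / b * t.im)) r := fun r hr => by
    have h1 : HasDerivAt (fun r : ℝ => (starRingEnd ℂ) (V r))
        ((starRingEnd ℂ) (U r / b * t)) r := (hVd r).star
    have h2 := Complex.imCLM.hasFDerivAt.comp_hasDerivAt r ((hUd r).mul h1)
    have h3 := (Real.hasDerivAt_rpow_const (p := b) (Or.inl hr.ne')).mul h2
    refine h3.congr_deriv ?_
    have hode := theta_contiguous hb ((r : ℂ) * t)
    have hV' : theta b (r * t) = V r := rfl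
    have hU' : theta (b + 1) (r * t) = U r := rfl
    rw [hV', hU'] at hode
    have hbc : (b : ℂ) ≠ 0 := by exact_mod_cast hb.ne'
    have hb1c : (b : ℂ) + 1 ≠ 0 := by exact_mod_cast hb1.ne'
    have hrc : (r : ℂ) ≠ 0 := by exact_mod_cast hr.ne'
    -- the differential equation eliminates the second derivative
    have hW : theta (b + 1 + 1) (r * t) / ((b : ℂ) + 1) * t = (V r - U r) * b / r := by
      rw [← hode]
      field_simp
      ring
    rw [hW, Real.rpow_sub_one hr.ne']
    simp only [Complex.imCLM_apply]
    have e1 : ((V r - U r) * b / r * (starRingEnd ℂ) (V r) +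
        U r * (starRingEnd ℂ) (U r / b * t)).im =
        -(b / r * (U r * (starRingEnd ℂ) (V r)).im) - ‖U r‖ ^ 2 / b * t.im := by
      have h4 : (V r - U r) * b / r * (starRingEnd ℂ) (V r) +
          U r * (starRingEnd ℂ) (U r / b * t) =
          (((b / r : ℝ) * ‖V r‖ ^ 2 : ℝ) : ℂ) - ((b / r : ℝ) : ℂ) * (U r * (starRingEnd ℂ) (V r)) +
            ((‖U r‖ ^ 2 / b : ℝ) : ℂ) * (starRingEnd ℂ) t := by
        rw [map_mul, map_div₀, Complex.conj_ofReal]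
        push_cast
        rw [← Complex.mul_conj', ← Complex.mul_conj']
        ring
      rw [h4, Complex.add_im, Complex.sub_im, Complex.ofReal_im, Complex.im_ofReal_mul,
        Complex.im_ofReal_mul, Complex.conj_im]
      ring
    rw [e1]
    simp only [Function.comp_apply, Pi.mul_apply, Complex.imCLM_apply]
    field_simp
    ring
  have hanti : AntitoneOn g (Set.Icc 0 1) := by
    refine antitoneOn_of_deriv_nonpos (convex_Icc 0 1) hgc.continuousOn (fun r hr => ?_) fun r hr => ?_
    · rw [interior_Icc] at hr
      exact (hgd r hr.1).differentiableAt.differentiableWithinAt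
    · rw [interior_Icc] at hr
      rw [(hgd r hr.1).deriv]
      have : 0 ≤ r ^ b := Real.rpow_nonneg hr.1.le b
      have : 0 ≤ r ^ b * ‖U r‖ ^ 2 / b * t.im := by positivity
      linarith
  have := hanti (Set.left_mem_Icc.2 zero_le_one) (Set.right_mem_Icc.2 zero_le_one) zero_le_one
  simpa [hg, hU, hV, Real.zero_rpow hb.ne'] using this

/-- The modulus of `₀F₁(b; ·)` increases along vertical half-lines away from the real axis. -/
theorem norm_theta_re_le {b : ℝ} (hb : 0 < b) (t : ℂ) : ‖theta b (t.re : ℂ)‖ ≤ ‖theta b t‖ := by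
  have main : ∀ s r : ℝ, 0 ≤ r → ‖theta b (s : ℂ)‖ ≤ ‖theta b (s + r * Complex.I)‖ := by
    intro s r hr
    set V : ℝ → ℂ := fun r => theta b (s + r * Complex.I) with hV
    have hVd : ∀ r : ℝ, HasDerivAt V (theta (b + 1) (s + r * Complex.I) / b * Complex.I) r := by
      intro r
      have h1 : HasDerivAt (fun r : ℝ => (s : ℂ) + r * Complex.I) Complex.I r := by
        simpa using ((Complex.ofRealCLM.hasDerivAt (x := r)).mul_const Complex.I).const_add (s : ℂ)
      exact (hasDerivAt_theta hb _).comp r h1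
    have hN : ∀ r : ℝ, HasDerivAt (fun r => ‖V r‖ ^ 2)
        (-(2 / b) * (theta (b + 1) (s + r * Complex.I) * (starRingEnd ℂ) (V r)).im) r := by
      intro r
      have := (hVd r).norm_sq
      refine this.congr_deriv ?_
      rw [Complex.inner, mul_right_comm, mul_comm (_ * _) Complex.I,
        Complex.I_mul_re, div_mul_eq_mul_div, Complex.div_ofReal_im]
      ring
    have hmono : MonotoneOn (fun r => ‖V r‖ ^ 2) (Set.Ici 0) := by
      refine monotoneOn_of_deriv_nonneg (convex_Ici 0)
        (fun r _ => (hN r).continuousAt.continuousWithinAt)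
        (fun r _ => (hN r).differentiableAt.differentiableWithinAt) fun r hr => ?_
      rw [interior_Ici] at hr
      rw [(hN r).deriv]
      have := im_theta_succ_mul_conj_le hb (t := s + r * Complex.I) (by simpa using le_of_lt hr)
      have h2 : 0 < 2 / b := by positivity
      nlinarith
    have := hmono (Set.self_mem_Ici) (Set.mem_Ici.2 hr) hr
    simpa [hV] using (pow_le_pow_iff_left₀ (norm_nonneg _) (norm_nonneg _) two_ne_zero).1 this
  rcases le_total 0 t.im with h | h
  · simpa using main t.re t.im h
  · have := main t.re (-t.im) (by linarith)
    have e : (t.re : ℂ) + ((-t.im : ℝ) : ℂ) * Complex.I = (starRingEnd ℂ) t := by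
      apply Complex.ext <;> simp
    rwa [e, theta_conj, RCLike.norm_conj] at this

/-- `₀F₁(b; y²)` grows at least like `exp (2 η y)` for every `η < 1`, by comparison with the
series of `cosh (2 η y)`. -/
theorem exists_le_thetaR {b : ℝ} (hb : 0 < b) {η : ℝ} (h0 : 0 < η) (h1 : η < 1) :
    ∃ c : ℝ, 0 < c ∧ ∀ y : ℝ, c * Real.exp (2 * η * y) ≤ thetaR b (y ^ 2) := by
  -- quotient of the coefficients of `cosh (2 η y)` and of `₀F₁(b; y²)`, which tends to zero since `η < 1`
  set r : ℕ → ℝ := fun l => l.factorial * poch b l * (4 * η ^ 2) ^ l / (2 * l).factorial with hr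
  -- the quotient is eventually decreasing, hence bounded
  have hstep : ∀ᶠ l : ℕ in atTop, r (l + 1) ≤ r l := by
    have h2 : 0 < 1 - η ^ 2 := by nlinarith
    filter_upwards [eventually_ge_atTop ⌈b / (1 - η ^ 2)⌉₊] with l hl
    have hl' : b / (1 - η ^ 2) ≤ l := (Nat.le_ceil _).trans (by exact_mod_cast hl)
    rw [div_le_iff₀ h2] at hl'
    have hp := poch_pos hb l
    simp only [hr]
    rw [poch_succ, show 2 * (l + 1) = 2 * l + 1 + 1 by ring, Nat.factorial_succ, Nat.factorial_succ,
      Nat.factorial_succ, pow_succ]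
    push_cast
    have h3 : (b + l) * (2 * η ^ 2) ≤ 2 * l + 1 := by nlinarith
    have hf : (0 : ℝ) < (2 * l).factorial := by positivity
    have hf' : (0 : ℝ) < l.factorial := by positivity
    rw [div_le_div_iff₀ (by positivity) hf]
    have e1 : ((l : ℝ) + 1) * l.factorial * (poch b l * (b + l)) * ((4 * η ^ 2) ^ l * (4 * η ^ 2)) *
        (2 * l).factorial = (2 * (l + 1)) * ((b + l) * (2 * η ^ 2)) *
        (l.factorial * poch b l * (4 * η ^ 2) ^ l * (2 * l).factorial) := by ring
    have e2 : l.factorial * poch b l * (4 * η ^ 2) ^ l *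
        ((2 * (l : ℝ) + 1 + 1) * ((2 * l + 1) * (2 * l).factorial)) =
        (2 * (l + 1)) * (2 * l + 1) *
        (l.factorial * poch b l * (4 * η ^ 2) ^ l * (2 * l).factorial) := by ring
    rw [e1, e2]
    gcongr
  obtain ⟨N, hN⟩ := eventually_atTop.1 hstep
  have hbd : BddAbove (Set.range r) := by
    have hanti : ∀ k, r (N + k) ≤ r N := by
      intro k
      induction k with
      | zero => simp
      | succ k ih => exact (hN (N + k) (by omega)).trans ih
    refine ⟨∑ l ∈ Finset.range (N + 1), |r l|, ?_⟩
    rintro _ ⟨l, rfl⟩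
    have hle : ∀ k ≤ N, r k ≤ ∑ l ∈ Finset.range (N + 1), |r l| := fun k hk =>
      (le_abs_self _).trans (Finset.single_le_sum (f := fun l => |r l|) (fun _ _ => abs_nonneg _)
        (Finset.mem_range.2 (by omega)))
    rcases le_total l N with h | h
    · exact hle l h
    · obtain ⟨k, rfl⟩ := Nat.exists_eq_add_of_le h
      exact (hanti k).trans (hle N le_rfl)
  obtain ⟨C, hC⟩ := hbd
  have hC' : ∀ l, r l ≤ C := fun l => hC ⟨l, rfl⟩
  have hC0 : 0 < C := lt_of_lt_of_le (by simp [hr, poch_zero]) (hC' 0)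
  refine ⟨1 / (2 * C), by positivity, fun y => ?_⟩
  have hs : ∀ y : ℝ, HasSum (fun l : ℕ => y ^ (2 * l) / (2 * l).factorial) (Real.cosh y) :=
    fun y => by simpa using Real.hasSum_cosh y
  have hcosh : Real.cosh (2 * η * y) / C ≤ thetaR b (y ^ 2) := by
    rw [← ((hs (2 * η * y)).div_const C).tsum_eq, thetaR]
    refine Summable.tsum_le_tsum (fun l => ?_) ((hs _).div_const C).summable
      (summable_theta_norm hb _)
    have hp := poch_pos hb l
    have := hC' l
    simp only [hr] at this
    rw [div_le_iff₀ (by positivity)] at this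
    unfold thetaCoeff
    rw [div_div, div_mul_eq_mul_div, div_le_div_iff₀ (by positivity) (by positivity)]
    have e : (2 * η * y) ^ (2 * l) = (4 * η ^ 2) ^ l * (y ^ 2) ^ l := by
      rw [← mul_pow, pow_mul]; ring
    have hy : 0 ≤ (y ^ 2) ^ l := by positivity
    rw [e]
    nlinarith [mul_le_mul_of_nonneg_right this hy]
  refine le_trans ?_ hcosh
  rw [Real.cosh_eq, div_mul_eq_mul_div, one_mul, div_div]
  gcongr
  linarith [Real.exp_pos (-(2 * η * y))]

/-! ### Moments of the Bessel distribution -/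

open Polynomial in
theorem summable_thetaCoeff_eval {b : ℝ} (hb : 0 < b) (y : ℝ) (P : ℝ[X]) :
    Summable fun l : ℕ => thetaCoeff b l * y ^ l * P.eval (l : ℝ) := by
  induction P using Polynomial.induction_on' with
  | add p q hp hq => simpa [mul_add] using hp.add hq
  | monomial k a =>
    have hs := (summable_theta_norm hb (|y| * Real.exp 1)).mul_left (|a| * k.factorial)
    refine Summable.of_norm_bounded hs fun l => ?_
    have hc := (thetaCoeff_pos hb l).le
    have h1 : (l : ℝ) ^ k ≤ k.factorial * Real.exp l := by
      have := Real.pow_div_factorial_le_exp (l : ℝ) (by positivity) k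
      rwa [div_le_iff₀ (by positivity), mul_comm] at this
    have h2 : Real.exp (l : ℝ) = Real.exp 1 ^ l := by rw [← Real.exp_nat_mul, mul_one]
    rw [eval_monomial, norm_mul, norm_mul, norm_mul, norm_pow, norm_pow, Real.norm_eq_abs,
      Real.norm_eq_abs, Real.norm_eq_abs, Real.norm_eq_abs, abs_of_nonneg hc, Nat.abs_cast]
    calc thetaCoeff b l * |y| ^ l * (|a| * (l : ℝ) ^ k)
        ≤ thetaCoeff b l * |y| ^ l * (|a| * (k.factorial * Real.exp 1 ^ l)) := by
          rw [← h2]; gcongr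
      _ = |a| * k.factorial * (thetaCoeff b l * (|y| * Real.exp 1) ^ l) := by rw [mul_pow]; ring

open Polynomial in
/-- The unnormalized expectation `∑ P(l) y ^ l / (l! (b)_l)` of a polynomial. -/
def besselSum {b : ℝ} (hb : 0 < b) (y : ℝ) : ℝ[X] →ₗ[ℝ] ℝ where
  toFun P := ∑' l : ℕ, thetaCoeff b l * y ^ l * P.eval (l : ℝ)
  map_add' P Q := by
    rw [← (summable_thetaCoeff_eval hb y P).tsum_add (summable_thetaCoeff_eval hb y Q)]
    simp [mul_add]
  map_smul' a P := by
    rw [RingHom.id_apply, smul_eq_mul, ← tsum_mul_left]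
    congr 1 with l
    simp only [eval_smul, smul_eq_mul]
    ring

open Polynomial in
theorem besselSum_hasSum {b : ℝ} (hb : 0 < b) (y : ℝ) (P : ℝ[X]) :
    HasSum (fun l : ℕ => thetaCoeff b l * y ^ l * P.eval (l : ℝ)) (besselSum hb y P) :=
  (summable_thetaCoeff_eval hb y P).hasSum

theorem besselSum_one {b : ℝ} (hb : 0 < b) (y : ℝ) : besselSum hb y 1 = thetaR b y := by
  simp [besselSum, thetaR]

open Polynomial in
theorem besselSum_mono {b : ℝ} (hb : 0 < b) {y : ℝ} (hy : 0 ≤ y) {P Q : ℝ[X]}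
    (h : ∀ l : ℕ, P.eval (l : ℝ) ≤ Q.eval (l : ℝ)) : besselSum hb y P ≤ besselSum hb y Q := by
  refine hasSum_le (fun l => ?_) (besselSum_hasSum hb y P) (besselSum_hasSum hb y Q)
  have := (thetaCoeff_pos hb l).le
  have := h l
  gcongr

open Polynomial in
/-- The recursion `l (l + b - 1) w_l = y w_{l-1}` of the weights `w_l = y ^ l / (l! (b)_l)`. -/
theorem besselSum_shift {b : ℝ} (hb : 0 < b) (y : ℝ) (P : ℝ[X]) :
    besselSum hb y (X * (X + C (b - 1)) * P) = y * besselSum hb y (P.comp (X + 1)) := by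
  rw [← (besselSum_hasSum hb y _).tsum_eq, (besselSum_hasSum hb y _).summable.tsum_eq_zero_add,
    ← (besselSum_hasSum hb y (P.comp (X + 1))).tsum_eq, ← tsum_mul_left]
  simp only [eval_mul, eval_X, Nat.cast_zero, zero_mul, mul_zero, zero_add, eval_add, eval_C,
    eval_comp, eval_one]
  congr 1 with l
  have := thetaCoeff_succ' hb l
  push_cast
  rw [← this]
  ring

/-- With `T` and `L` the total mass and the first moment of the weights, the comparison `h` bounds the
second moment `V` about `x` by `O(x) T`. -/
theorem besselMean_aux {x T L D b V : ℝ} (hx : 1 ≤ x) (hT : 0 ≤ T) (hD : 0 ≤ D) (hb : 0 < b)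
    (hL0 : 0 ≤ L) (hDb : -(b - 1) ≤ D) (hL : L ≤ (1 + D) * x * T)
    (h : x ^ 2 * V ≤ 2 * (x ^ 2 * (2 * L + b * T)) + 2 * D ^ 2 * (x ^ 2 * T - (b - 1) * L)) :
    V ≤ (4 * (1 + D) + 2 * b + 2 * D ^ 2 * (1 + D * (1 + D))) * x * T := by
  have hx0 : 0 < x := by linarith
  have hTx : T ≤ x * T := le_mul_of_one_le_left hT hx
  have hx2 : 1 ≤ x ^ 2 := one_le_pow₀ hx
  have a1 : 2 * L + b * T ≤ (2 * (1 + D) + b) * (x * T) := by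
    have : b * T ≤ b * (x * T) := by gcongr
    linarith
  have a2 : -(b - 1) * L ≤ x ^ 2 * (D * (1 + D) * (x * T)) := by
    calc -(b - 1) * L ≤ D * L := by gcongr
      _ ≤ D * ((1 + D) * x * T) := by gcongr
      _ = 1 * (D * (1 + D) * (x * T)) := by ring
      _ ≤ x ^ 2 * (D * (1 + D) * (x * T)) := by gcongr
  have a3 : x ^ 2 * T - (b - 1) * L ≤ x ^ 2 * ((1 + D * (1 + D)) * (x * T)) := by
    have : x ^ 2 * T ≤ x ^ 2 * (x * T) := by gcongr
    linarith
  have h1 : x ^ 2 * V ≤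
      x ^ 2 * ((4 * (1 + D) + 2 * b + 2 * D ^ 2 * (1 + D * (1 + D))) * x * T) := by
    refine h.trans ?_
    calc _ ≤ 2 * (x ^ 2 * ((2 * (1 + D) + b) * (x * T))) +
          2 * D ^ 2 * (x ^ 2 * ((1 + D * (1 + D)) * (x * T))) := by gcongr
      _ = _ := by ring
  exact le_of_mul_le_mul_left h1 (by positivity)

open Polynomial in
set_option maxHeartbeats 800000 in
/-- The mean of the Bessel distribution with weights proportional to `x ^ (2 l) / (l! (b)_l)` is
`x + O(1)`. The upper bound is Jensen's inequality in the identity `E[l (l + b - 1)] = x²`; the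
lower bound comes from the variance of `l (l + b - 1)`. -/
theorem exists_besselMean {b : ℝ} (hb : 0 < b) : ∃ K : ℝ, 0 ≤ K ∧ ∀ x : ℝ, 1 ≤ x →
    |besselSum hb (x ^ 2) X - x * thetaR b (x ^ 2)| ≤ K * thetaR b (x ^ 2) := by
  set D : ℝ := |b - 1| with hD
  have hD0 : 0 ≤ D := abs_nonneg _
  set K₂ : ℝ := 4 * (1 + D) + 2 * b + 2 * D ^ 2 * (1 + D * (1 + D)) with hK2
  have hK20 : 0 ≤ K₂ := by positivity
  refine ⟨2 * K₂ + 2 * D, by positivity, fun x hx => ?_⟩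
  have hx0 : 0 < x := by linarith
  set y := x ^ 2 with hy
  set S := besselSum hb y with hS
  set T := thetaR b y with hT
  have hT1 : 1 ≤ T := one_le_thetaR hb (by positivity)
  have hS1 : S 1 = T := besselSum_one hb y
  have hDb : b - 1 ≤ D := le_abs_self _
  have hDb' : -(b - 1) ≤ D := neg_le_abs _
  have hDsq : D ^ 2 = (b - 1) ^ 2 := sq_abs _
  set L := S X with hL
  have hL0 : 0 ≤ L := by
    have := besselSum_mono hb (y := y) (by positivity) (P := 0) (Q := X) (fun l => by simp)
    simpa using this
  -- the mean of `Z = l (l + b - 1)` is `y`; its variance `y (2 E[l] + b)` is computed in `hvar`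
  have hZ : S (X * (X + C (b - 1))) = y * T := by
    have := besselSum_shift hb y 1
    rw [mul_one, one_comp] at this
    rw [hS, this, besselSum_one]
  have hCmul : ∀ (a : ℝ) (P : ℝ[X]), S (C a * P) = a * S P := fun a P => by
    rw [← smul_eq_C_mul, map_smul, smul_eq_mul]
  have hX2 : S (X ^ 2) = y * T - (b - 1) * L := by
    rw [← hZ, show (X : ℝ[X]) * (X + C (b - 1)) = X ^ 2 + C (b - 1) * X by ring, map_add, hCmul]
    ring
  have hsq : S ((X - C x) ^ 2) = 2 * y * T - (2 * x + (b - 1)) * L := by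
    rw [show ((X : ℝ[X]) - C x) ^ 2 = X ^ 2 - C (2 * x) * X + C (x ^ 2) * 1 by
      simp only [map_mul, map_pow]; rw [show (C (2 : ℝ) : ℝ[X]) = 2 from rfl]; ring,
      map_add, map_sub, hCmul, hCmul, hX2, hS1]
    ring
  have hsq0 : 0 ≤ S ((X - C x) ^ 2) := by
    have := besselSum_mono hb (y := y) (by positivity) (P := 0) (Q := (X - C x) ^ 2)
      (fun l => by simp; positivity)
    simpa using this
  have hden : x ≤ 2 * x + (b - 1) := by linarith
  have hupper : L - x * T ≤ D * T := by
    have h1 : (2 * x + (b - 1)) * (L - x * T) ≤ (2 * x + (b - 1)) * (D * T) := by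
      have : (2 * x + (b - 1)) * (L - x * T) ≤ -(b - 1) * x * T := by
        nlinarith
      have h3 : -(b - 1) * x * T ≤ D * x * T := by gcongr
      have h4 : x * (D * T) ≤ (2 * x + (b - 1)) * (D * T) := by gcongr
      nlinarith
    exact le_of_mul_le_mul_left h1 (by linarith)
  have hLx : L ≤ (1 + D) * x * T := by nlinarith [mul_nonneg hD0 (by positivity : 0 ≤ T)]
  have hZ2 : S ((X * (X + C (b - 1))) ^ 2) = y * (y * T + 2 * L + b * T) := by
    have := besselSum_shift hb y (X * (X + C (b - 1)))
    rw [sq]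
    rw [hS, this]
    congr 1
    have e : (X * (X + C (b - 1))).comp (X + 1) = X * (X + C (b - 1)) + C 2 * X + C b * 1 :=
      Polynomial.funext fun r => by
        simp only [eval_comp, eval_mul, eval_add, eval_X, eval_C, eval_one]
        ring
    rw [e, map_add, map_add]
    change S _ + S _ + S _ = _
    rw [hCmul, hCmul, hZ, hS1]
  have hvar : S ((X * (X + C (b - 1)) - C y) ^ 2) = y * (2 * L + b * T) := by
    rw [show ((X : ℝ[X]) * (X + C (b - 1)) - C y) ^ 2 = (X * (X + C (b - 1))) ^ 2 -
      C (2 * y) * (X * (X + C (b - 1))) + C (y ^ 2) * 1 by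
      simp only [map_mul, map_pow]; rw [show (C (2 : ℝ) : ℝ[X]) = 2 from rfl]; ring,
      map_add, map_sub, hCmul, hCmul, hZ2, hZ, hS1]
    ring
  -- `x |l - x| ≤ |l² - x²| ≤ |Z - y| + |b - 1| l` compares the second moment about `x` with `Var Z`
  have hcmp : y * S ((X - C x) ^ 2) ≤
      2 * (y * (2 * L + b * T)) + 2 * D ^ 2 * (y * T - (b - 1) * L) := by
    rw [← hvar, ← hX2, ← hCmul, ← hCmul, ← hCmul, ← map_add]
    refine besselSum_mono hb (by positivity) fun l => ?_
    simp only [eval_mul, eval_C, eval_pow, eval_sub, eval_X, eval_add]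
    have hl : (0 : ℝ) ≤ l := by positivity
    rw [hDsq, hy]
    have h1 : x ^ 2 * ((l : ℝ) - x) ^ 2 ≤ ((l : ℝ) + x) ^ 2 * ((l : ℝ) - x) ^ 2 := by
      gcongr; linarith
    nlinarith [sq_nonneg ((l : ℝ) * (l + (b - 1)) - x ^ 2 + (b - 1) * l)]
  have hsqle : S ((X - C x) ^ 2) ≤ K₂ * x * T :=
    besselMean_aux hx (by positivity) hD0 hb hL0 hDb' hLx hcmp
  have hlower : -(K₂ + D) * T ≤ L - x * T := by
    have h1 : (2 * x + (b - 1)) * (-(K₂ + D) * T) ≤ (2 * x + (b - 1)) * (L - x * T) := by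
      have e : (2 * x + (b - 1)) * (L - x * T) = -S ((X - C x) ^ 2) - (b - 1) * x * T := by
        rw [hsq, hy]; ring
      rw [e]
      have h2 : x * ((K₂ + D) * T) ≤ (2 * x + (b - 1)) * ((K₂ + D) * T) := by gcongr
      have h3 : (b - 1) * x * T ≤ D * x * T := by gcongr
      nlinarith
    exact le_of_mul_le_mul_left h1 (by linarith)
  rw [abs_le]
  have hKT : 0 ≤ K₂ * T := by positivity
  have hDT : 0 ≤ D * T := by positivity
  constructor <;> nlinarith

open Polynomial in
/-- The polynomial whose Bessel sum is the fourth central moment: its quartic and cubic terms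
cancel, so that this moment is of order `x²` only. -/
theorem exists_besselFourth {b : ℝ} (hb : 0 < b) (a : ℝ) : ∃ K : ℝ, 0 ≤ K ∧ ∀ y : ℝ, 1 ≤ y →
    besselSum hb y ((X + C a) * (X + C a + 1) * (X + C b) * (X + C b + 1)) +
      y ^ 2 * besselSum hb y 1 + 2 * (y * besselSum hb y ((X + C a) * (X + C b))) +
      2 * y ^ 2 * besselSum hb y 1 + 2 * (y * besselSum hb y ((X + 1) * (X + C b))) -
      4 * (y * besselSum hb y ((X + C a + 1) * (X + C b + 1))) - 4 * y ^ 2 * besselSum hb y 1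
      ≤ K * y * thetaR b y := by
  -- coefficients of the quadratic polynomial that remains after the cancellation
  set q₂ : ℝ := a * (a + 1) + b * (b + 1) + (2 * a + 1) * (2 * b + 1) - ((b - 1) * (b - 2) - (2 * b - 3)) +
    2 * ((b - 1) ^ 2 + 2 * (b - 1) * (a - 1)) + 2 * (b - 1) ^ 2 -
    4 * (a * b + (b - 1) * (a + b)) with hq2
  set q₁ : ℝ := (2 * a + 1) * (b * (b + 1)) + (2 * b + 1) * (a * (a + 1)) + (b - 1) * (b - 2) +
    2 * (b - 1) ^ 2 * (a - 1) - 4 * (b - 1) * (a * b) with hq1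
  set q₀ : ℝ := a * (a + 1) * (b * (b + 1)) with hq0
  refine ⟨(|q₂| + |q₁|) * (1 + 1 / b) + |q₀|, by positivity, fun y hy => ?_⟩
  set S := besselSum hb y with hS
  have hT1 : 1 ≤ thetaR b y := one_le_thetaR hb (by linarith)
  have hCmul : ∀ (a : ℝ) (P : ℝ[X]), S (C a * P) = a * S P := fun a P => by
    rw [← smul_eq_C_mul, map_smul, smul_eq_mul]
  -- the recursion of the weights absorbs the factors `y` into the polynomials
  have hsh : ∀ P R : ℝ[X], P.comp (X + 1) = R → y * S R = S (X * (X + C (b - 1)) * P) := by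
    rintro P _ rfl
    exact (besselSum_shift hb y P).symm
  have e0 : y * S 1 = S (X * (X + C (b - 1))) := by
    rw [hsh 1 1 (by simp), mul_one]
  have e1 : y ^ 2 * S 1 = S (X * (X + C (b - 1)) * ((X - C 1) * (X + C (b - 2)))) := by
    rw [sq, mul_assoc, e0]
    refine hsh _ _ (Polynomial.funext fun r => ?_)
    simp only [eval_comp, eval_mul, eval_add, eval_sub, eval_X, eval_C, eval_one]
    ring
  have e2 : y * S ((X + C a) * (X + C b)) =
      S (X * (X + C (b - 1)) * ((X + C (a - 1)) * (X + C (b - 1)))) := by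
    refine hsh _ _ (Polynomial.funext fun r => ?_)
    simp only [eval_comp, eval_mul, eval_add, eval_X, eval_C, eval_one]
    ring
  have e3 : y * S ((X + 1) * (X + C b)) =
      S (X * (X + C (b - 1)) * (X * (X + C (b - 1)))) := by
    refine hsh _ _ (Polynomial.funext fun r => ?_)
    simp only [eval_comp, eval_mul, eval_add, eval_X, eval_C, eval_one]
    ring
  have e4 : y * S ((X + C a + 1) * (X + C b + 1)) =
      S (X * (X + C (b - 1)) * ((X + C a) * (X + C b))) := by
    refine hsh _ _ (Polynomial.funext fun r => ?_)
    simp only [eval_comp, eval_mul, eval_add, eval_X, eval_C, eval_one]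
    ring
  have hbound : S (C q₂ * X ^ 2 + C q₁ * X + C q₀) ≤
      S (C ((|q₂| + |q₁|) * (1 + 1 / b)) * (X * (X + C (b - 1))) + C |q₀| * 1) := by
    refine besselSum_mono hb (by linarith) fun l => ?_
    simp only [eval_mul, eval_C, eval_pow, eval_X, eval_add, eval_one]
    have hl : (l : ℝ) ≤ (l : ℝ) ^ 2 := by exact_mod_cast Nat.le_self_pow two_ne_zero l
    have h2 : (l : ℝ) ^ 2 ≤ (1 + 1 / b) * (l * (l + (b - 1))) := by
      rcases Nat.eq_zero_or_pos l with rfl | h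
      · simp
      · have h1 : (1 : ℝ) ≤ l := by exact_mod_cast h
        have h3 : (l : ℝ) ≤ (1 + 1 / b) * (l + (b - 1)) := by
          have : (1 + 1 / b) * (l + (b - 1)) - l = ((l - 1) + b ^ 2) / b := by
            field_simp; ring
          have : 0 ≤ ((l - 1) + b ^ 2) / b := by
            have : 0 ≤ (l : ℝ) - 1 := by linarith
            positivity
          linarith
        nlinarith
    have h5 : q₂ * (l : ℝ) ^ 2 ≤ |q₂| * (l : ℝ) ^ 2 := by gcongr; exact le_abs_self _
    have h6 : q₁ * (l : ℝ) ≤ |q₁| * (l : ℝ) ^ 2 := by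
      calc q₁ * (l : ℝ) ≤ |q₁| * (l : ℝ) := by gcongr; exact le_abs_self _
        _ ≤ _ := by gcongr
    have h7 := le_abs_self q₀
    have h8 := mul_le_mul_of_nonneg_left h2 (show 0 ≤ |q₂| + |q₁| by positivity)
    linarith
  have hval : S (C q₂ * X ^ 2 + C q₁ * X + C q₀) =
      S ((X + C a) * (X + C a + 1) * (X + C b) * (X + C b + 1)) -
      S (X * (X + C (b - 1)) * ((X - C 1) * (X + C (b - 2)))) +
      2 * S (X * (X + C (b - 1)) * ((X + C (a - 1)) * (X + C (b - 1)))) +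
      2 * S (X * (X + C (b - 1)) * (X * (X + C (b - 1)))) -
      4 * S (X * (X + C (b - 1)) * ((X + C a) * (X + C b))) := by
    rw [← hCmul, ← hCmul, ← hCmul, ← map_sub, ← map_add, ← map_add, ← map_sub]
    congr 1
    refine Polynomial.funext fun r => ?_
    simp only [eval_mul, eval_add, eval_sub, eval_X, eval_C, eval_one, eval_pow, hq2, hq1, hq0]
    ring
  rw [← e1, ← e2, ← e3, ← e4] at hval
  rw [hval, map_add, hCmul, hCmul, ← e0, show S 1 = thetaR b y from besselSum_one hb y] at hbound
  have h9 : |q₀| * thetaR b y ≤ |q₀| * (y * thetaR b y) := by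
    gcongr
    nlinarith
  have e5 : 2 * y ^ 2 * S 1 = 2 * (y ^ 2 * S 1) := by ring
  have e6 : 4 * y ^ 2 * S 1 = 4 * (y ^ 2 * S 1) := by ring
  have e7 : S 1 = thetaR b y := besselSum_one hb y
  rw [e5, e6]
  rw [e7]
  linarith

/-! ### The surface measure and polar coordinates -/

theorem finrank_real_Cn (n : ℕ) : Module.finrank ℝ (Cn n) = 2 * n := by
  rw [← Module.finrank_mul_finrank ℝ ℂ (Cn n), Complex.finrank_real_complex,
    finrank_euclideanSpace_fin]

theorem toSphere_univ_ne_zero {n : ℕ} (hn : 0 < n) :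
    (volume : Measure (Cn n)).toSphere Set.univ ≠ 0 := by
  have : NeZero n := ⟨hn.ne'⟩
  have : Nontrivial (Cn n) := by
    refine ⟨⟨0, EuclideanSpace.single 0 1, fun h => ?_⟩⟩
    have := congrArg (fun v : Cn n => v 0) h
    simp at this
  rw [Ne, Measure.measure_univ_eq_zero]
  exact Measure.toSphere_ne_zero _

theorem toSphere_eq {n : ℕ} (hn : 0 < n) :
    (volume : Measure (Cn n)).toSphere =
      (volume : Measure (Cn n)).toSphere Set.univ • sphereMeasure n := by
  rw [sphereMeasure, smul_smul, ENNReal.mul_inv_cancel (toSphere_univ_ne_zero hn)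
    (measure_ne_top _ _), one_smul]

theorem isProbabilityMeasure_sphereMeasure {n : ℕ} (hn : 0 < n) :
    IsProbabilityMeasure (sphereMeasure n) := by
  constructor
  rw [sphereMeasure, Measure.smul_apply, smul_eq_mul,
    ENNReal.inv_mul_cancel (toSphere_univ_ne_zero hn) (measure_ne_top _ _)]

theorem lintegral_polar {n : ℕ} (hn : 0 < n) {f : Cn n → ENNReal} (hf : Measurable f) :
    ∫⁻ u, f u = (volume : Measure (Cn n)).toSphere Set.univ *
      ∫⁻ r : Set.Ioi (0 : ℝ), ∫⁻ x, f ((r : ℝ) • (x : Cn n)) ∂(sphereMeasure n)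
        ∂(Measure.volumeIoiPow (Module.finrank ℝ (Cn n) - 1)) := by
  have : NeZero n := ⟨hn.ne'⟩
  have : Nontrivial (Cn n) := by
    refine ⟨⟨0, EuclideanSpace.single 0 1, fun h => ?_⟩⟩
    have := congrArg (fun v : Cn n => v 0) h
    simp at this
  have h1 : ∫⁻ u, f u = ∫⁻ u : ({(0 : Cn n)}ᶜ : Set (Cn n)), f u
      ∂((volume : Measure (Cn n)).comap Subtype.val) := by
    rw [lintegral_subtype_comap (measurableSet_singleton _).compl, restrict_compl_singleton]
  have h2 := (volume : Measure (Cn n)).measurePreserving_homeomorphUnitSphereProd.lintegral_comp_emb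
    (Homeomorph.measurableEmbedding _) fun q => f ((q.2 : ℝ) • (q.1 : Cn n))
  rw [h1]
  have h3 : ∀ u : ({(0 : Cn n)}ᶜ : Set (Cn n)), f u =
      f (((homeomorphUnitSphereProd (Cn n) u).2 : ℝ) •
        ((homeomorphUnitSphereProd (Cn n) u).1 : Cn n)) := by
    intro u
    have hu : ‖(u : Cn n)‖ ≠ 0 := norm_ne_zero_iff.2 u.2
    simp [smul_smul, hu]
  rw [lintegral_congr h3, h2]
  rw [lintegral_prod_symm _ (by fun_prop)]
  rw [← lintegral_const_mul]
  · refine lintegral_congr fun r => ?_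
    conv_lhs => rw [toSphere_eq hn, lintegral_smul_measure]
    rfl
  · exact Measurable.lintegral_prod_right' (f := fun q : Set.Ioi (0 : ℝ) × Sph n =>
      f ((q.1 : ℝ) • (q.2 : Cn n))) (by fun_prop)

/-- A radial density allows to average over spheres. -/
theorem lintegral_mul_radial {n : ℕ} (hn : 0 < n) {f : Cn n → ENNReal} (hf : Measurable f)
    {g : ℝ → ENNReal} (hg : Measurable g) :
    ∫⁻ u, f u * g ‖u‖ =
      ∫⁻ u : Cn n, (∫⁻ x, f (‖u‖ • (x : Cn n)) ∂(sphereMeasure n)) * g ‖u‖ := by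
  have := isProbabilityMeasure_sphereMeasure hn
  have hm : Measurable fun r : ℝ => ∫⁻ x : Sph n, f (r • (x : Cn n)) ∂(sphereMeasure n) :=
    Measurable.lintegral_prod_right' (f := fun q : ℝ × Sph n => f (q.1 • (q.2 : Cn n)))
      (by fun_prop)
  rw [lintegral_polar hn (by fun_prop), lintegral_polar hn (by fun_prop)]
  congr 1
  refine lintegral_congr fun r => ?_
  have hr : ∀ x : Sph n, ‖(r : ℝ) • (x : Cn n)‖ = r := fun x => by
    have : (0 : ℝ) < r := r.2
    simp [norm_smul, abs_of_pos this]
  simp only [hr]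
  rw [lintegral_mul_const _ (by fun_prop), lintegral_const, measure_univ, mul_one]

/-- A measure on `ℂⁿ` that is invariant under the unitary group. -/
def UnitaryInvariant {n : ℕ} (ν : Measure (Cn n)) : Prop :=
  ∀ U : Cn n ≃ₗᵢ[ℂ] Cn n, MeasurePreserving U ν ν

theorem unitaryInvariant_volume (n : ℕ) : UnitaryInvariant (volume : Measure (Cn n)) := by
  intro U
  exact LinearIsometryEquiv.measurePreserving
    ({ U.toLinearEquiv.restrictScalars ℝ with norm_map' := U.norm_map } : Cn n ≃ₗᵢ[ℝ] Cn n)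

theorem UnitaryInvariant.withDensity_norm {n : ℕ} {ν : Measure (Cn n)} (hν : UnitaryInvariant ν)
    {g : Cn n → ENNReal} (hg : Measurable g) (hU : ∀ U : Cn n ≃ₗᵢ[ℂ] Cn n, ∀ u, g (U u) = g u) :
    UnitaryInvariant (ν.withDensity g) := by
  intro U
  refine ⟨U.continuous.measurable, ?_⟩
  ext s hs
  rw [Measure.map_apply U.continuous.measurable hs, withDensity_apply _ hs,
    withDensity_apply _ (U.continuous.measurable hs),
    ← (hν U).setLIntegral_comp_preimage hs hg]
  simp only [hU]

/-- The surface measure, as a measure on `ℂⁿ`. -/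
def sphereMeasure' (n : ℕ) : Measure (Cn n) := (sphereMeasure n).map Subtype.val

theorem unitaryInvariant_sphereMeasure' {n : ℕ} (hn : 0 < n) :
    UnitaryInvariant (sphereMeasure' n) := by
  intro U
  refine ⟨U.continuous.measurable, ?_⟩
  have := isProbabilityMeasure_sphereMeasure hn
  -- the surface measure of `s` is the volume of the cone over `s`, up to normalization
  set g : ℝ → ENNReal := (Set.Ioo (0 : ℝ) 1).indicator 1 with hg
  have hgm : Measurable g := measurable_one.indicator measurableSet_Ioo
  have key : ∀ s : Set (Cn n), MeasurableSet s →
      ∫⁻ u : Cn n, s.indicator 1 (‖u‖⁻¹ • u) * g ‖u‖ =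
        sphereMeasure' n s * ∫⁻ u : Cn n, g ‖u‖ := by
    intro s hs
    have hf : Measurable fun u : Cn n => s.indicator (1 : Cn n → ENNReal) (‖u‖⁻¹ • u) :=
      (measurable_one.indicator hs).comp (by fun_prop)
    rw [lintegral_mul_radial hn hf hgm, ← lintegral_const_mul _ (by fun_prop)]
    refine lintegral_congr fun u => ?_
    rcases eq_or_ne u 0 with rfl | hu
    · simp [hg]
    · congr 1
      have hu' : 0 < ‖u‖ := norm_pos_iff.2 hu
      rw [sphereMeasure', Measure.map_apply measurable_subtype_coe hs,
        ← lintegral_indicator_one (measurable_subtype_coe hs)]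
      refine lintegral_congr fun x => ?_
      have : ‖‖u‖ • (x : Cn n)‖⁻¹ • (‖u‖ • (x : Cn n)) = x := by
        simp [norm_smul, smul_smul, hu'.ne']
      rw [this]
      rfl
  have hpos : ∫⁻ u : Cn n, g ‖u‖ ≠ 0 ∧ ∫⁻ u : Cn n, g ‖u‖ ≠ ⊤ := by
    have e : ∀ u : Cn n, g ‖u‖ = (Metric.ball (0 : Cn n) 1 \ {0}).indicator 1 u := by
      intro u
      by_cases hu : u = 0
      · simp [hg, hu]
      · have : 0 < ‖u‖ := norm_pos_iff.2 hu
        simp [hg, Set.indicator, hu]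
    simp_rw [e]
    rw [lintegral_indicator_one (Metric.isOpen_ball.measurableSet.diff (measurableSet_singleton _))]
    have : Nonempty (Fin n) := ⟨⟨0, hn⟩⟩
    have : Nontrivial (Cn n) := inferInstance
    rw [measure_sdiff_null (measure_singleton _)]
    exact ⟨(Metric.measure_ball_pos _ _ one_pos).ne', measure_ball_lt_top.ne⟩
  ext s hs
  rw [Measure.map_apply U.continuous.measurable hs]
  refine (ENNReal.mul_left_inj hpos.1 hpos.2).1 ?_
  rw [← key s hs, ← key _ (U.continuous.measurable hs)]
  have hm : Measurable fun u : Cn n => s.indicator (1 : Cn n → ENNReal) (‖u‖⁻¹ • u) * g ‖u‖ :=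
    ((measurable_one.indicator hs).comp (by fun_prop)).mul (by fun_prop)
  rw [← (unitaryInvariant_volume n U).lintegral_comp hm]
  refine lintegral_congr fun u => ?_
  have e : U (‖u‖⁻¹ • u) = ‖u‖⁻¹ • U u := LinearMapClass.map_smul_of_tower U _ _
  rw [U.norm_map, ← e]
  rfl

theorem lintegral_sphereMeasure' {n : ℕ} {f : Cn n → ENNReal} (hf : Measurable f) :
    ∫⁻ u, f u ∂(sphereMeasure' n) = ∫⁻ x, f (x : Cn n) ∂(sphereMeasure n) :=
  lintegral_map hf measurable_subtype_coe

/-! ### Gaussian moments -/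

/-- The Gaussian moments `∫ |u| ^ (2 j) exp (-c |u|²) du = (n)_j π ^ n / c ^ (n + j)`. -/
theorem lintegral_pow_mul_gaussian {n : ℕ} (hn : 0 < n) (j : ℕ) {c : ℝ} (hc : 0 < c) :
    ∫⁻ u : Cn n, ENNReal.ofReal (‖u‖ ^ (2 * j) * Real.exp (-c * ‖u‖ ^ 2)) =
      ENNReal.ofReal (poch n j * (Real.pi ^ n / c ^ (n + j))) := by
  have : Nonempty (Fin n) := ⟨⟨0, hn⟩⟩
  have hΓ : ∀ j : ℕ, IntegrableOn (fun y : ℝ => y ^ (2 * n - 1) •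
      (y ^ (2 * j) * Real.exp (-c * y ^ 2))) (Set.Ioi 0) ∧
      ∫ y in Set.Ioi (0 : ℝ), y ^ (2 * n - 1) • (y ^ (2 * j) * Real.exp (-c * y ^ 2)) =
      Real.Gamma (n + j) / (2 * c ^ (n + j)) := by
    intro j
    have e : ∀ y ∈ Set.Ioi (0 : ℝ), y ^ (((2 * n - 1 + 2 * j : ℕ) : ℝ)) *
        Real.exp (-c * y ^ (2 : ℝ)) = y ^ (2 * n - 1) • (y ^ (2 * j) * Real.exp (-c * y ^ 2)) := by
      intro y hy
      rw [Real.rpow_natCast, Real.rpow_two, pow_add, smul_eq_mul, mul_assoc]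
    have hq : (-1 : ℝ) < ((2 * n - 1 + 2 * j : ℕ) : ℝ) :=
      lt_of_lt_of_le (by norm_num) (Nat.cast_nonneg _)
    refine ⟨(integrableOn_rpow_mul_exp_neg_mul_rpow hq two_pos hc).congr_fun e
      measurableSet_Ioi, ?_⟩
    rw [← setIntegral_congr_fun measurableSet_Ioi e,
      integral_rpow_mul_exp_neg_mul_rpow two_pos hq hc]
    have h1 : (((2 * n - 1 + 2 * j : ℕ) : ℝ) + 1) / 2 = n + j := by
      have : ((2 * n - 1 + 2 * j : ℕ) : ℝ) + 1 = ((2 * n - 1 + 2 * j + 1 : ℕ) : ℝ) := by push_cast; ring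
      rw [this, show 2 * n - 1 + 2 * j + 1 = 2 * (n + j) by omega]
      push_cast
      ring
    rw [show -(((2 * n - 1 + 2 * j : ℕ) : ℝ) + 1) / 2 = -((((2 * n - 1 + 2 * j : ℕ) : ℝ) + 1) / 2) by ring,
      h1, Real.rpow_neg hc.le, ← Nat.cast_add, Real.rpow_natCast]
    field_simp
  have hI : ∀ j : ℕ, ∫ u : Cn n, ‖u‖ ^ (2 * j) * Real.exp (-c * ‖u‖ ^ 2) =
      (2 * n : ℕ) • (volume : Measure (Cn n)).real (Metric.ball 0 1) •
        (Real.Gamma (n + j) / (2 * c ^ (n + j))) := by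
    intro j
    rw [integral_fun_norm_addHaar volume fun y : ℝ => y ^ (2 * j) * Real.exp (-c * y ^ 2),
      finrank_real_Cn, (hΓ j).2]
  have h0 : ∫ u : Cn n, Real.exp (-c * ‖u‖ ^ 2) = (Real.pi / c) ^ n := by
    rw [GaussianFourier.integral_rexp_neg_mul_sq_norm hc, finrank_real_Cn]
    push_cast
    rw [mul_div_cancel_left₀ _ two_ne_zero, Real.rpow_natCast]
  have h1 := hI 0
  simp only [mul_zero, pow_zero, one_mul, h0, nsmul_eq_mul, smul_eq_mul, Nat.cast_zero,
    add_zero] at h1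
  have hpoch : ∀ j : ℕ, Real.Gamma (n + j) = poch n j * Real.Gamma n := by
    intro j
    induction j with
    | zero => simp [poch_zero]
    | succ k ih =>
      have : (0 : ℝ) < n + k := by positivity
      rw [poch_succ, Nat.cast_succ, ← add_assoc, Real.Gamma_add_one this.ne', ih]
      ring
  rw [← ofReal_integral_eq_lintegral_ofReal]
  · congr 1
    rw [hI j, hpoch, nsmul_eq_mul, smul_eq_mul, pow_add, div_pow] at *
    field_simp at h1 ⊢
    linear_combination -(poch n j) * h1
  · refine (integrable_fun_norm_addHaar volume (f := fun y : ℝ =>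
      y ^ (2 * j) * Real.exp (-c * y ^ 2))).2 ?_
    rw [finrank_real_Cn]
    exact (hΓ j).1
  · exact ae_of_all _ fun u => by positivity

theorem integrable_of_integral_ne_zero' {α : Type*} [MeasurableSpace α] {μ : Measure α} {f : α → ℝ}
    (h : ∫ x, f x ∂μ ≠ 0) : Integrable f μ := by
  by_contra hf
  exact h (integral_undef hf)

/-- The moments `∫ |x₁| ^ (2 l) dσ = l! / (n)_l` of the sphere, from the Gaussian integral of
`|u₁| ^ (2 l)` computed both as a product and in polar coordinates. -/
theorem lintegral_sphere_coord {n : ℕ} (hn : 0 < n) (l : ℕ) :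
    ∫⁻ x : Sph n, ENNReal.ofReal (‖(x : Cn n) ⟨0, hn⟩‖ ^ (2 * l)) ∂(sphereMeasure n) =
      ENNReal.ofReal (l.factorial / poch n l) := by
  set i₀ : Fin n := ⟨0, hn⟩ with hi₀
  have : IsProbabilityMeasure (sphereMeasure n) := isProbabilityMeasure_sphereMeasure hn
  set e : (Fin n → ℂ) ≃L[ℝ] Cn n := (PiLp.continuousLinearEquiv 2 ℝ (fun _ : Fin n => ℂ)).symm
  obtain ⟨c, hc⟩ : ∃ c : ENNReal, (volume : Measure (Cn n)) =
      c • (volume : Measure (Fin n → ℂ)).map e :=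
    ⟨_, Measure.isAddLeftInvariant_eq_smul _ _⟩
  have hA : ∀ l : ℕ, ∫⁻ u : Cn n, ENNReal.ofReal (‖u i₀‖ ^ (2 * l)) *
      ENNReal.ofReal (Real.exp (-‖u‖ ^ 2)) =
      c * ENNReal.ofReal (l.factorial * Real.pi ^ n) := by
    intro l
    have hm : Measurable fun u : Cn n => ENNReal.ofReal (‖u i₀‖ ^ (2 * l)) *
      ENNReal.ofReal (Real.exp (-‖u‖ ^ 2)) := by fun_prop
    rw [hc, lintegral_smul_measure, lintegral_map hm e.continuous.measurable, smul_eq_mul]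
    congr 1
    set f : Fin n → ℂ → ℝ := fun i w =>
      ‖w‖ ^ (if i = i₀ then 2 * l else 0) * Real.exp (-‖w‖ ^ 2) with hf
    have hprod : ∫ v : Fin n → ℂ, ∏ i, f i (v i) = l.factorial * Real.pi ^ n := by
      rw [integral_fintype_prod_volume_eq_prod]
      have h1 : ∀ i, ∫ w : ℂ, f i w = (if i = i₀ then (l.factorial : ℝ) else 1) * Real.pi := by
        intro i
        have key : ∀ k : ℕ, ∫ w : ℂ, ‖w‖ ^ (2 * k) * Real.exp (-‖w‖ ^ 2) =
            k.factorial * Real.pi := by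
          intro k
          have := Complex.integral_rpow_mul_exp_neg_rpow (p := 2) (q := ((2 * k : ℕ) : ℝ))
            one_le_two (lt_of_lt_of_le (by norm_num) (Nat.cast_nonneg _))
          simp only [Real.rpow_natCast, Real.rpow_two] at this
          rw [this]
          have h2 : (((2 * k : ℕ) : ℝ) + 2) / 2 = k + 1 := by push_cast; ring
          rw [h2, Real.Gamma_nat_eq_factorial]
          ring
        simp only [hf]
        split_ifs with h
        · exact key l
        · simpa using key 0
      rw [Finset.prod_congr rfl fun i _ => h1 i, Finset.prod_mul_distrib]
      simp
    have hne : ∫ v : Fin n → ℂ, ∏ i, f i (v i) ≠ 0 := by rw [hprod]; positivity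
    rw [← hprod, ofReal_integral_eq_lintegral_ofReal (integrable_of_integral_ne_zero' hne)
      (ae_of_all _ fun v => by simp only [hf]; positivity)]
    refine lintegral_congr fun v => ?_
    rw [← ENNReal.ofReal_mul (by positivity)]
    congr 1
    have e1 : ∀ i, (e v) i = v i := fun i => rfl
    simp only [hf, e1]
    rw [Finset.prod_mul_distrib, EuclideanSpace.norm_eq, Real.sq_sqrt (by positivity),
      ← Real.exp_sum, Finset.sum_neg_distrib]
    simp [e1, Finset.prod_ite_eq', pow_ite]
  have hrad : ∀ l : ℕ, ∫⁻ u : Cn n, ENNReal.ofReal (‖u i₀‖ ^ (2 * l)) *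
      ENNReal.ofReal (Real.exp (-‖u‖ ^ 2)) =
      (∫⁻ x : Sph n, ENNReal.ofReal (‖(x : Cn n) i₀‖ ^ (2 * l)) ∂(sphereMeasure n)) *
        ENNReal.ofReal (poch n l * Real.pi ^ n) := by
    intro l
    rw [lintegral_mul_radial hn (f := fun u : Cn n => ENNReal.ofReal (‖u i₀‖ ^ (2 * l)))
      (g := fun r => ENNReal.ofReal (Real.exp (-r ^ 2))) (by fun_prop) (by fun_prop)]
    have hg := lintegral_pow_mul_gaussian hn l one_pos
    simp only [one_pow, div_one] at hg
    rw [← hg, ← lintegral_const_mul _ (by fun_prop)]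
    refine lintegral_congr fun u => ?_
    have e1 : ∀ x : Sph n, ENNReal.ofReal (‖(‖u‖ • (x : Cn n)) i₀‖ ^ (2 * l)) =
        ENNReal.ofReal (‖(x : Cn n) i₀‖ ^ (2 * l)) * ENNReal.ofReal (‖u‖ ^ (2 * l)) := by
      intro x
      rw [← ENNReal.ofReal_mul (by positivity), PiLp.smul_apply, norm_smul, norm_norm, mul_pow,
        mul_comm]
    simp only [e1]
    rw [lintegral_mul_const _ (by fun_prop), mul_assoc, ← ENNReal.ofReal_mul (by positivity)]
    simp
  have h0 := hrad 0
  rw [hA 0] at h0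
  simp only [mul_zero, pow_zero, ENNReal.ofReal_one, lintegral_const, measure_univ, mul_one,
    Nat.factorial_zero, Nat.cast_one, one_mul, poch_zero] at h0
  have hπ : ENNReal.ofReal (Real.pi ^ n) ≠ 0 := by
    rw [Ne, ENNReal.ofReal_eq_zero, not_le]; positivity
  -- the case `l = 0` determines the normalization of the Lebesgue measure of `ℂⁿ` relative to that of
  -- `Fin n → ℂ`
  have hc1 : c = 1 := by
    have := (ENNReal.mul_left_inj hπ ENNReal.ofReal_ne_top).1 (h0.trans (one_mul _).symm)
    exact this
  have hl := hrad l
  have hp : 0 < poch n l := poch_pos (by exact_mod_cast hn) l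
  rw [hA l, hc1, one_mul] at hl
  have hne : ENNReal.ofReal (poch n l * Real.pi ^ n) ≠ 0 := by
    rw [Ne, ENNReal.ofReal_eq_zero, not_le]; positivity
  refine (ENNReal.mul_left_inj hne ENNReal.ofReal_ne_top).1 (hl.symm.trans ?_)
  rw [← ENNReal.ofReal_mul (by positivity)]
  congr 1
  field_simp

/-! ### The measure `m` as a mixture of Gaussians -/

theorem integrable_exp_cosh (p : ℝ) {t : ℝ} (ht : 0 < t) :
    Integrable fun τ : ℝ => Real.exp (-(2 * t) * Real.cosh τ) * Real.exp (p * τ) := by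
  have hg := (integrable_exp_neg_mul_sq (show 0 < t / 2 by positivity)).const_mul
    (Real.exp (p ^ 2 / (2 * t)))
  refine hg.mono' (by fun_prop) (ae_of_all _ fun τ => ?_)
  rw [Real.norm_eq_abs, abs_of_nonneg (by positivity), ← Real.exp_add, ← Real.exp_add,
    Real.exp_le_exp]
  have hcosh : 1 + τ ^ 2 / 2 ≤ Real.cosh τ := by
    have := sum_le_hasSum (Finset.range 2)
      (fun k _ => div_nonneg (by rw [pow_mul]; positivity) (Nat.cast_nonneg _)) (Real.hasSum_cosh τ)
    simpa [Finset.sum_range_succ, Nat.factorial] using this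
  have h1 : -(2 * t) * Real.cosh τ ≤ -(2 * t) * (1 + τ ^ 2 / 2) := by nlinarith
  have h2 : p ^ 2 / (2 * t) + -(t / 2) * τ ^ 2 - (p * τ - t * τ ^ 2) =
      (p - t * τ) ^ 2 / (2 * t) := by field_simp; ring
  have h3 : 0 ≤ (p - t * τ) ^ 2 / (2 * t) := by positivity
  nlinarith

/-- The integral representation `t ^ p K_p(2 t) = (1 / 2) ∫ exp (-s - t² / s) s ^ (p - 1) ds`. -/
theorem integral_exp_neg_sub_div (p : ℝ) {t : ℝ} (ht : 0 < t) :
    IntegrableOn (fun s : ℝ => Real.exp (-s - t ^ 2 / s) * s ^ (p - 1)) (Set.Ioi 0) ∧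
      ∫ s in Set.Ioi (0 : ℝ), Real.exp (-s - t ^ 2 / s) * s ^ (p - 1) =
        2 * (t ^ p * besselK p (2 * t)) := by
  set F : ℝ → ℝ := fun s => Real.exp (-s - t ^ 2 / s) * s ^ (p - 1) with hF
  set h : ℝ → ℝ := fun τ => Real.exp (-(2 * t) * Real.cosh τ) * Real.exp (p * τ) with hh
  have himg : (fun τ : ℝ => t * Real.exp τ) '' Set.univ = Set.Ioi 0 := by
    ext s
    simp only [Set.image_univ, Set.mem_range, Set.mem_Ioi]
    constructor
    · rintro ⟨τ, rfl⟩
      positivity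
    · intro hs
      exact ⟨Real.log (s / t), by rw [Real.exp_log (by positivity)]; field_simp⟩
  have hder : ∀ τ ∈ (Set.univ : Set ℝ),
      HasDerivWithinAt (fun τ : ℝ => t * Real.exp τ) (t * Real.exp τ) Set.univ τ := fun τ _ =>
    ((Real.hasDerivAt_exp τ).const_mul t).hasDerivWithinAt
  have hinj : Set.InjOn (fun τ : ℝ => t * Real.exp τ) Set.univ := fun a _ b _ hab =>
    Real.exp_injective (mul_left_cancel₀ ht.ne' hab)
  have hcomp : ∀ τ : ℝ, |t * Real.exp τ| • F (t * Real.exp τ) = t ^ p * h τ := by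
    intro τ
    have hpos : 0 < t * Real.exp τ := by positivity
    rw [abs_of_pos hpos, smul_eq_mul, hF, hh]
    simp only
    have e1 : t * Real.exp τ * (t * Real.exp τ) ^ (p - 1) = t ^ p * Real.exp (p * τ) := by
      rw [Real.rpow_sub_one hpos.ne', mul_div_cancel₀ _ hpos.ne',
        Real.mul_rpow ht.le (Real.exp_pos τ).le, ← Real.exp_mul, mul_comm τ p]
    have e2 : -(t * Real.exp τ) - t ^ 2 / (t * Real.exp τ) = -(2 * t) * Real.cosh τ := by
      rw [Real.cosh_eq, Real.exp_neg]
      field_simp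
      ring
    rw [e2, mul_left_comm, e1]
    ring
  have hint : Integrable h := integrable_exp_cosh p ht
  have hval : ∫ τ, h τ = 2 * besselK p (2 * t) := by
    rw [← integral_add_compl (measurableSet_Ioi (a := (0 : ℝ))) hint, Set.compl_Ioi,
      ← neg_zero, ← integral_comp_neg_Ioi, neg_zero, ← integral_add hint.integrableOn]
    · rw [besselK, ← integral_const_mul]
      refine integral_congr_ae (ae_of_all _ fun τ => ?_)
      simp only [hh, Real.cosh_neg]
      rw [Real.cosh_eq (p * τ)]
      ring_nf
    · exact hint.comp_neg.integrableOn
  constructor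
  · rw [← himg, integrableOn_image_iff_integrableOn_abs_deriv_smul MeasurableSet.univ hder hinj]
    exact (hint.const_mul (t ^ p)).integrableOn.congr_fun (fun τ _ => (hcomp τ).symm)
      MeasurableSet.univ
  · rw [← himg, integral_image_eq_integral_abs_deriv_smul MeasurableSet.univ hder hinj]
    refine (setIntegral_congr_fun MeasurableSet.univ fun τ _ => hcomp τ).trans ?_
    rw [setIntegral_univ, integral_const_mul, hval]
    ring

/-- The Gamma density with parameter `b`. -/
def gammaDensity (b s : ℝ) : ℝ := 1 / Real.Gamma b * Real.exp (-s) * s ^ (b - 1)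

/-- The density of the complex Gaussian measure with variance `ħ² s`. -/
def gaussDensity (n : ℕ) (ħ s : ℝ) (u : Cn n) : ℝ :=
  1 / (Real.pi * ħ ^ 2 * s) ^ n * Real.exp (-(1 / (ħ ^ 2 * s)) * ‖u‖ ^ 2)

theorem gammaDensity_nonneg {b s : ℝ} (hb : 0 < b) (hs : 0 < s) : 0 ≤ gammaDensity b s := by
  have := Real.Gamma_pos_of_pos hb
  unfold gammaDensity
  positivity

/-- The mixture density. -/
def mixDensity (n : ℕ) (p ħ : ℝ) (u : Cn n) : ENNReal :=
  ∫⁻ s in Set.Ioi (0 : ℝ),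
    ENNReal.ofReal (gammaDensity (n + p) s) * ENNReal.ofReal (gaussDensity n ħ s u)

theorem measurable_mixIntegrand (n : ℕ) (p ħ : ℝ) : Measurable fun q : Cn n × ℝ =>
    ENNReal.ofReal (gammaDensity (n + p) q.2) * ENNReal.ofReal (gaussDensity n ħ q.2 q.1) := by
  unfold gammaDensity gaussDensity
  fun_prop

theorem measurable_mixDensity (n : ℕ) (p ħ : ℝ) : Measurable (mixDensity n p ħ) :=
  Measurable.lintegral_prod_right' (measurable_mixIntegrand n p ħ)

/-- The measure `m` is the average of centred complex Gaussian measures whose variance is `ħ²` times a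
variable with the Gamma distribution of parameter `n + p`. -/
theorem mMeasure_eq {n : ℕ} (hn : 0 < n) {p ħ : ℝ} (hp : -(n : ℝ) < p) (hħ : 0 < ħ) :
    mMeasure n p ħ = volume.withDensity (mixDensity n p ħ) := by
  have : Nonempty (Fin n) := ⟨⟨0, hn⟩⟩
  refine withDensity_congr_ae ?_
  filter_upwards [compl_mem_ae_iff.2 (measure_singleton (0 : Cn n))] with u hu
  have hu0 : 0 < ‖u‖ := norm_pos_iff.2 hu
  have hr : 0 < ‖u‖ / ħ := by positivity
  obtain ⟨hi, hv⟩ := integral_exp_neg_sub_div p hr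
  have hΓ := Real.Gamma_pos_of_pos (show 0 < (n : ℝ) + p by linarith)
  have e : 1 / Real.Gamma (n + p) * (2 / (Real.pi * ħ ^ 2) ^ n) * (‖u‖ / ħ) ^ p *
      besselK p (2 * ‖u‖ / ħ) = ∫ s in Set.Ioi (0 : ℝ), 1 / Real.Gamma (n + p) *
      (1 / (Real.pi * ħ ^ 2) ^ n) * (Real.exp (-s - (‖u‖ / ħ) ^ 2 / s) * s ^ (p - 1)) := by
    rw [integral_const_mul, hv, mul_div_assoc 2]
    ring
  rw [e, mixDensity, ofReal_integral_eq_lintegral_ofReal (hi.const_mul _)]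
  · refine setLIntegral_congr_fun measurableSet_Ioi fun s hs => ?_
    have hs : 0 < s := hs
    rw [← ENNReal.ofReal_mul (gammaDensity_nonneg (by linarith) hs)]
    congr 1
    unfold gammaDensity gaussDensity
    have e1 : s ^ ((n : ℝ) + p - 1) = s ^ n * s ^ (p - 1) := by
      rw [add_sub_assoc, Real.rpow_add hs, Real.rpow_natCast]
    have e2 : Real.exp (-s - (‖u‖ / ħ) ^ 2 / s) =
        Real.exp (-s) * Real.exp (-(1 / (ħ ^ 2 * s)) * ‖u‖ ^ 2) := by
      rw [← Real.exp_add]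
      congr 1
      field_simp
      ring
    rw [e1, e2, mul_pow _ s]
    field_simp
  · filter_upwards [ae_restrict_mem measurableSet_Ioi] with s hs
    have hs : 0 < s := hs
    simp only [Pi.zero_apply]
    positivity

theorem lintegral_mMeasure {n : ℕ} (hn : 0 < n) {p ħ : ℝ} (hp : -(n : ℝ) < p) (hħ : 0 < ħ)
    {g : Cn n → ENNReal} (hg : Measurable g) :
    ∫⁻ u, g u ∂(mMeasure n p ħ) = ∫⁻ s in Set.Ioi (0 : ℝ), ENNReal.ofReal (gammaDensity (n + p) s) *
      ∫⁻ u : Cn n, g u * ENNReal.ofReal (gaussDensity n ħ s u) := by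
  have hmeas := measurable_mixIntegrand n p ħ
  rw [mMeasure_eq hn hp hħ, lintegral_withDensity_eq_lintegral_mul _ (measurable_mixDensity n p ħ) hg]
  simp only [Pi.mul_apply, mixDensity]
  have h1 : ∀ u : Cn n, (∫⁻ s in Set.Ioi (0 : ℝ), ENNReal.ofReal (gammaDensity (n + p) s) *
      ENNReal.ofReal (gaussDensity n ħ s u)) * g u = ∫⁻ s in Set.Ioi (0 : ℝ),
      ENNReal.ofReal (gammaDensity (n + p) s) * ENNReal.ofReal (gaussDensity n ħ s u) * g u := by
    intro u
    rw [lintegral_mul_const]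
    exact hmeas.comp (by fun_prop : Measurable fun s : ℝ => (u, s))
  simp only [h1]
  rw [lintegral_lintegral_swap (hmeas.mul (hg.comp measurable_fst)).aemeasurable]
  refine lintegral_congr fun s => ?_
  have hgs : Measurable (gaussDensity n ħ s) := by unfold gaussDensity; fun_prop
  rw [← lintegral_const_mul _ (by fun_prop)]
  refine lintegral_congr fun u => ?_
  ring

theorem gamma_lintegral {b c : ℝ} (hb : 0 < b) (hc : 0 < c) :
    ∫⁻ s in Set.Ioi (0 : ℝ), ENNReal.ofReal (s ^ (b - 1) * Real.exp (-(c * s))) =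
      ENNReal.ofReal ((1 / c) ^ b * Real.Gamma b) := by
  have h := Real.integral_rpow_mul_exp_neg_mul_Ioi hb hc
  have hΓ := Real.Gamma_pos_of_pos hb
  rw [← h, ofReal_integral_eq_lintegral_ofReal]
  · exact integrable_of_integral_ne_zero' (by rw [h]; positivity)
  · filter_upwards [ae_restrict_mem measurableSet_Ioi] with s hs
    have hs : 0 < s := hs
    simp only [Pi.zero_apply]
    positivity

theorem gamma_add_nat {b : ℝ} (hb : 0 < b) (j : ℕ) :
    Real.Gamma (b + j) = poch b j * Real.Gamma b := by
  induction j with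
  | zero => simp [poch_zero]
  | succ k ih =>
    have : (0 : ℝ) < b + k := by positivity
    rw [poch_succ, Nat.cast_succ, ← add_assoc, Real.Gamma_add_one this.ne', ih]
    ring

/-- The radial moments of `m`. -/
theorem lintegral_mMeasure_pow {n : ℕ} (hn : 0 < n) {p ħ : ℝ} (hp : -(n : ℝ) < p) (hħ : 0 < ħ)
    (j : ℕ) : ∫⁻ u, ENNReal.ofReal (‖u‖ ^ (2 * j)) ∂(mMeasure n p ħ) =
      ENNReal.ofReal (poch n j * poch (n + p) j * ħ ^ (2 * j)) := by
  have hb : 0 < (n : ℝ) + p := by linarith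
  have hΓ := Real.Gamma_pos_of_pos hb
  have hpn : 0 < poch n j := poch_pos (by exact_mod_cast hn) j
  rw [lintegral_mMeasure hn hp hħ (by fun_prop)]
  have h1 : ∀ s ∈ Set.Ioi (0 : ℝ), ENNReal.ofReal (gammaDensity (n + p) s) *
      ∫⁻ u : Cn n, ENNReal.ofReal (‖u‖ ^ (2 * j)) * ENNReal.ofReal (gaussDensity n ħ s u) =
      ENNReal.ofReal (1 / Real.Gamma (n + p) * poch n j * ħ ^ (2 * j)) *
        ENNReal.ofReal (s ^ (n + p + j - 1) * Real.exp (-(1 * s))) := by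
    intro s hs
    have hs : 0 < s := hs
    have h2 : ∀ u : Cn n, ENNReal.ofReal (‖u‖ ^ (2 * j)) * ENNReal.ofReal (gaussDensity n ħ s u) =
        ENNReal.ofReal (1 / (Real.pi * ħ ^ 2 * s) ^ n) *
          ENNReal.ofReal (‖u‖ ^ (2 * j) * Real.exp (-(1 / (ħ ^ 2 * s)) * ‖u‖ ^ 2)) := by
      intro u
      rw [← ENNReal.ofReal_mul (by positivity), ← ENNReal.ofReal_mul (by positivity)]
      congr 1
      unfold gaussDensity
      ring
    simp only [h2]
    rw [lintegral_const_mul _ (by fun_prop), lintegral_pow_mul_gaussian hn j (by positivity),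
      ← ENNReal.ofReal_mul (by positivity),
      ← ENNReal.ofReal_mul (gammaDensity_nonneg hb hs), ← ENNReal.ofReal_mul (by positivity)]
    congr 1
    unfold gammaDensity
    rw [show (n : ℝ) + p + j - 1 = (n + p - 1) + j by ring, Real.rpow_add hs, Real.rpow_natCast,
      pow_add, one_mul, mul_pow, mul_pow, pow_mul]
    simp only [div_pow, mul_pow, one_pow]
    field_simp
  rw [setLIntegral_congr_fun measurableSet_Ioi h1, lintegral_const_mul _ (by fun_prop),
    gamma_lintegral (b := n + p + j) (by positivity) one_pos, ← ENNReal.ofReal_mul (by positivity),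
    gamma_add_nat hb]
  congr 1
  simp only [div_one, Real.one_rpow, one_mul]
  field_simp

/-- An exponential moment of `m`, uniform in `ħ`. -/
theorem lintegral_mMeasure_exp_le {n : ℕ} (hn : 0 < n) {p ħ : ℝ} (hp : -(n : ℝ) < p)
    (hħ : 0 < ħ) : ∫⁻ u, ENNReal.ofReal (Real.exp (‖u‖ / ħ)) ∂(mMeasure n p ħ) ≤
      ENNReal.ofReal (2 ^ n * 2 ^ ((n : ℝ) + p)) := by
  have hb : 0 < (n : ℝ) + p := by linarith
  have hΓ := Real.Gamma_pos_of_pos hb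
  rw [lintegral_mMeasure hn hp hħ (by fun_prop)]
  have h1 : ∀ s ∈ Set.Ioi (0 : ℝ), ENNReal.ofReal (gammaDensity (n + p) s) *
      ∫⁻ u : Cn n, ENNReal.ofReal (Real.exp (‖u‖ / ħ)) * ENNReal.ofReal (gaussDensity n ħ s u) ≤
      ENNReal.ofReal (1 / Real.Gamma (n + p) * 2 ^ n) *
        ENNReal.ofReal (s ^ (n + p - 1) * Real.exp (-(1 / 2 * s))) := by
    intro s hs
    have hs : 0 < s := hs
    have h2 : ∀ u : Cn n, ENNReal.ofReal (Real.exp (‖u‖ / ħ)) *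
        ENNReal.ofReal (gaussDensity n ħ s u) ≤
        ENNReal.ofReal (1 / (Real.pi * ħ ^ 2 * s) ^ n * Real.exp (s / 2)) *
          ENNReal.ofReal (‖u‖ ^ (2 * 0) * Real.exp (-(1 / (2 * (ħ ^ 2 * s))) * ‖u‖ ^ 2)) := by
      intro u
      rw [← ENNReal.ofReal_mul (by positivity), ← ENNReal.ofReal_mul (by positivity)]
      refine ENNReal.ofReal_le_ofReal ?_
      unfold gaussDensity
      have h3 : Real.exp (‖u‖ / ħ) * Real.exp (-(1 / (ħ ^ 2 * s)) * ‖u‖ ^ 2) ≤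
          Real.exp (s / 2) * Real.exp (-(1 / (2 * (ħ ^ 2 * s))) * ‖u‖ ^ 2) := by
        rw [← Real.exp_add, ← Real.exp_add, Real.exp_le_exp]
        have : s / 2 + -(1 / (2 * (ħ ^ 2 * s))) * ‖u‖ ^ 2 -
            (‖u‖ / ħ + -(1 / (ħ ^ 2 * s)) * ‖u‖ ^ 2) = (s - ‖u‖ / ħ) ^ 2 / (2 * s) := by
          field_simp
          ring
        have : 0 ≤ (s - ‖u‖ / ħ) ^ 2 / (2 * s) := by positivity
        linarith
      have h4 : 0 ≤ 1 / (Real.pi * ħ ^ 2 * s) ^ n := by positivity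
      have := mul_le_mul_of_nonneg_left h3 h4
      simp only [mul_zero, pow_zero, one_mul]
      linarith
    refine (mul_le_mul_right (lintegral_mono h2) _).trans (le_of_eq ?_)
    rw [lintegral_const_mul _ (by fun_prop), lintegral_pow_mul_gaussian hn 0 (by positivity),
      ← ENNReal.ofReal_mul (by positivity),
      ← ENNReal.ofReal_mul (gammaDensity_nonneg hb hs), ← ENNReal.ofReal_mul (by positivity)]
    congr 1
    unfold gammaDensity
    have e : Real.exp (-(1 / 2 * s)) = Real.exp (-s) * Real.exp (s / 2) := by
      rw [← Real.exp_add]; congr 1; ring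
    rw [e, poch_zero, add_zero]
    simp only [div_pow, mul_pow, one_pow]
    field_simp
  refine (setLIntegral_mono (by fun_prop) h1).trans (le_of_eq ?_)
  rw [lintegral_const_mul _ (by fun_prop), gamma_lintegral hb (by norm_num),
    ← ENNReal.ofReal_mul (by positivity)]
  congr 1
  rw [one_div_one_div]
  field_simp

theorem unitaryInvariant_mMeasure {n : ℕ} (hn : 0 < n) {p ħ : ℝ} (hp : -(n : ℝ) < p)
    (hħ : 0 < ħ) : UnitaryInvariant (mMeasure n p ħ) := by
  rw [mMeasure_eq hn hp hħ]
  refine (unitaryInvariant_volume n).withDensity_norm (measurable_mixDensity n p ħ) fun U u => ?_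
  simp [mixDensity, gaussDensity]

/-- Averaging over spheres with respect to `m`. -/
theorem lintegral_mMeasure_polar {n : ℕ} (hn : 0 < n) {p ħ : ℝ} (hp : -(n : ℝ) < p)
    (hħ : 0 < ħ) {f : Cn n → ENNReal} (hf : Measurable f) :
    ∫⁻ u, f u ∂(mMeasure n p ħ) =
      ∫⁻ u : Cn n, ∫⁻ x, f (‖u‖ • (x : Cn n)) ∂(sphereMeasure n) ∂(mMeasure n p ħ) := by
  have hm : Measurable fun r : ℝ => ∫⁻ x : Sph n, f (r • (x : Cn n)) ∂(sphereMeasure n) :=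
    have := isProbabilityMeasure_sphereMeasure hn
    Measurable.lintegral_prod_right' (f := fun q : ℝ × Sph n => f (q.1 • (q.2 : Cn n)))
      (by fun_prop)
  set g : ℝ → ENNReal := fun r => ∫⁻ s in Set.Ioi (0 : ℝ), ENNReal.ofReal (gammaDensity (n + p) s) *
    ENNReal.ofReal (1 / (Real.pi * ħ ^ 2 * s) ^ n * Real.exp (-(1 / (ħ ^ 2 * s)) * r ^ 2)) with hg
  have hgm : Measurable g := by
    refine Measurable.lintegral_prod_right' (f := fun q : ℝ × ℝ =>
      ENNReal.ofReal (gammaDensity (n + p) q.2) * ENNReal.ofReal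
      (1 / (Real.pi * ħ ^ 2 * q.2) ^ n * Real.exp (-(1 / (ħ ^ 2 * q.2)) * q.1 ^ 2))) ?_
    unfold gammaDensity
    fun_prop
  have hmix : mixDensity n p ħ = fun u => g ‖u‖ := rfl
  rw [mMeasure_eq hn hp hħ, lintegral_withDensity_eq_lintegral_mul _ (measurable_mixDensity n p ħ) hf,
    lintegral_withDensity_eq_lintegral_mul _ (measurable_mixDensity n p ħ) (by fun_prop)]
  simp only [Pi.mul_apply, hmix]
  simp only [mul_comm (g _)]
  exact lintegral_mul_radial hn hf hgm

/-! ### Unitarily invariant measures -/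

theorem cdot_eq_inner {n : ℕ} (z w : Cn n) : cdot z w = inner ℂ w z := by
  simp [cdot, PiLp.inner_apply]

theorem norm_cdot_le {n : ℕ} (z w : Cn n) : ‖cdot z w‖ ≤ ‖z‖ * ‖w‖ := by
  rw [cdot_eq_inner, mul_comm]
  exact norm_inner_le_norm w z

theorem cdot_self {n : ℕ} (z : Cn n) : cdot z z = ((‖z‖ ^ 2 : ℝ) : ℂ) := by
  rw [cdot_eq_inner, inner_self_eq_norm_sq_to_K]
  simp

theorem cdot_conj {n : ℕ} (z w : Cn n) : (starRingEnd ℂ) (cdot z w) = cdot w z := by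
  rw [cdot_eq_inner, cdot_eq_inner, inner_conj_symm]

theorem cdot_smul_left {n : ℕ} (c : ℂ) (z w : Cn n) : cdot (c • z) w = c * cdot z w := by
  rw [cdot_eq_inner, cdot_eq_inner, inner_smul_right]

theorem cdot_smul_right {n : ℕ} (c : ℂ) (z w : Cn n) :
    cdot z (c • w) = (starRingEnd ℂ) c * cdot z w := by
  rw [cdot_eq_inner, cdot_eq_inner, inner_smul_left]

theorem cdot_add_left {n : ℕ} (x z w : Cn n) : cdot (x + z) w = cdot x w + cdot z w := by
  simp only [cdot_eq_inner, inner_add_right]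

theorem cdot_sub_left {n : ℕ} (x z w : Cn n) : cdot (x - z) w = cdot x w - cdot z w := by
  simp only [cdot_eq_inner, inner_sub_right]

theorem continuous_cdot_left {n : ℕ} (w : Cn n) : Continuous fun z : Cn n => cdot z w := by
  simp only [cdot_eq_inner]
  fun_prop

/-- The unitary map fixing the unit vector `e` and multiplying its orthogonal complement by the
complex number `c` of modulus one. -/
def rotation {n : ℕ} (e : Cn n) (he : ‖e‖ = 1) (c : ℂ) (hc : ‖c‖ = 1) : Cn n ≃ₗᵢ[ℂ] Cn n :=
  LinearIsometry.toLinearIsometryEquiv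
    (LinearMap.isometryOfInner
      (c • LinearMap.id + (1 - c) • (LinearMap.toSpanSingleton ℂ (Cn n) e).comp
        ((innerSL ℂ e : Cn n →L[ℂ] ℂ) : Cn n →ₗ[ℂ] ℂ)) (by
      intro x y
      have hcc : (starRingEnd ℂ) c * c = 1 := by rw [Complex.conj_mul', hc]; simp
      have hee : inner ℂ e e = (1 : ℂ) := by rw [inner_self_eq_norm_sq_to_K, he]; simp
      simp only [LinearMap.add_apply, LinearMap.smul_apply, LinearMap.id_apply,
        LinearMap.comp_apply, LinearMap.toSpanSingleton_apply, ContinuousLinearMap.coe_coe,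
        innerSL_apply_apply, inner_add_left, inner_add_right, inner_smul_left, inner_smul_right, hee,
        map_sub, map_one]
      rw [← inner_conj_symm x e]
      linear_combination (inner ℂ x y - inner ℂ e y * (starRingEnd ℂ) (inner ℂ e x)) * hcc +
        0 * hcc)) rfl

theorem rotation_apply {n : ℕ} (e : Cn n) (he : ‖e‖ = 1) (c : ℂ) (hc : ‖c‖ = 1) (u : Cn n) :
    rotation e he c hc u = c • u + (1 - c) • (cdot u e • e) := by
  rw [cdot_eq_inner]
  rfl

theorem cdot_slice {n : ℕ} (e : Cn n) (he : ‖e‖ = 1) (c : ℂ) (u : Cn n) :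
    cdot (c • u + (1 - c) • (cdot u e • e)) e = cdot u e := by
  rw [cdot_add_left, cdot_smul_left, cdot_smul_left, cdot_smul_left, cdot_self, he]
  simp only [one_pow, Complex.ofReal_one, mul_one]
  ring

/-- Multiplication by a complex number of modulus one. -/
def phase {n : ℕ} (c : ℂ) (hc : ‖c‖ = 1) : Cn n ≃ₗᵢ[ℂ] Cn n :=
  LinearIsometry.toLinearIsometryEquiv
    ({ (c • LinearMap.id : Cn n →ₗ[ℂ] Cn n) with
      norm_map' := fun u => by
        change ‖c • u‖ = ‖u‖
        rw [norm_smul, hc, one_mul] }) rfl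

theorem phase_apply {n : ℕ} (c : ℂ) (hc : ‖c‖ = 1) (u : Cn n) : phase c hc u = c • u := rfl

theorem UnitaryInvariant.integral_comp {n : ℕ} {ν : Measure (Cn n)} (hν : UnitaryInvariant ν)
    (U : Cn n ≃ₗᵢ[ℂ] Cn n) (f : Cn n → ℂ) : ∫ u, f (U u) ∂ν = ∫ u, f u ∂ν :=
  (hν U).integral_comp U.toHomeomorph.measurableEmbedding f

/-- Averaging over the unitary maps that fix `e`, the mean value property replaces a holomorphic
factor by its restriction to the complex line through `e`. -/
theorem UnitaryInvariant.integral_slice {n : ℕ} {ν : Measure (Cn n)} [SFinite ν]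
    (hν : UnitaryInvariant ν) {e : Cn n} (he : ‖e‖ = 1) {G : Cn n → ℂ} (hG : Continuous G)
    {φ : ℂ → ℂ} (hφ : Continuous φ)
    (hhol : ∀ᵐ u ∂ν, DiffContOnCl ℂ (fun c : ℂ => G (c • u + (1 - c) • (cdot u e • e)))
      (Metric.ball 0 |1|))
    {B : Cn n → ℝ} (hB : Integrable B ν)
    (hGB : ∀ᵐ u ∂ν, ∀ c : ℂ, ‖c‖ = 1 →
      ‖G (c • u + (1 - c) • (cdot u e • e)) * φ (cdot u e)‖ ≤ B u) :
    ∫ u, G u * φ (cdot u e) ∂ν = ∫ u, G (cdot u e • e) * φ (cdot u e) ∂ν := by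
  have hcd := continuous_cdot_left e
  set H : ℝ → Cn n → ℂ := fun θ u =>
    G (circleMap 0 1 θ • u + (1 - circleMap 0 1 θ) • (cdot u e • e)) * φ (cdot u e) with hH
  have hcirc : ∀ θ : ℝ, ‖circleMap 0 1 θ‖ = 1 := fun θ => by simp
  -- each `H θ` is the integrand composed with a unitary map fixing `e`
  have h1 : ∀ θ : ℝ, ∫ u, H θ u ∂ν = ∫ u, G u * φ (cdot u e) ∂ν := by
    intro θ
    rw [← hν.integral_comp (rotation e he (circleMap 0 1 θ) (hcirc θ)) fun u => G u * φ (cdot u e)]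
    refine integral_congr_ae (ae_of_all _ fun u => ?_)
    simp only [hH, rotation_apply, cdot_slice e he]
  -- for fixed `u`, the average over the circle is the value at the centre
  have h2 : ∀ᵐ u ∂ν, ∫ θ in (0 : ℝ)..(2 * Real.pi), H θ u =
      ((2 * Real.pi : ℝ) : ℂ) * (G (cdot u e • e) * φ (cdot u e)) := by
    filter_upwards [hhol] with u hu
    have := hu.circleAverage
    rw [Real.circleAverage_def] at this
    simp only [zero_smul, sub_zero, one_smul, zero_add] at this
    simp only [hH]
    rw [intervalIntegral.integral_mul_const, ← this]
    have h2π : ((2 * Real.pi : ℝ) : ℂ) ≠ 0 := by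
      exact_mod_cast (by positivity : (2 * Real.pi : ℝ) ≠ 0)
    rw [Complex.real_smul, ← mul_assoc, ← mul_assoc, Complex.ofReal_inv, mul_inv_cancel₀ h2π,
      one_mul]
  have hπ : (0 : ℝ) ≤ 2 * Real.pi := by positivity
  have hcont : Continuous (Function.uncurry H) := by
    simp only [hH]
    have : Continuous fun q : ℝ × Cn n => cdot q.2 e := hcd.comp continuous_snd
    have hc : Continuous fun q : ℝ × Cn n => circleMap 0 1 q.1 :=
      (continuous_circleMap 0 1).comp continuous_fst
    exact (hG.comp (by fun_prop)).mul (hφ.comp this)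
  have hint : Integrable (Function.uncurry H)
      ((volume.restrict (Set.Ioc (0 : ℝ) (2 * Real.pi))).prod ν) := by
    have hB' := hB.comp_snd (volume.restrict (Set.Ioc (0 : ℝ) (2 * Real.pi)))
    refine hB'.mono' hcont.aestronglyMeasurable ?_
    filter_upwards [Measure.quasiMeasurePreserving_snd.ae hGB] with q hq
    exact hq _ (hcirc q.1)
  have h3 : ∫ θ in (0 : ℝ)..(2 * Real.pi), (∫ u, H θ u ∂ν) =
      ∫ u, (∫ θ in (0 : ℝ)..(2 * Real.pi), H θ u) ∂ν := by
    simp only [intervalIntegral.integral_of_le hπ]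
    exact integral_integral_swap hint
  rw [integral_congr_ae h2, integral_const_mul] at h3
  simp only [h1, intervalIntegral.integral_const, sub_zero, Complex.real_smul] at h3
  exact mul_left_cancel₀ (by exact_mod_cast (by positivity : (2 * Real.pi : ℝ) ≠ 0)) h3

/-- The moments `∫ |u₁| ^ (2 l) dν`. -/
def coordMoment {n : ℕ} (hn : 0 < n) (ν : Measure (Cn n)) (l : ℕ) : ℝ :=
  ∫ u, ‖u ⟨0, hn⟩‖ ^ (2 * l) ∂ν

theorem UnitaryInvariant.integral_cdot_self {n : ℕ} (hn : 0 < n) {ν : Measure (Cn n)}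
    (hν : UnitaryInvariant ν) {e : Cn n} (he : ‖e‖ = 1) (l : ℕ) :
    ∫ u, cdot u e ^ l * (starRingEnd ℂ) (cdot u e) ^ l ∂ν = coordMoment hn ν l := by
  set i₀ : Fin n := ⟨0, hn⟩
  obtain ⟨b, hb⟩ := Orthonormal.exists_orthonormalBasis_extension_of_card_eq (𝕜 := ℂ) (ι := Fin n)
    (by simp) (v := fun _ : Fin n => e) (s := {i₀}) (by
      rw [orthonormal_iff_ite]
      rintro ⟨i, rfl⟩ ⟨j, rfl⟩
      simp [inner_self_eq_norm_sq_to_K, he])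
  have hbe : b i₀ = e := hb i₀ rfl
  have h1 : ∀ u : Cn n, cdot u e ^ l * (starRingEnd ℂ) (cdot u e) ^ l =
      ((‖(b.repr u) i₀‖ ^ (2 * l) : ℝ) : ℂ) := by
    intro u
    rw [← mul_pow, Complex.mul_conj', b.repr_apply_apply, hbe, cdot_eq_inner, pow_mul]
    push_cast
    rfl
  simp only [h1]
  rw [hν.integral_comp b.repr fun u => ((‖u i₀‖ ^ (2 * l) : ℝ) : ℂ), integral_complex_ofReal]
  rfl

theorem UnitaryInvariant.integral_cdot_of_ne {n : ℕ} {ν : Measure (Cn n)}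
    (hν : UnitaryInvariant ν) (e : Cn n) {k l : ℕ} (hkl : k ≠ l) :
    ∫ u, cdot u e ^ k * (starRingEnd ℂ) (cdot u e) ^ l ∂ν = 0 := by
  -- the unitary scalar `exp (i π / (k - l))` multiplies the integrand by `-1`
  set c : ℂ := Complex.exp (((Real.pi / ((k : ℝ) - l) : ℝ) : ℂ) * Complex.I) with hc
  have hc1 : ‖c‖ = 1 := Complex.norm_exp_ofReal_mul_I _
  have hd : (k : ℂ) - l ≠ 0 := sub_ne_zero.2 (by exact_mod_cast hkl)
  have hcc : c ^ k * (starRingEnd ℂ) c ^ l = -1 := by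
    rw [hc, ← Complex.exp_conj, ← Complex.exp_nat_mul, ← Complex.exp_nat_mul, ← Complex.exp_add,
      ← Complex.exp_pi_mul_I]
    congr 1
    rw [map_mul, Complex.conj_ofReal, Complex.conj_I]
    push_cast
    field_simp
    ring
  have h := hν.integral_comp (phase c hc1) fun u => cdot u e ^ k * (starRingEnd ℂ) (cdot u e) ^ l
  have h1 : ∀ u : Cn n, cdot (phase c hc1 u) e ^ k * (starRingEnd ℂ) (cdot (phase c hc1 u) e) ^ l =
      (-1) * (cdot u e ^ k * (starRingEnd ℂ) (cdot u e) ^ l) := by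
    intro u
    rw [phase_apply, cdot_smul_left, map_mul, mul_pow, mul_pow, ← hcc]
    ring
  simp only [h1] at h
  rw [integral_const_mul] at h
  linear_combination (-1 / 2 : ℂ) * h

/-- The pairing of the monomials `(u ⬝ w) ^ k` and `(u ⬝ z) ^ l`. -/
theorem UnitaryInvariant.integral_cdot_pow {n : ℕ} (hn : 0 < n) {ν : Measure (Cn n)} [SFinite ν]
    (hν : UnitaryInvariant ν) (hint : ∀ m : ℕ, Integrable (fun u : Cn n => ‖u‖ ^ m) ν)
    (w z : Cn n) (k l : ℕ) :
    ∫ u, cdot u w ^ k * (starRingEnd ℂ) (cdot u z) ^ l ∂ν =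
      if k = l then cdot z w ^ l * coordMoment hn ν l else 0 := by
  obtain ⟨e, he, hz⟩ : ∃ e : Cn n, ‖e‖ = 1 ∧ z = (‖z‖ : ℂ) • e := by
    by_cases hz : z = 0
    · exact ⟨EuclideanSpace.single ⟨0, hn⟩ 1, by simp, by simp [hz]⟩
    · have hz' : ‖z‖ ≠ 0 := norm_ne_zero_iff.2 hz
      refine ⟨(‖z‖ : ℂ)⁻¹ • z, by simp [norm_smul, hz'], ?_⟩
      rw [smul_smul, mul_inv_cancel₀ (by exact_mod_cast hz'), one_smul]
  set a : ℝ := ‖z‖ with ha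
  have hcdz : ∀ u : Cn n, cdot u z = a * cdot u e := fun u => by
    conv_lhs => rw [hz]
    rw [cdot_smul_right, Complex.conj_ofReal]
  -- the slice property with the unit vector `e` in the direction of `z` turns `u ⬝ w` into
  -- `(u ⬝ e) (e ⬝ w)`
  have hslice := hν.integral_slice he (G := fun u => cdot u w ^ k)
    (φ := fun t => (starRingEnd ℂ) t ^ l) ((continuous_cdot_left w).pow k)
    (Complex.continuous_conj.pow l) (ae_of_all _ fun u => by
      refine Differentiable.diffContOnCl ?_
      simp only [cdot_add_left, cdot_smul_left]
      fun_prop) (B := fun u => ‖w‖ ^ k * ‖u‖ ^ (k + l)) ((hint (k + l)).const_mul _)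
    (ae_of_all _ fun u c hc => by
      rw [norm_mul, norm_pow, norm_pow, RCLike.norm_conj, ← rotation_apply e he c hc]
      have h1 := norm_cdot_le (rotation e he c hc u) w
      have h2 := norm_cdot_le u e
      rw [LinearIsometryEquiv.norm_map] at h1
      rw [he, mul_one] at h2
      calc _ ≤ (‖u‖ * ‖w‖) ^ k * ‖u‖ ^ l := by gcongr
        _ = _ := by rw [mul_pow, pow_add]; ring)
  have h1 : ∀ u : Cn n, cdot u w ^ k * (starRingEnd ℂ) (cdot u z) ^ l =
      (a : ℂ) ^ l * (cdot u w ^ k * (starRingEnd ℂ) (cdot u e) ^ l) := by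
    intro u
    rw [hcdz, map_mul, Complex.conj_ofReal, mul_pow]
    ring
  have h2 : ∀ u : Cn n, cdot (cdot u e • e) w ^ k * (starRingEnd ℂ) (cdot u e) ^ l =
      cdot e w ^ k * (cdot u e ^ k * (starRingEnd ℂ) (cdot u e) ^ l) := by
    intro u
    rw [cdot_smul_left, mul_pow]
    ring
  simp only [h1]
  rw [integral_const_mul, hslice]
  simp only [h2]
  rw [integral_const_mul]
  split_ifs with hkl
  · subst hkl
    rw [hν.integral_cdot_self hn he, ← mul_assoc, ← mul_pow]
    congr 2
    conv_rhs => rw [hz]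
    rw [cdot_smul_left]
  · rw [hν.integral_cdot_of_ne e hkl, mul_zero, mul_zero]

/-- The pairing of two series `∑ α_k (u ⬝ w) ^ k` and `∑ β_l (u ⬝ z) ^ l`. -/
theorem UnitaryInvariant.hasSum_integral {n : ℕ} (hn : 0 < n) {ν : Measure (Cn n)} [SFinite ν]
    (hν : UnitaryInvariant ν) (hint : ∀ m : ℕ, Integrable (fun u : Cn n => ‖u‖ ^ m) ν)
    {α β : ℕ → ℂ} (hα : ∀ r : ℝ, Summable fun k => ‖α k‖ * r ^ k)
    (hβ : ∀ r : ℝ, Summable fun k => ‖β k‖ * r ^ k) (w z : Cn n)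
    (hprod : Integrable (fun u : Cn n => (∑' k, ‖α k‖ * (‖u‖ * ‖w‖) ^ k) *
      ∑' k, ‖β k‖ * (‖u‖ * ‖z‖) ^ k) ν) :
    HasSum (fun l => α l * (starRingEnd ℂ) (β l) * (cdot z w ^ l * coordMoment hn ν l))
      (∫ u, (∑' k, α k * cdot u w ^ k) * (starRingEnd ℂ) (∑' k, β k * cdot u z ^ k) ∂ν) := by
  set F : ℕ × ℕ → Cn n → ℂ := fun i u =>
    (α i.1 * cdot u w ^ i.1) * ((starRingEnd ℂ) (β i.2) * (starRingEnd ℂ) (cdot u z) ^ i.2) with hF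
  have hαs : ∀ u : Cn n, Summable fun k => ‖α k * cdot u w ^ k‖ := fun u =>
    (hα ‖cdot u w‖).congr fun k => by rw [norm_mul, norm_pow]
  have hβs : ∀ u : Cn n, Summable fun k =>
      ‖(starRingEnd ℂ) (β k) * (starRingEnd ℂ) (cdot u z) ^ k‖ := fun u =>
    (hβ ‖cdot u z‖).congr fun k => by
      rw [norm_mul, norm_pow, RCLike.norm_conj, RCLike.norm_conj]
  have hcw := continuous_cdot_left w
  have hcz := continuous_cdot_left z
  have hbound : ∀ (i : ℕ × ℕ) (u : Cn n), ‖F i u‖ ≤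
      (‖α i.1‖ * (‖u‖ * ‖w‖) ^ i.1) * (‖β i.2‖ * (‖u‖ * ‖z‖) ^ i.2) := by
    intro i u
    simp only [hF]
    rw [norm_mul, norm_mul, norm_mul, norm_pow, norm_pow, RCLike.norm_conj, RCLike.norm_conj]
    exact mul_le_mul
      (mul_le_mul_of_nonneg_left (pow_le_pow_left₀ (norm_nonneg _) (norm_cdot_le u w) _)
        (norm_nonneg _))
      (mul_le_mul_of_nonneg_left (pow_le_pow_left₀ (norm_nonneg _) (norm_cdot_le u z) _)
        (norm_nonneg _)) (by positivity) (by positivity)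
  have hdom1 : ∀ u : Cn n, Summable fun i : ℕ × ℕ =>
      (‖α i.1‖ * (‖u‖ * ‖w‖) ^ i.1) * (‖β i.2‖ * (‖u‖ * ‖z‖) ^ i.2) := fun u =>
    Summable.mul_of_nonneg (hα (‖u‖ * ‖w‖)) (hβ (‖u‖ * ‖z‖)) (fun k => by positivity)
      (fun k => by positivity)
  have hdom2 : ∀ u : Cn n, (∑' k, ‖α k‖ * (‖u‖ * ‖w‖) ^ k) * (∑' k, ‖β k‖ * (‖u‖ * ‖z‖) ^ k) =
      ∑' i : ℕ × ℕ, (‖α i.1‖ * (‖u‖ * ‖w‖) ^ i.1) * (‖β i.2‖ * (‖u‖ * ‖z‖) ^ i.2) := fun u =>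
    Summable.tsum_mul_tsum (hα (‖u‖ * ‖w‖)) (hβ (‖u‖ * ‖z‖)) (hdom1 u)
  have hmain := hasSum_integral_of_dominated_convergence (μ := ν) (F := F)
    (f := fun u => (∑' k, α k * cdot u w ^ k) * (starRingEnd ℂ) (∑' k, β k * cdot u z ^ k))
    (fun i u => (‖α i.1‖ * (‖u‖ * ‖w‖) ^ i.1) * (‖β i.2‖ * (‖u‖ * ‖z‖) ^ i.2))
    (fun i => by
      refine Continuous.aestronglyMeasurable ?_
      simp only [hF]
      fun_prop)
    (fun i => ae_of_all _ (hbound i))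
    (ae_of_all _ hdom1)
    (hprod.congr (ae_of_all _ hdom2))
    (ae_of_all _ fun u => by
      have hs := summable_mul_of_summable_norm (hαs u) (hβs u)
      have := (hαs u).of_norm.hasSum.mul (hβs u).of_norm.hasSum hs
      rw [Complex.conj_tsum]
      simp only [map_mul, map_pow]
      exact this)
  have hval : ∀ i : ℕ × ℕ, ∫ u, F i u ∂ν = α i.1 * (starRingEnd ℂ) (β i.2) *
      if i.1 = i.2 then cdot z w ^ i.2 * coordMoment hn ν i.2 else 0 := by
    intro i
    rw [← hν.integral_cdot_pow hn hint w z i.1 i.2, ← integral_const_mul]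
    refine integral_congr_ae (ae_of_all _ fun u => ?_)
    simp only [hF]
    ring
  simp only [hval] at hmain
  have hinj : Function.Injective fun l : ℕ => (l, l) := fun a b h => (Prod.mk.inj h).1
  have := (hinj.hasSum_iff (fun x hx => ?_)).2 hmain
  · simpa [Function.comp_def] using this
  · rw [if_neg, mul_zero]
    rintro h
    exact hx ⟨x.1, Prod.ext rfl h⟩

/-! ### The reproducing kernel and its moments -/

theorem add_pos_of_neg_lt {n : ℕ} {p : ℝ} (hp : -(n : ℝ) < p) : 0 < (n : ℝ) + p := by linarith

theorem kernelT_eq (n : ℕ) (p ħ : ℝ) (z w : Cn n) :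
    kernelT n p ħ z w = theta (n + p) (cdot z w / (ħ : ℂ) ^ 2) := rfl

theorem kernelT_conj (n : ℕ) (p ħ : ℝ) (z w : Cn n) :
    (starRingEnd ℂ) (kernelT n p ħ z w) = kernelT n p ħ w z := by
  rw [kernelT_eq, kernelT_eq, ← theta_conj, map_div₀, map_pow, Complex.conj_ofReal, cdot_conj]

theorem kernelT_self (n : ℕ) (p ħ : ℝ) (z : Cn n) :
    kernelT n p ħ z z = (thetaR (n + p) ((‖z‖ / ħ) ^ 2) : ℂ) := by
  rw [kernelT_eq, cdot_self, ← theta_ofReal]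
  push_cast
  rw [div_pow]

theorem one_le_thetaR_sq {b : ℝ} (hb : 0 < b) (x : ℝ) : 1 ≤ thetaR b (x ^ 2) :=
  one_le_thetaR hb (sq_nonneg x)

theorem kernelT_self_ne_zero {n : ℕ} {p : ℝ} (hp : -(n : ℝ) < p) (ħ : ℝ) (z : Cn n) :
    kernelT n p ħ z z ≠ 0 := by
  rw [kernelT_self]
  have := one_le_thetaR_sq (add_pos_of_neg_lt hp) (‖z‖ / ħ)
  exact_mod_cast (by linarith : thetaR (n + p) ((‖z‖ / ħ) ^ 2) ≠ 0)

theorem continuous_kernelT_left {n : ℕ} {p : ℝ} (hp : -(n : ℝ) < p) (ħ : ℝ) (w : Cn n) :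
    Continuous fun u => kernelT n p ħ u w := by
  simp only [kernelT_eq]
  exact (differentiable_theta (add_pos_of_neg_lt hp)).continuous.comp
    ((continuous_cdot_left w).div_const _)

theorem norm_kernelT_le_thetaR {n : ℕ} {p ħ : ℝ} (hp : -(n : ℝ) < p) (u w : Cn n) :
    ‖kernelT n p ħ u w‖ ≤ thetaR (n + p) (‖u‖ * ‖w‖ / ħ ^ 2) := by
  rw [kernelT_eq]
  refine (norm_theta_le (add_pos_of_neg_lt hp) _).trans
    (thetaR_mono (add_pos_of_neg_lt hp) (norm_nonneg _) ?_)
  rw [norm_div, norm_pow, Complex.norm_real, Real.norm_eq_abs, sq_abs]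
  gcongr
  exact norm_cdot_le u w

theorem thetaR_le_exp {b ħ : ℝ} (hb : 0 < b) (hħ : 0 < ħ) {η : ℝ} (hη : 0 < η) {s t : ℝ}
    (hs : 0 ≤ s) (ht : 0 ≤ t) :
    thetaR b (s * t / ħ ^ 2) ≤ Real.exp (η * s / ħ + (min b 1)⁻¹ * (t / (η * ħ))) := by
  have := thetaR_mul_le hb (x := η * s / ħ) (y := t / (η * ħ)) (by positivity) (by positivity)
  convert this using 2
  field_simp

theorem norm_kernelT_le {n : ℕ} {p ħ : ℝ} (hp : -(n : ℝ) < p) (hħ : 0 < ħ) {η : ℝ} (hη : 0 < η)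
    (u w : Cn n) : ‖kernelT n p ħ u w‖ ≤
      Real.exp (η * ‖u‖ / ħ + (min ((n : ℝ) + p) 1)⁻¹ * (‖w‖ / (η * ħ))) :=
  (norm_kernelT_le_thetaR hp u w).trans
    (thetaR_le_exp (add_pos_of_neg_lt hp) hħ hη (norm_nonneg _) (norm_nonneg _))

/-- The coefficients of `T(u, w)` as a power series in `u ⬝ w`. -/
def kernelCoeff (n : ℕ) (p ħ : ℝ) (k : ℕ) : ℝ := thetaCoeff (n + p) k / ħ ^ (2 * k)

theorem kernelT_eq_tsum (n : ℕ) (p ħ : ℝ) (u w : Cn n) :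
    kernelT n p ħ u w = ∑' k, (kernelCoeff n p ħ k : ℂ) * cdot u w ^ k := by
  rw [kernelT_eq, theta_eq]
  refine tsum_congr fun k => ?_
  rw [kernelCoeff, div_pow, ← pow_mul]
  push_cast
  ring

theorem kernelCoeff_pos {n : ℕ} {p ħ : ℝ} (hp : -(n : ℝ) < p) (hħ : 0 < ħ) (k : ℕ) :
    0 < kernelCoeff n p ħ k :=
  div_pos (thetaCoeff_pos (add_pos_of_neg_lt hp) k) (by positivity)

theorem hasSum_kernelCoeff {n : ℕ} {p ħ : ℝ} (hp : -(n : ℝ) < p) (hħ : 0 < ħ) (r : ℝ) :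
    HasSum (fun k => ‖(kernelCoeff n p ħ k : ℂ)‖ * r ^ k) (thetaR (n + p) (r / ħ ^ 2)) := by
  have := (summable_theta_norm (add_pos_of_neg_lt hp) (r / ħ ^ 2)).hasSum
  refine this.congr_fun fun k => ?_
  rw [Complex.norm_real, Real.norm_eq_abs, abs_of_pos (kernelCoeff_pos hp hħ k), kernelCoeff,
    div_pow, ← pow_mul]
  ring

/-- The coefficients of `t ^ i * ∑ c_k t ^ k`. -/
def shiftCoeff (c : ℕ → ℂ) (i k : ℕ) : ℂ := if i ≤ k then c (k - i) else 0

theorem shiftCoeff_add (c : ℕ → ℂ) (i k : ℕ) : shiftCoeff c i (k + i) = c k := by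
  simp [shiftCoeff]

theorem hasSum_norm_shiftCoeff {c : ℕ → ℂ} {r s : ℝ} (i : ℕ)
    (h : HasSum (fun k => ‖c k‖ * r ^ k) s) :
    HasSum (fun k => ‖shiftCoeff c i k‖ * r ^ k) (r ^ i * s) := by
  refine ((add_left_injective i).hasSum_iff fun k hk => ?_).1 ?_
  · have : ¬ i ≤ k := fun hik => hk ⟨k - i, by simp [hik]⟩
    simp [shiftCoeff, this]
  · refine (h.mul_left (r ^ i)).congr_fun fun k => ?_
    simp only [Function.comp_apply, shiftCoeff_add, pow_add]
    ring

theorem tsum_shiftCoeff {c : ℕ → ℂ} (i : ℕ) (t : ℂ) (h : Summable fun k => c k * t ^ k) :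
    ∑' k, shiftCoeff c i k * t ^ k = t ^ i * ∑' k, c k * t ^ k := by
  refine HasSum.tsum_eq (((add_left_injective i).hasSum_iff fun k hk => ?_).1 ?_)
  · have : ¬ i ≤ k := fun hik => hk ⟨k - i, by simp [hik]⟩
    simp [shiftCoeff, this]
  · refine (h.hasSum.mul_left (t ^ i)).congr_fun fun k => ?_
    simp only [Function.comp_apply, shiftCoeff_add, pow_add]
    ring

theorem ae_sphereMeasure' (n : ℕ) : ∀ᵐ u ∂sphereMeasure' n, ‖u‖ = 1 := by
  rw [sphereMeasure', ae_map_iff measurable_subtype_coe.aemeasurable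
    (measurableSet_eq_fun measurable_norm measurable_const)]
  exact ae_of_all _ fun x => by simp

theorem coordMoment_sphereMeasure' {n : ℕ} (hn : 0 < n) (l : ℕ) :
    coordMoment hn (sphereMeasure' n) l = l.factorial / poch n l := by
  have h0 : 0 ≤ (l.factorial : ℝ) / poch n l :=
    div_nonneg (by positivity) (poch_pos (by exact_mod_cast hn) l).le
  rw [coordMoment, integral_eq_lintegral_of_nonneg_ae (ae_of_all _ fun u => by positivity)
    (by fun_prop), lintegral_sphereMeasure' (by fun_prop), lintegral_sphere_coord hn l,
    ENNReal.toReal_ofReal h0]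

/-- The coherent states have reproducing kernel `T`: the sphere moments `l! / (n)_l` turn the squared
coefficients `c_l² / l!²` into `1 / (l! (n + p)_l)`. -/
theorem inner_coh {n : ℕ} (hn : 0 < n) {p ħ : ℝ} (hp : -(n : ℝ) < p) (hħ : 0 < ħ) (w z : Cn n) :
    inner ℂ (coh n p ħ w) (coh n p ħ z) = kernelT n p ħ w z := by
  have hprob := isProbabilityMeasure_sphereMeasure hn
  have hfin : IsFiniteMeasure (sphereMeasure' n) := by
    unfold sphereMeasure'; infer_instance
  have hb := add_pos_of_neg_lt hp
  set α : ℕ → ℂ := fun k => ((cohCoeff n p k / (k.factorial : ℝ) / ħ ^ k : ℝ) : ℂ) with hα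
  have hser : ∀ x z : Cn n, cohFun n p ħ x z = ∑' k, α k * cdot x z ^ k := by
    intro x z
    rw [cohFun, cohSeries]
    refine tsum_congr fun k => ?_
    simp only [hα, div_pow]
    push_cast
    ring
  have hsum : ∀ r : ℝ, Summable fun k => ‖α k‖ * r ^ k := by
    intro r
    obtain ⟨M, hM0, hM⟩ := cohCoeff_le n p
    have hE : ExpType α := ⟨M / ħ, by positivity, fun k => by
      simp only [hα, Complex.norm_real, Real.norm_eq_abs, abs_div, Nat.abs_cast, abs_pow,
        abs_of_pos hħ, div_pow]
      rw [div_right_comm]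
      gcongr
      exact hM k⟩
    exact hE.summable r
  have hint : ∀ m : ℕ, Integrable (fun u : Cn n => ‖u‖ ^ m) (sphereMeasure' n) := fun m =>
    (integrable_const (1 : ℝ)).congr (by
      filter_upwards [ae_sphereMeasure' n] with u hu
      rw [hu, one_pow])
  have hpair := (unitaryInvariant_sphereMeasure' hn).hasSum_integral hn hint hsum hsum z w
    ((integrable_const ((∑' k, ‖α k‖ * (1 * ‖z‖) ^ k) * ∑' k, ‖α k‖ * (1 * ‖w‖) ^ k)).congr (by
      filter_upwards [ae_sphereMeasure' n] with u hu
      rw [hu]))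
  have hleft : inner ℂ (coh n p ħ w) (coh n p ħ z) =
      ∫ u, (∑' k, α k * cdot u z ^ k) * (starRingEnd ℂ) (∑' k, α k * cdot u w ^ k)
        ∂sphereMeasure' n := by
    rw [Submodule.coe_inner, L2.inner_def, sphereMeasure',
      (MeasurableEmbedding.subtype_coe Metric.isClosed_sphere.measurableSet).integral_map]
    refine integral_congr_ae ?_
    filter_upwards [(cohFun_memLp n p ħ w).coeFn_toLp, (cohFun_memLp n p ħ z).coeFn_toLp]
      with x hx hx'
    simp only [coh, hx, hx', ← hser]
    rw [RCLike.inner_apply']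
    exact mul_comm _ _
  rw [hleft, ← hpair.tsum_eq, kernelT_eq_tsum]
  refine tsum_congr fun k => ?_
  rw [coordMoment_sphereMeasure' hn]
  simp only [hα, Complex.conj_ofReal]
  have h1 := poch_pos (b := (n : ℝ)) (by exact_mod_cast hn) k
  have h2 := poch_pos hb k
  have h3 : cohCoeff n p k * cohCoeff n p k = poch n k / poch (n + p) k := by
    rw [cohCoeff, Real.mul_self_sqrt (by positivity)]
  have h4 : cohCoeff n p k / (k.factorial : ℝ) / ħ ^ k * (cohCoeff n p k / (k.factorial : ℝ) / ħ ^ k)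
      * (k.factorial / poch n k) = kernelCoeff n p ħ k := by
    rw [kernelCoeff, thetaCoeff, pow_mul, sq, mul_pow]
    have : cohCoeff n p k / (k.factorial : ℝ) / ħ ^ k * (cohCoeff n p k / (k.factorial : ℝ) / ħ ^ k)
      * (k.factorial / poch n k) = (cohCoeff n p k * cohCoeff n p k) / (k.factorial : ℝ) / (ħ ^ k * ħ ^ k)
      / poch n k := by
      field_simp
    rw [this, h3]
    field_simp
  rw [← h4]
  push_cast
  ring

theorem integrable_pow_mul_exp {n : ℕ} (hn : 0 < n) {p ħ : ℝ} (hp : -(n : ℝ) < p) (hħ : 0 < ħ)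
    (k : ℕ) : Integrable (fun u : Cn n => ‖u‖ ^ k * Real.exp (‖u‖ / (2 * ħ)))
      (mMeasure n p ħ) := by
  have h1 : Integrable (fun u : Cn n => Real.exp (‖u‖ / ħ)) (mMeasure n p ħ) := by
    refine ⟨Continuous.aestronglyMeasurable (by fun_prop), ?_⟩
    rw [hasFiniteIntegral_iff_ofReal (ae_of_all _ fun u => by positivity)]
    exact (lintegral_mMeasure_exp_le hn hp hħ).trans_lt ENNReal.ofReal_lt_top
  refine (h1.const_mul (k.factorial * (2 * ħ) ^ k)).mono'
    (Continuous.aestronglyMeasurable (by fun_prop)) (ae_of_all _ fun u => ?_)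
  rw [Real.norm_of_nonneg (by positivity)]
  have h2 := Real.pow_div_factorial_le_exp (‖u‖ / (2 * ħ)) (by positivity) k
  rw [div_pow, div_div, div_le_iff₀ (by positivity)] at h2
  calc ‖u‖ ^ k * Real.exp (‖u‖ / (2 * ħ)) ≤
      (Real.exp (‖u‖ / (2 * ħ)) * ((2 * ħ) ^ k * k.factorial)) * Real.exp (‖u‖ / (2 * ħ)) := by
        gcongr
    _ = k.factorial * (2 * ħ) ^ k * (Real.exp (‖u‖ / (2 * ħ)) * Real.exp (‖u‖ / (2 * ħ))) := by ring
    _ = _ := by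
      rw [← Real.exp_add]
      congr 2
      field_simp
      norm_num

theorem integrable_pow_mMeasure {n : ℕ} (hn : 0 < n) {p ħ : ℝ} (hp : -(n : ℝ) < p) (hħ : 0 < ħ)
    (k : ℕ) : Integrable (fun u : Cn n => ‖u‖ ^ k) (mMeasure n p ħ) := by
  refine (integrable_pow_mul_exp hn hp hħ k).mono' (Continuous.aestronglyMeasurable (by fun_prop))
    (ae_of_all _ fun u => ?_)
  rw [Real.norm_of_nonneg (by positivity)]
  exact le_mul_of_one_le_right (by positivity) (Real.one_le_exp (by positivity))

/-- The measure `|u| ^ (2 a) dm`. -/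
def weightedM (n : ℕ) (p ħ : ℝ) (a : ℕ) : Measure (Cn n) :=
  (mMeasure n p ħ).withDensity fun u => ENNReal.ofReal (‖u‖ ^ (2 * a))

instance (n : ℕ) (p ħ : ℝ) (a : ℕ) : SFinite (weightedM n p ħ a) := by
  unfold weightedM mMeasure; infer_instance

theorem unitaryInvariant_weightedM {n : ℕ} (hn : 0 < n) {p ħ : ℝ} (hp : -(n : ℝ) < p)
    (hħ : 0 < ħ) (a : ℕ) : UnitaryInvariant (weightedM n p ħ a) :=
  (unitaryInvariant_mMeasure hn hp hħ).withDensity_norm (by fun_prop) fun U u => by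
    rw [LinearIsometryEquiv.norm_map]

theorem integral_weightedM {n : ℕ} {p ħ : ℝ} (a : ℕ) (f : Cn n → ℂ) :
    ∫ u, f u ∂weightedM n p ħ a = ∫ u, ((‖u‖ ^ (2 * a) : ℝ) : ℂ) * f u ∂mMeasure n p ħ := by
  rw [weightedM, integral_withDensity_eq_integral_toReal_smul₀ (by fun_prop)
    (ae_of_all _ fun u => ENNReal.ofReal_lt_top)]
  refine integral_congr_ae (ae_of_all _ fun u => ?_)
  simp only [ENNReal.toReal_ofReal (by positivity : (0 : ℝ) ≤ ‖u‖ ^ (2 * a)), Complex.real_smul]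

theorem integrable_weightedM {n : ℕ} {p ħ : ℝ} (a : ℕ) {f : Cn n → ℝ}
    (hf : Integrable (fun u => ‖u‖ ^ (2 * a) * f u) (mMeasure n p ħ)) :
    Integrable f (weightedM n p ħ a) := by
  rw [weightedM, integrable_withDensity_iff_integrable_smul' (by fun_prop)
    (ae_of_all _ fun u => ENNReal.ofReal_lt_top)]
  refine hf.congr (ae_of_all _ fun u => ?_)
  simp only [ENNReal.toReal_ofReal (by positivity : (0 : ℝ) ≤ ‖u‖ ^ (2 * a)), smul_eq_mul]

theorem coordMoment_weightedM {n : ℕ} (hn : 0 < n) {p ħ : ℝ} (hp : -(n : ℝ) < p)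
    (hħ : 0 < ħ) (a l : ℕ) : coordMoment hn (weightedM n p ħ a) l =
      l.factorial / poch n l * (poch n (l + a) * poch (n + p) (l + a) * ħ ^ (2 * (l + a))) := by
  have hn' : (0 : ℝ) < n := by exact_mod_cast hn
  have h0 : 0 ≤ (l.factorial : ℝ) / poch n l := div_nonneg (by positivity) (poch_pos hn' l).le
  have h1 := (poch_pos hn' (l + a)).le
  have h2 := (poch_pos (add_pos_of_neg_lt hp) (l + a)).le
  have hmeas : Measurable fun u : Cn n => ENNReal.ofReal (‖u ⟨0, hn⟩‖ ^ (2 * l)) := by fun_prop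
  rw [coordMoment, integral_eq_lintegral_of_nonneg_ae (ae_of_all _ fun u => by positivity)
    (by fun_prop), weightedM, lintegral_withDensity_eq_lintegral_mul _ (by fun_prop) hmeas,
    lintegral_mMeasure_polar hn hp hħ (by fun_prop)]
  have h3 : ∀ (u : Cn n) (x : Sph n), ((fun u : Cn n => ENNReal.ofReal (‖u‖ ^ (2 * a))) *
      fun u : Cn n => ENNReal.ofReal (‖u ⟨0, hn⟩‖ ^ (2 * l))) (‖u‖ • (x : Cn n)) =
      ENNReal.ofReal (‖u‖ ^ (2 * (l + a))) *
        ENNReal.ofReal (‖(x : Cn n) ⟨0, hn⟩‖ ^ (2 * l)) := by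
    intro u x
    have hx : ‖(x : Cn n)‖ = 1 := by simp
    simp only [Pi.mul_apply, norm_smul, norm_norm, hx, mul_one, PiLp.smul_apply]
    rw [← ENNReal.ofReal_mul (by positivity), ← ENNReal.ofReal_mul (by positivity)]
    congr 1
    ring
  simp only [h3]
  rw [lintegral_congr fun u => lintegral_const_mul _ (by fun_prop)]
  simp only [lintegral_sphere_coord hn l]
  rw [lintegral_mul_const _ (by fun_prop), lintegral_mMeasure_pow hn hp hħ, mul_comm,
    ENNReal.toReal_mul, ENNReal.toReal_ofReal h0, ENNReal.toReal_ofReal (by positivity)]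

theorem integrable_kernel_dom {n : ℕ} (hn : 0 < n) {p ħ : ℝ} (hp : -(n : ℝ) < p) (hħ : 0 < ħ)
    (k : ℕ) (w z : Cn n) :
    Integrable (fun u : Cn n => ‖u‖ ^ k * (thetaR (n + p) (‖u‖ * ‖w‖ / ħ ^ 2) *
      thetaR (n + p) (‖u‖ * ‖z‖ / ħ ^ 2))) (mMeasure n p ħ) := by
  have hb := add_pos_of_neg_lt hp
  have hcont : ∀ t : ℝ, Continuous fun u : Cn n => thetaR (n + p) (‖u‖ * t / ħ ^ 2) := by
    intro t
    have h1 : Continuous fun y : ℝ => thetaR (n + p) y := by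
      have h2 : (fun y : ℝ => thetaR (n + p) y) = fun y : ℝ => (theta (n + p) (y : ℂ)).re := by
        funext y
        rw [theta_ofReal, Complex.ofReal_re]
      rw [h2]
      exact Complex.continuous_re.comp
        ((differentiable_theta hb).continuous.comp Complex.continuous_ofReal)
    exact h1.comp (by fun_prop)
  have hcw := hcont ‖w‖
  have hcz := hcont ‖z‖
  refine ((integrable_pow_mul_exp hn hp hħ k).const_mul
    (Real.exp ((min ((n : ℝ) + p) 1)⁻¹ * (‖w‖ / (1 / 4 * ħ))) *
      Real.exp ((min ((n : ℝ) + p) 1)⁻¹ * (‖z‖ / (1 / 4 * ħ))))).mono'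
    (Continuous.aestronglyMeasurable (by fun_prop)) (ae_of_all _ fun u => ?_)
  have h0 : ∀ t : ℝ, 0 ≤ t → 0 ≤ thetaR (n + p) (‖u‖ * t / ħ ^ 2) := fun t ht =>
    zero_le_one.trans (one_le_thetaR hb (by positivity))
  have hw := thetaR_le_exp hb hħ (η := 1 / 4) (by norm_num) (norm_nonneg u) (norm_nonneg w)
  have hz := thetaR_le_exp hb hħ (η := 1 / 4) (by norm_num) (norm_nonneg u) (norm_nonneg z)
  rw [Real.norm_of_nonneg (mul_nonneg (by positivity)
    (mul_nonneg (h0 _ (norm_nonneg _)) (h0 _ (norm_nonneg _))))]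
  calc _ ≤ ‖u‖ ^ k * (_ * _) := mul_le_mul_of_nonneg_left
        (mul_le_mul hw hz (h0 _ (norm_nonneg _)) (Real.exp_pos _).le) (by positivity)
    _ = _ := by
      rw [Real.exp_add, Real.exp_add,
        show ‖u‖ / (2 * ħ) = 1 / 4 * ‖u‖ / ħ + 1 / 4 * ‖u‖ / ħ by
          field_simp
          ring,
        Real.exp_add]
      ring

/-- The series expansion of `∫ |u| ^ (2 a) (u ⬝ w) ^ i T(u, w) conj ((u ⬝ z) ^ j T(u, z)) dm`. -/
theorem hasSum_integral_kernelT {n : ℕ} (hn : 0 < n) {p ħ : ℝ} (hp : -(n : ℝ) < p) (hħ : 0 < ħ)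
    (a i j : ℕ) (w z : Cn n) :
    HasSum (fun l => shiftCoeff (fun k => (kernelCoeff n p ħ k : ℂ)) i l *
        (starRingEnd ℂ) (shiftCoeff (fun k => (kernelCoeff n p ħ k : ℂ)) j l) *
        (cdot z w ^ l * coordMoment hn (weightedM n p ħ a) l))
      (∫ u, ((‖u‖ ^ (2 * a) : ℝ) : ℂ) * ((cdot u w ^ i * kernelT n p ħ u w) *
        (starRingEnd ℂ) (cdot u z ^ j * kernelT n p ħ u z)) ∂mMeasure n p ħ) := by
  have hs : ∀ i r, HasSum (fun k => ‖shiftCoeff (fun k => (kernelCoeff n p ħ k : ℂ)) i k‖ * r ^ k)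
      (r ^ i * thetaR (n + p) (r / ħ ^ 2)) := fun i r =>
    hasSum_norm_shiftCoeff i (hasSum_kernelCoeff hp hħ r)
  have hT : ∀ (i : ℕ) (u w : Cn n), cdot u w ^ i * kernelT n p ħ u w =
      ∑' k, shiftCoeff (fun k => (kernelCoeff n p ħ k : ℂ)) i k * cdot u w ^ k := by
    intro i u w
    rw [kernelT_eq_tsum, tsum_shiftCoeff]
    refine Summable.of_norm ((hasSum_kernelCoeff hp hħ ‖cdot u w‖).summable.congr fun k => ?_)
    rw [norm_mul, norm_pow]
  simp only [hT]
  rw [← integral_weightedM]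
  refine (unitaryInvariant_weightedM hn hp hħ a).hasSum_integral hn (fun m => ?_)
    (fun r => (hs i r).summable) (fun r => (hs j r).summable) w z ?_
  · refine integrable_weightedM a ?_
    simpa only [← pow_add] using integrable_pow_mMeasure hn hp hħ (2 * a + m)
  · refine integrable_weightedM a ?_
    have h1 := (integrable_kernel_dom hn hp hħ (2 * a + i + j) w z).const_mul (‖w‖ ^ i * ‖z‖ ^ j)
    refine h1.congr (ae_of_all _ fun u => ?_)
    have e1 := (hs i (‖u‖ * ‖w‖)).tsum_eq
    have e2 := (hs j (‖u‖ * ‖z‖)).tsum_eq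
    simp only [e1, e2]
    simp only [mul_pow, pow_add]
    ring

theorem integrable_kernelT {n : ℕ} (hn : 0 < n) {p ħ : ℝ} (hp : -(n : ℝ) < p) (hħ : 0 < ħ)
    (a i j : ℕ) (w z : Cn n) :
    Integrable (fun u => ((‖u‖ ^ (2 * a) : ℝ) : ℂ) * ((cdot u w ^ i * kernelT n p ħ u w) *
        (starRingEnd ℂ) (cdot u z ^ j * kernelT n p ħ u z))) (mMeasure n p ħ) := by
  have hw := continuous_kernelT_left hp ħ w
  have hz := continuous_kernelT_left hp ħ z
  have hcw := continuous_cdot_left w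
  have hcz := continuous_cdot_left z
  have h1 := (integrable_kernel_dom hn hp hħ (2 * a + i + j) w z).const_mul (‖w‖ ^ i * ‖z‖ ^ j)
  refine h1.mono' (Continuous.aestronglyMeasurable (by fun_prop)) (ae_of_all _ fun u => ?_)
  have h2 := norm_kernelT_le_thetaR (ħ := ħ) hp u w
  have h3 := norm_kernelT_le_thetaR (ħ := ħ) hp u z
  rw [norm_mul, norm_mul, RCLike.norm_conj, norm_mul, norm_mul, norm_pow, norm_pow,
    Complex.norm_real, Real.norm_of_nonneg (by positivity)]
  calc _ ≤ ‖u‖ ^ (2 * a) * (((‖u‖ * ‖w‖) ^ i * thetaR (n + p) (‖u‖ * ‖w‖ / ħ ^ 2)) *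
        ((‖u‖ * ‖z‖) ^ j * thetaR (n + p) (‖u‖ * ‖z‖ / ħ ^ 2))) := by
        refine mul_le_mul_of_nonneg_left (mul_le_mul ?_ ?_ (by positivity) ?_) (by positivity)
        · exact mul_le_mul (pow_le_pow_left₀ (norm_nonneg _) (norm_cdot_le u w) _) h2
            (norm_nonneg _) (by positivity)
        · exact mul_le_mul (pow_le_pow_left₀ (norm_nonneg _) (norm_cdot_le u z) _) h3
            (norm_nonneg _) (by positivity)
        · exact mul_nonneg (by positivity) ((norm_nonneg _).trans h2)
    _ = _ := by
      simp only [mul_pow, pow_add]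
      ring

/-- The reproducing property of `T` in `L²(m)`. -/
theorem integral_kernelT_mul_conj {n : ℕ} (hn : 0 < n) {p ħ : ℝ} (hp : -(n : ℝ) < p) (hħ : 0 < ħ)
    (w z : Cn n) : ∫ u, kernelT n p ħ u w * (starRingEnd ℂ) (kernelT n p ħ u z) ∂mMeasure n p ħ =
      kernelT n p ħ z w := by
  have h := hasSum_integral_kernelT hn hp hħ 0 0 0 w z
  simp only [mul_zero, pow_zero, Complex.ofReal_one, one_mul] at h
  rw [← h.tsum_eq, kernelT_eq_tsum]
  refine tsum_congr fun l => ?_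
  have h1 := poch_pos (b := (n : ℝ)) (by exact_mod_cast hn) l
  have h2 := poch_pos (add_pos_of_neg_lt hp) l
  have h3 : kernelCoeff n p ħ l * kernelCoeff n p ħ l * coordMoment hn (weightedM n p ħ 0) l =
      kernelCoeff n p ħ l := by
    rw [coordMoment_weightedM hn hp hħ, kernelCoeff, thetaCoeff, add_zero]
    field_simp
  rw [show ∀ c : ℕ → ℂ, shiftCoeff c 0 l = c l from fun c => shiftCoeff_add c 0 l,
    Complex.conj_ofReal]
  calc _ = ((kernelCoeff n p ħ l * kernelCoeff n p ħ l *
        coordMoment hn (weightedM n p ħ 0) l : ℝ) : ℂ) * cdot z w ^ l := by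
        push_cast
        ring
    _ = _ := by rw [h3]

/-- The weighted moments of `|T(u, z)|²` as Bessel sums. -/
theorem integral_weight_kernelT {n : ℕ} (hn : 0 < n) {p ħ : ℝ} (hp : -(n : ℝ) < p) (hħ : 0 < ħ)
    (a d j : ℕ) (z : Cn n) (P : Polynomial ℝ)
    (hP : ∀ k : ℕ, ((k + d + j).factorial : ℝ) * poch n (k + d + j + a) *
      poch (n + p) (k + d + j + a) = poch n (k + d + j) * (k + d).factorial * poch (n + p) (k + d) *
        P.eval (k : ℝ)) :
    ∫ u, ((‖u‖ ^ (2 * a) : ℝ) : ℂ) * ((cdot u z ^ (d + j) * kernelT n p ħ u z) *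
        (starRingEnd ℂ) (cdot u z ^ j * kernelT n p ħ u z)) ∂mMeasure n p ħ =
      ((ħ ^ (2 * d + 4 * j + 2 * a) * ((‖z‖ / ħ) ^ 2) ^ (d + j) *
        besselSum (add_pos_of_neg_lt hp) ((‖z‖ / ħ) ^ 2) P : ℝ) : ℂ) := by
  have h := hasSum_integral_kernelT hn hp hħ a (d + j) j z z
  have h' := ((add_left_injective (d + j)).hasSum_iff fun k hk => ?_).2 h
  · have h2 := Complex.hasSum_ofReal.2 (((besselSum_hasSum (add_pos_of_neg_lt hp) ((‖z‖ / ħ) ^ 2)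
      P).mul_left (ħ ^ (2 * d + 4 * j + 2 * a) * ((‖z‖ / ħ) ^ 2) ^ (d + j))))
    refine h'.unique (h2.congr_fun fun k => ?_)
    have e1 : ∀ c : ℕ → ℂ, shiftCoeff c (d + j) (k + (d + j)) = c k := fun c =>
      shiftCoeff_add c _ _
    have e2 : ∀ c : ℕ → ℂ, shiftCoeff c j (k + (d + j)) = c (k + d) := fun c => by
      rw [← add_assoc, shiftCoeff_add]
    simp only [Function.comp_apply, e1, e2, Complex.conj_ofReal, cdot_self]
    rw [← Complex.ofReal_pow, ← Complex.ofReal_mul, ← Complex.ofReal_mul, ← Complex.ofReal_mul,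
      Complex.ofReal_inj, coordMoment_weightedM hn hp hħ, ← add_assoc]
    have hn' : (0 : ℝ) < n := by exact_mod_cast hn
    have h1 := poch_pos hn' (k + d + j)
    have h3 := poch_pos (add_pos_of_neg_lt hp) k
    have h4 := poch_pos (add_pos_of_neg_lt hp) (k + d)
    have hPk : P.eval (k : ℝ) = ((k + d + j).factorial : ℝ) * poch n (k + d + j + a) *
      poch (n + p) (k + d + j + a) / (poch n (k + d + j) * (k + d).factorial *
        poch (n + p) (k + d)) := by
      rw [hP k]
      field_simp
    rw [hPk]
    simp only [kernelCoeff, thetaCoeff, div_pow, ← pow_mul]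
    field_simp
    ring
  · have : ¬ (d + j ≤ k) := fun hik => hk ⟨k - (d + j), by simp [hik]⟩
    simp [shiftCoeff, this]

/-- The kernel `|T(u, z)|²` is concentrated near `u = z`, at the scale `√ħ`. -/
theorem exists_integral_norm_sub_pow_four_le {n : ℕ} (hn : 0 < n) {p : ℝ} (hp : -(n : ℝ) < p) :
    ∃ K : ℝ, 0 ≤ K ∧ ∀ ħ : ℝ, 0 < ħ → ∀ z : Cn n, ħ ≤ ‖z‖ →
      Integrable (fun u => ‖u - z‖ ^ 4 * ‖kernelT n p ħ u z‖ ^ 2) (mMeasure n p ħ) ∧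
      ∫ u, ‖u - z‖ ^ 4 * ‖kernelT n p ħ u z‖ ^ 2 ∂mMeasure n p ħ ≤
        K * ħ ^ 2 * ‖z‖ ^ 2 * thetaR (n + p) ((‖z‖ / ħ) ^ 2) := by
  obtain ⟨K, hK0, hK⟩ := exists_besselFourth (add_pos_of_neg_lt hp) (n : ℝ)
  refine ⟨K, hK0, fun ħ hħ z hz => ?_⟩
  set T : Cn n → ℂ := fun u => kernelT n p ħ u z with hT
  set s : Cn n → ℂ := fun u => cdot u z with hs
  -- `|u - z|⁴ = (|u|² - 2 Re s + |z|²)²` is the real part of a combination of the monomials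
  -- `|u| ^ (2 a) s ^ i (conj s) ^ j`, whose moments are Bessel sums
  set I : ℕ → ℕ → ℕ → Cn n → ℂ := fun a i j u =>
    ((‖u‖ ^ (2 * a) : ℝ) : ℂ) * ((s u ^ i * T u) * (starRingEnd ℂ) (s u ^ j * T u)) with hI
  have hint : ∀ a i j, Integrable (I a i j) (mMeasure n p ħ) := fun a i j =>
    integrable_kernelT hn hp hħ a i j z z
  set r : ℂ := ((‖z‖ ^ 2 : ℝ) : ℂ) with hr
  set f : Cn n → ℂ := fun u => I 2 0 0 u + r ^ 2 * I 0 0 0 u + 2 * r * I 1 0 0 u + 2 * I 0 2 0 u +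
    2 * I 0 1 1 u - 4 * I 1 1 0 u - 4 * r * I 0 1 0 u with hf
  have hfi : Integrable f (mMeasure n p ħ) :=
    (((((((hint 2 0 0).add ((hint 0 0 0).const_mul (r ^ 2))).add
      ((hint 1 0 0).const_mul (2 * r))).add ((hint 0 2 0).const_mul 2)).add
      ((hint 0 1 1).const_mul 2)).sub ((hint 1 1 0).const_mul 4)).sub
      ((hint 0 1 0).const_mul (4 * r)))
  have hre : ∀ u, ‖u - z‖ ^ 4 * ‖T u‖ ^ 2 = (f u).re := by
    intro u
    have h1 : ‖u - z‖ ^ 2 = ‖u‖ ^ 2 - 2 * (s u).re + ‖z‖ ^ 2 := by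
      rw [@norm_sub_sq ℂ, inner_re_symm, hs]
      simp only [cdot_eq_inner]
      rfl
    have h2 : ∀ a i j, I a i j u = ((‖u‖ ^ (2 * a) * ‖T u‖ ^ 2 : ℝ) : ℂ) *
        (s u ^ i * (starRingEnd ℂ) (s u) ^ j) := by
      intro a i j
      simp only [hI, map_mul, map_pow]
      have : T u * (starRingEnd ℂ) (T u) = ((‖T u‖ ^ 2 : ℝ) : ℂ) := by
        rw [Complex.mul_conj']
        push_cast
        rfl
      push_cast at this ⊢
      linear_combination ((‖u‖ : ℂ) ^ (2 * a) * s u ^ i * (starRingEnd ℂ) (s u) ^ j) * this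
    have h3 : f u = ((‖T u‖ ^ 2 : ℝ) : ℂ) * (((‖u‖ ^ 4 + ‖z‖ ^ 4 + 2 * ‖z‖ ^ 2 * ‖u‖ ^ 2 : ℝ) : ℂ) +
        2 * s u ^ 2 + 2 * (s u * (starRingEnd ℂ) (s u)) -
        ((4 * (‖u‖ ^ 2 + ‖z‖ ^ 2) : ℝ) : ℂ) * s u) := by
      simp only [hf, h2, hr]
      push_cast
      ring
    rw [h3, Complex.re_ofReal_mul, Complex.sub_re, Complex.re_ofReal_mul, Complex.add_re,
      Complex.add_re, Complex.ofReal_re, Complex.mul_conj, sq (s u)]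
    simp only [Complex.mul_re, Complex.mul_im, Complex.ofReal_re, Complex.ofReal_im,
      Complex.re_ofNat, Complex.im_ofNat, Complex.normSq_apply]
    rw [show ‖u - z‖ ^ 4 = (‖u - z‖ ^ 2) ^ 2 by ring, h1]
    ring
  have hval : ∀ a d j (P : Polynomial ℝ), (∀ k : ℕ, ((k + d + j).factorial : ℝ) *
      poch n (k + d + j + a) * poch (n + p) (k + d + j + a) =
      poch n (k + d + j) * (k + d).factorial * poch (n + p) (k + d) * P.eval (k : ℝ)) →
      ∫ u, I a (d + j) j u ∂mMeasure n p ħ =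
      ((ħ ^ (2 * d + 4 * j + 2 * a) * ((‖z‖ / ħ) ^ 2) ^ (d + j) *
        besselSum (add_pos_of_neg_lt hp) ((‖z‖ / ħ) ^ 2) P : ℝ) : ℂ) := fun a d j P hP =>
    integral_weight_kernelT hn hp hħ a d j z P hP
  have e0 := hval 0 0 0 1 (fun k => by
    simp only [add_zero, Polynomial.eval_one, mul_one]
    ring)
  have e1 := hval 1 0 0 ((Polynomial.X + Polynomial.C (n : ℝ)) *
    (Polynomial.X + Polynomial.C (n + p))) (fun k => by
      simp only [add_zero, poch_succ, Polynomial.eval_mul, Polynomial.eval_add, Polynomial.eval_X,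
        Polynomial.eval_C]
      ring)
  have e2 := hval 2 0 0 ((Polynomial.X + Polynomial.C (n : ℝ)) *
    (Polynomial.X + Polynomial.C (n : ℝ) + 1) * (Polynomial.X + Polynomial.C (n + p)) *
    (Polynomial.X + Polynomial.C (n + p) + 1)) (fun k => by
      simp only [add_zero, poch_succ, Polynomial.eval_mul, Polynomial.eval_add, Polynomial.eval_X,
        Polynomial.eval_C, Polynomial.eval_one]
      push_cast
      ring)
  have e3 := hval 0 2 0 1 (fun k => by
    simp only [add_zero, Polynomial.eval_one, mul_one]
    ring)
  have e4 := hval 0 0 1 ((Polynomial.X + 1) * (Polynomial.X + Polynomial.C (n + p))) (fun k => by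
      simp only [add_zero, poch_succ, Polynomial.eval_mul, Polynomial.eval_add, Polynomial.eval_X,
        Polynomial.eval_C, Polynomial.eval_one, Nat.factorial_succ]
      push_cast
      ring)
  have e5 := hval 1 1 0 ((Polynomial.X + Polynomial.C (n : ℝ) + 1) *
    (Polynomial.X + Polynomial.C (n + p) + 1)) (fun k => by
      simp only [add_zero, poch_succ, Polynomial.eval_mul, Polynomial.eval_add, Polynomial.eval_X,
        Polynomial.eval_C, Polynomial.eval_one, Nat.factorial_succ]
      push_cast
      ring)
  have e6 := hval 0 1 0 1 (fun k => by
    simp only [add_zero, Polynomial.eval_one, mul_one]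
    ring)
  have hsplit : ∫ u, f u ∂mMeasure n p ħ = ∫ u, I 2 0 0 u ∂mMeasure n p ħ +
      r ^ 2 * ∫ u, I 0 0 0 u ∂mMeasure n p ħ + 2 * r * ∫ u, I 1 0 0 u ∂mMeasure n p ħ +
      2 * ∫ u, I 0 2 0 u ∂mMeasure n p ħ + 2 * ∫ u, I 0 1 1 u ∂mMeasure n p ħ -
      4 * ∫ u, I 1 1 0 u ∂mMeasure n p ħ - 4 * r * ∫ u, I 0 1 0 u ∂mMeasure n p ħ := by
    have g1 := hint 2 0 0
    have g2 := (hint 0 0 0).const_mul (r ^ 2)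
    have g3 := (hint 1 0 0).const_mul (2 * r)
    have g4 := (hint 0 2 0).const_mul 2
    have g5 := (hint 0 1 1).const_mul 2
    have g6 := (hint 1 1 0).const_mul 4
    have g7 := (hint 0 1 0).const_mul (4 * r)
    refine (integral_sub (((((g1.add g2).add g3).add g4).add g5).sub g6) g7).trans ?_
    rw [integral_sub' ((((g1.add g2).add g3).add g4).add g5) g6,
      integral_add' (((g1.add g2).add g3).add g4) g5, integral_add' ((g1.add g2).add g3) g4,
      integral_add' (g1.add g2) g3, integral_add' g1 g2]
    simp only [integral_const_mul]
  have hfun : (fun u => ‖u - z‖ ^ 4 * ‖T u‖ ^ 2) = fun u => (f u).re := funext hre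
  refine ⟨?_, ?_⟩
  · rw [hfun]
    exact hfi.re
  · have hre' : ∫ u, (f u).re ∂mMeasure n p ħ = (∫ u, f u ∂mMeasure n p ħ).re := integral_re hfi
    have hfourth := hK ((‖z‖ / ħ) ^ 2) (by
      have : 1 ≤ ‖z‖ / ħ := (one_le_div hħ).2 hz
      nlinarith)
    rw [hfun, hre', hsplit]
    simp only [add_zero, zero_add, Nat.reduceAdd, mul_zero, mul_one, Nat.reduceMul] at e0 e1 e2 e3 e4 e5 e6
    rw [e0, e1, e2, e3, e4, e5, e6, hr]
    have hzħ : ‖z‖ ^ 2 = ħ ^ 2 * (‖z‖ / ħ) ^ 2 := by field_simp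
    generalize (‖z‖ / ħ) ^ 2 = y at *
    rw [hzħ]
    norm_cast
    refine le_trans (le_of_eq ?_) ((mul_le_mul_of_nonneg_left hfourth
      (by positivity : (0 : ℝ) ≤ ħ ^ 4)).trans (le_of_eq ?_))
    · ring
    · ring

/-! ### Analyticity of the coherent states -/

theorem cohCoeff_pos {n : ℕ} (hn : 0 < n) {p : ℝ} (hp : -(n : ℝ) < p) (l : ℕ) :
    0 < cohCoeff n p l :=
  Real.sqrt_pos.2 (div_pos (poch_pos (by exact_mod_cast hn) l) (poch_pos (add_pos_of_neg_lt hp) l))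

/-- The coefficients of the entire function `cohSeries`. -/
def cohSeriesCoeff (n : ℕ) (p : ℝ) (l : ℕ) : ℂ := ((cohCoeff n p l / (l.factorial : ℝ) : ℝ) : ℂ)

theorem cohSeriesCoeff_expType (n : ℕ) (p : ℝ) : ExpType (cohSeriesCoeff n p) := by
  obtain ⟨M, hM0, hM⟩ := cohCoeff_le n p
  refine ⟨M, hM0, fun k => ?_⟩
  rw [cohSeriesCoeff, Complex.norm_real, Real.norm_eq_abs, abs_div, Nat.abs_cast]
  gcongr
  exact hM k

/-- The function `cohSeries` on the Banach algebra of continuous functions on the sphere. -/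
def cohCalc (n : ℕ) (p : ℝ) : C(Sph n, ℂ) → C(Sph n, ℂ) :=
  FormalMultilinearSeries.ofScalarsSum (cohSeriesCoeff n p)

theorem contDiff_cohCalc (n : ℕ) (p : ℝ) : ContDiff ℂ ⊤ (cohCalc n p) :=
  (cohSeriesCoeff_expType n p).contDiff _ _

theorem cohCalc_apply (n : ℕ) (p : ℝ) (g : C(Sph n, ℂ)) (x : Sph n) :
    cohCalc n p g x = cohSeries n p (g x) := by
  have h := (cohSeriesCoeff_expType n p).hasFPowerSeriesOnBall C(Sph n, ℂ)
  have h1 := h.hasSum (y := g) (by simp)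
  rw [zero_add] at h1
  have h2 := h1.mapL (ContinuousMap.evalCLM ℂ x)
  rw [cohSeries]
  refine (HasSum.tsum_eq (h2.congr_fun fun l => ?_)).symm
  simp [FormalMultilinearSeries.ofScalars_apply_eq, cohSeriesCoeff]

/-- The function `x ↦ (u ⬝ x) / ħ` on the sphere, which is linear in `u`. -/
def cdotCLM (n : ℕ) (ħ : ℝ) : Cn n →L[ℂ] C(Sph n, ℂ) :=
  LinearMap.toContinuousLinearMap
    { toFun := fun u => ⟨fun x => cdot u x / ħ, by
        simp only [cdot_eq_inner]
        fun_prop⟩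
      map_add' := fun u v => by
        ext x
        simp [cdot_add_left, add_div]
      map_smul' := fun c u => by
        ext x
        simp [cdot_smul_left, mul_div_assoc] }

theorem cdotCLM_apply (n : ℕ) (ħ : ℝ) (u : Cn n) (x : Sph n) :
    cdotCLM n ħ u x = cdot u x / ħ := rfl

/-- The ambient Hilbert space `L²(S)`. -/
abbrev L2Sph (n : ℕ) : Type := Lp ℂ 2 (sphereMeasure n)

/-- The coherent state `K(·, z)` as an element of `L²(S)`. -/
def cohL2 (n : ℕ) (p ħ : ℝ) (z : Cn n) : L2Sph n := (coh n p ħ z : L2Sph n)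

theorem cohSeries_conj (n : ℕ) (p : ℝ) (t : ℂ) :
    (starRingEnd ℂ) (cohSeries n p t) = cohSeries n p ((starRingEnd ℂ) t) := by
  rw [cohSeries, cohSeries, Complex.conj_tsum]
  simp only [map_mul, map_pow, Complex.conj_ofReal]

theorem cohL2_eq (n : ℕ) (p ħ : ℝ) (z : Cn n) :
    cohL2 n p ħ z = ContinuousMap.toLp 2 (sphereMeasure n) ℂ (cohCalc n p (star (cdotCLM n ħ z))) := by
  refine Lp.ext ?_
  filter_upwards [(cohFun_memLp n p ħ z).coeFn_toLp, ContinuousMap.coeFn_toLp (p := 2)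
    (𝕜 := ℂ) (sphereMeasure n) (cohCalc n p (star (cdotCLM n ħ z)))] with x hx hx'
  rw [hx', cohCalc_apply]
  refine hx.trans ?_
  rw [cohFun]
  congr 1
  simp [cdotCLM_apply, cdot_conj]

theorem cohCalc_star (n : ℕ) (p : ℝ) (g : C(Sph n, ℂ)) :
    cohCalc n p (star g) = star (cohCalc n p g) := by
  ext x
  rw [cohCalc_apply, ContinuousMap.star_apply, ContinuousMap.star_apply, cohCalc_apply]
  exact (cohSeries_conj n p _).symm

/-- The functional `h ↦ ∫ g h dσ` on `L²(S)`, for a continuous function `g`. -/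
def pairingCLM (n : ℕ) : C(Sph n, ℂ) →L[ℂ] L2Sph n →L[ℂ] ℂ :=
  (innerSL ℂ : L2Sph n →L⋆[ℂ] L2Sph n →L[ℂ] ℂ).comp
    ((ContinuousMap.toLp 2 (sphereMeasure n) ℂ : C(Sph n, ℂ) →L[ℂ] L2Sph n).comp
      ((starL ℂ : C(Sph n, ℂ) ≃L⋆[ℂ] C(Sph n, ℂ)) : C(Sph n, ℂ) →L⋆[ℂ] C(Sph n, ℂ)))

theorem innerSL_cohL2 (n : ℕ) (p ħ : ℝ) (u : Cn n) :
    innerSL ℂ (cohL2 n p ħ u) = pairingCLM n (cohCalc n p (cdotCLM n ħ u)) := by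
  rw [cohL2_eq, cohCalc_star]
  rfl

/-- The functional `h ↦ ⟪K(·, u), h⟫` is a holomorphic function of `u`. -/
theorem contDiff_innerSL_cohL2 (n : ℕ) (p ħ : ℝ) :
    ContDiff ℂ ⊤ fun u : Cn n => (innerSL ℂ (cohL2 n p ħ u) : L2Sph n →L[ℂ] ℂ) := by
  simp only [innerSL_cohL2]
  exact (pairingCLM n).contDiff.comp ((contDiff_cohCalc n p).comp (cdotCLM n ħ).contDiff)

/-- The holomorphic function `u ↦ ⟪K(·, u), h⟫` attached to `h`. -/
def transform (n : ℕ) (p ħ : ℝ) (h : L2Sph n) (u : Cn n) : ℂ := inner ℂ (cohL2 n p ħ u) h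

theorem contDiff_transform (n : ℕ) (p ħ : ℝ) (h : L2Sph n) :
    ContDiff ℂ ⊤ (transform n p ħ h) :=
  (contDiff_innerSL_cohL2 n p ħ).clm_apply contDiff_const

theorem differentiable_transform (n : ℕ) (p ħ : ℝ) (h : L2Sph n) :
    Differentiable ℂ (transform n p ħ h) :=
  (contDiff_transform n p ħ h).differentiable (by simp)

/-- Along an antiholomorphic complex line, the coherent state is a holomorphic function. -/
theorem contDiff_cohL2_line (n : ℕ) (p ħ : ℝ) (a b : Cn n) :
    ContDiff ℂ ⊤ fun s : ℂ => cohL2 n p ħ (a + (starRingEnd ℂ) s • b) := by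
  have h : ∀ s : ℂ, star (cdotCLM n ħ (a + (starRingEnd ℂ) s • b)) =
      star (cdotCLM n ħ a) + s • star (cdotCLM n ħ b) := by
    intro s
    ext x
    simp
  simp only [cohL2_eq, h]
  refine (ContinuousLinearMap.contDiff _).comp ((contDiff_cohCalc n p).comp ?_)
  fun_prop

theorem inner_cohL2 {n : ℕ} (hn : 0 < n) {p ħ : ℝ} (hp : -(n : ℝ) < p) (hħ : 0 < ħ)
    (w z : Cn n) : inner ℂ (cohL2 n p ħ w) (cohL2 n p ħ z) = kernelT n p ħ w z :=
  inner_coh hn hp hħ w z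

theorem transform_cohL2 {n : ℕ} (hn : 0 < n) {p ħ : ℝ} (hp : -(n : ℝ) < p) (hħ : 0 < ħ)
    (z u : Cn n) : transform n p ħ (cohL2 n p ħ z) u = kernelT n p ħ u z :=
  inner_coh hn hp hħ u z

/-! ### The transform into `L²(m)` -/

/-- The closed linear span of the coherent states. -/
def cohSpan (n : ℕ) (p ħ : ℝ) : Submodule ℂ (L2Sph n) :=
  (Submodule.span ℂ (Set.range (cohL2 n p ħ))).topologicalClosure

theorem cohL2_mem_cohSpan (n : ℕ) (p ħ : ℝ) (z : Cn n) : cohL2 n p ħ z ∈ cohSpan n p ħ :=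
  Submodule.le_topologicalClosure _ (Submodule.subset_span ⟨z, rfl⟩)

theorem transform_add (n : ℕ) (p ħ : ℝ) (g h : L2Sph n) :
    transform n p ħ (g + h) = transform n p ħ g + transform n p ħ h := by
  funext u
  exact inner_add_right _ _ _

theorem transform_sub (n : ℕ) (p ħ : ℝ) (g h : L2Sph n) :
    transform n p ħ (g - h) = transform n p ħ g - transform n p ħ h := by
  funext u
  exact inner_sub_right _ _ _

theorem transform_smul (n : ℕ) (p ħ : ℝ) (c : ℂ) (h : L2Sph n) :
    transform n p ħ (c • h) = c • transform n p ħ h := by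
  funext u
  exact inner_smul_right _ _ _

theorem transform_cohL2' {n : ℕ} (hn : 0 < n) {p ħ : ℝ} (hp : -(n : ℝ) < p) (hħ : 0 < ħ)
    (z : Cn n) : transform n p ħ (cohL2 n p ħ z) = fun u => kernelT n p ħ u z :=
  funext (transform_cohL2 hn hp hħ z)

theorem memLp_kernelT {n : ℕ} (hn : 0 < n) {p ħ : ℝ} (hp : -(n : ℝ) < p) (hħ : 0 < ħ)
    (z : Cn n) : MemLp (fun u => kernelT n p ħ u z) 2 (mMeasure n p ħ) := by
  rw [memLp_two_iff_integrable_sq_norm (continuous_kernelT_left hp ħ z).aestronglyMeasurable]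
  refine (integrable_kernelT hn hp hħ 0 0 0 z z).norm.congr (ae_of_all _ fun u => ?_)
  simp [sq]

theorem memLp_transform_of_mem_span {n : ℕ} (hn : 0 < n) {p ħ : ℝ} (hp : -(n : ℝ) < p)
    (hħ : 0 < ħ) {h : L2Sph n} (hh : h ∈ Submodule.span ℂ (Set.range (cohL2 n p ħ))) :
    MemLp (transform n p ħ h) 2 (mMeasure n p ħ) := by
  induction hh using Submodule.span_induction with
  | mem h hh =>
    obtain ⟨z, rfl⟩ := hh
    rw [transform_cohL2' hn hp hħ]
    exact memLp_kernelT hn hp hħ z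
  | zero =>
    have : transform n p ħ 0 = 0 := by
      funext u
      exact inner_zero_right _
    rw [this]
    exact MemLp.zero
  | add g h _ _ hg hh =>
    rw [transform_add]
    exact hg.add hh
  | smul c h _ hh =>
    rw [transform_smul]
    exact hh.const_smul c

theorem integrable_conj_mul {α : Type*} [MeasurableSpace α] {μ : Measure α} {f g : α → ℂ}
    (hf : MemLp f 2 μ) (hg : MemLp g 2 μ) :
    Integrable (fun x => (starRingEnd ℂ) (f x) * g x) μ :=
  hf.star.integrable_mul hg

theorem integral_transform_of_mem_span {n : ℕ} (hn : 0 < n) {p ħ : ℝ} (hp : -(n : ℝ) < p)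
    (hħ : 0 < ħ) {g h : L2Sph n} (hg : g ∈ Submodule.span ℂ (Set.range (cohL2 n p ħ)))
    (hh : h ∈ Submodule.span ℂ (Set.range (cohL2 n p ħ))) :
    ∫ u, (starRingEnd ℂ) (transform n p ħ g u) * transform n p ħ h u ∂mMeasure n p ħ =
      inner ℂ g h := by
  induction hh using Submodule.span_induction with
  | mem h hh =>
    obtain ⟨w, rfl⟩ := hh
    induction hg using Submodule.span_induction with
    | mem g hg =>
      obtain ⟨z, rfl⟩ := hg
      rw [inner_cohL2 hn hp hħ, ← integral_kernelT_mul_conj hn hp hħ]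
      simp only [transform_cohL2 hn hp hħ, mul_comm]
    | zero => simp [transform]
    | add g g' hg hg' h1 h2 =>
      rw [inner_add_left, ← h1, ← h2, ← integral_add]
      · simp only [transform_add, Pi.add_apply, map_add, add_mul]
      · exact integrable_conj_mul (memLp_transform_of_mem_span hn hp hħ hg)
          (memLp_transform_of_mem_span hn hp hħ (Submodule.subset_span ⟨w, rfl⟩))
      · exact integrable_conj_mul (memLp_transform_of_mem_span hn hp hħ hg')
          (memLp_transform_of_mem_span hn hp hħ (Submodule.subset_span ⟨w, rfl⟩))
    | smul c g hg h1 =>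
      rw [inner_smul_left, ← h1, ← integral_const_mul]
      simp only [transform_smul, Pi.smul_apply, smul_eq_mul, map_mul, mul_assoc]
  | zero => simp [transform]
  | add h h' hh hh' h1 h2 =>
    rw [inner_add_right, ← h1, ← h2, ← integral_add]
    · simp only [transform_add, Pi.add_apply, mul_add]
    · exact integrable_conj_mul (memLp_transform_of_mem_span hn hp hħ hg)
        (memLp_transform_of_mem_span hn hp hħ hh)
    · exact integrable_conj_mul (memLp_transform_of_mem_span hn hp hħ hg)
        (memLp_transform_of_mem_span hn hp hħ hh')
  | smul c h hh h1 =>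
    rw [inner_smul_right, ← h1, ← integral_const_mul]
    simp only [transform_smul, Pi.smul_apply, smul_eq_mul]
    refine integral_congr_ae (ae_of_all _ fun u => ?_)
    ring

theorem lintegral_transform_of_mem_span {n : ℕ} (hn : 0 < n) {p ħ : ℝ} (hp : -(n : ℝ) < p)
    (hħ : 0 < ħ) {h : L2Sph n} (hh : h ∈ Submodule.span ℂ (Set.range (cohL2 n p ħ))) :
    ∫⁻ u, ENNReal.ofReal (‖transform n p ħ h u‖ ^ 2) ∂mMeasure n p ħ =
      ENNReal.ofReal (‖h‖ ^ 2) := by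
  have h1 := integral_transform_of_mem_span hn hp hħ hh hh
  have h2 : ∀ u, (starRingEnd ℂ) (transform n p ħ h u) * transform n p ħ h u =
      ((‖transform n p ħ h u‖ ^ 2 : ℝ) : ℂ) := fun u => by
    rw [Complex.conj_mul']
    push_cast
    rfl
  simp only [h2] at h1
  rw [integral_complex_ofReal, inner_self_eq_norm_sq_to_K] at h1
  have h3 : ∫ u, ‖transform n p ħ h u‖ ^ 2 ∂mMeasure n p ħ = ‖h‖ ^ 2 := by
    refine Complex.ofReal_injective (h1.trans ?_)
    simp
  rw [← h3, ofReal_integral_eq_lintegral_ofReal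
    ((memLp_two_iff_integrable_sq_norm (memLp_transform_of_mem_span hn hp hħ hh).1).1
      (memLp_transform_of_mem_span hn hp hħ hh)) (ae_of_all _ fun u => by positivity)]

/-- The transform is contractive on the closed span of the coherent states, by Fatou's lemma. -/
theorem lintegral_transform_le {n : ℕ} (hn : 0 < n) {p ħ : ℝ} (hp : -(n : ℝ) < p)
    (hħ : 0 < ħ) {h : L2Sph n} (hh : h ∈ cohSpan n p ħ) :
    ∫⁻ u, ENNReal.ofReal (‖transform n p ħ h u‖ ^ 2) ∂mMeasure n p ħ ≤
      ENNReal.ofReal (‖h‖ ^ 2) := by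
  obtain ⟨g, hg, hlim⟩ := mem_closure_iff_seq_limit.1 hh
  have h1 : ∀ u, Tendsto (fun k => ENNReal.ofReal (‖transform n p ħ (g k) u‖ ^ 2)) atTop
      (𝓝 (ENNReal.ofReal (‖transform n p ħ h u‖ ^ 2))) := fun u =>
    ENNReal.tendsto_ofReal ((((innerSL ℂ (cohL2 n p ħ u)).continuous.tendsto h).comp hlim).norm.pow 2)
  have h2 : Tendsto (fun k => ENNReal.ofReal (‖g k‖ ^ 2)) atTop (𝓝 (ENNReal.ofReal (‖h‖ ^ 2))) :=
    ENNReal.tendsto_ofReal (hlim.norm.pow 2)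
  calc _ = ∫⁻ u, liminf (fun k => ENNReal.ofReal (‖transform n p ħ (g k) u‖ ^ 2)) atTop
        ∂mMeasure n p ħ := lintegral_congr fun u => (h1 u).liminf_eq.symm
    _ ≤ liminf (fun k => ∫⁻ u, ENNReal.ofReal (‖transform n p ħ (g k) u‖ ^ 2) ∂mMeasure n p ħ)
        atTop := lintegral_liminf_le fun k => by
          have := (differentiable_transform n p ħ (g k)).continuous
          exact (ENNReal.continuous_ofReal.comp (this.norm.pow 2)).measurable
    _ = liminf (fun k => ENNReal.ofReal (‖g k‖ ^ 2)) atTop := by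
      congr 1
      funext k
      exact lintegral_transform_of_mem_span hn hp hħ (hg k)
    _ = _ := h2.liminf_eq

theorem memLp_transform_of_mem_cohSpan {n : ℕ} (hn : 0 < n) {p ħ : ℝ} (hp : -(n : ℝ) < p)
    (hħ : 0 < ħ) {h : L2Sph n} (hh : h ∈ cohSpan n p ħ) :
    MemLp (transform n p ħ h) 2 (mMeasure n p ħ) := by
  have hc := (differentiable_transform n p ħ h).continuous
  rw [memLp_two_iff_integrable_sq_norm hc.aestronglyMeasurable]
  refine ⟨Continuous.aestronglyMeasurable (by fun_prop), ?_⟩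
  rw [hasFiniteIntegral_iff_ofReal (ae_of_all _ fun u => by positivity)]
  exact (lintegral_transform_le hn hp hħ hh).trans_lt ENNReal.ofReal_lt_top

/-- The transform as a contraction of the closed span of the coherent states into `L²(m)`. -/
def transformCLM {n : ℕ} (hn : 0 < n) {p ħ : ℝ} (hp : -(n : ℝ) < p) (hħ : 0 < ħ) :
    cohSpan n p ħ →L[ℂ] Lp ℂ 2 (mMeasure n p ħ) :=
  LinearMap.mkContinuous
    { toFun := fun h => (memLp_transform_of_mem_cohSpan hn hp hħ h.2).toLp _
      map_add' := fun g h => by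
        rw [← MemLp.toLp_add]
        exact MemLp.toLp_congr _ _ (by rw [Submodule.coe_add, transform_add])
      map_smul' := fun c h => by
        rw [RingHom.id_apply, ← MemLp.toLp_const_smul]
        exact MemLp.toLp_congr _ _ (by rw [Submodule.coe_smul, transform_smul]) } 1 fun h => by
    rw [one_mul, LinearMap.coe_mk, AddHom.coe_mk, Lp.norm_toLp]
    have h1 := lintegral_transform_le hn hp hħ h.2
    rw [eLpNorm_eq_lintegral_rpow_enorm_toReal two_ne_zero ENNReal.ofNat_ne_top]
    have h2 : ∀ u, ‖transform n p ħ h u‖ₑ ^ (2 : ENNReal).toReal =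
        ENNReal.ofReal (‖transform n p ħ h u‖ ^ 2) := fun u => by
      rw [ENNReal.toReal_ofNat, ← ofReal_norm, ENNReal.ofReal_rpow_of_nonneg
        (norm_nonneg _) (by norm_num)]
      norm_num
    simp only [h2]
    refine ENNReal.toReal_le_of_le_ofReal (norm_nonneg _) ?_
    refine (ENNReal.rpow_le_rpow h1 (by positivity)).trans (le_of_eq ?_)
    rw [ENNReal.ofReal_rpow_of_nonneg (by positivity) (by positivity), ENNReal.toReal_ofNat,
      ← Real.sqrt_eq_rpow, Real.sqrt_sq (norm_nonneg _)]
    rfl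

theorem transformCLM_coeFn {n : ℕ} (hn : 0 < n) {p ħ : ℝ} (hp : -(n : ℝ) < p) (hħ : 0 < ħ)
    (h : cohSpan n p ħ) : transformCLM hn hp hħ h =ᵐ[mMeasure n p ħ] transform n p ħ h :=
  (memLp_transform_of_mem_cohSpan hn hp hħ h.2).coeFn_toLp

theorem inner_transformCLM {n : ℕ} (hn : 0 < n) {p ħ : ℝ} (hp : -(n : ℝ) < p) (hħ : 0 < ħ)
    (g h : cohSpan n p ħ) : inner ℂ (transformCLM hn hp hħ g) (transformCLM hn hp hħ h) =
      ∫ u, (starRingEnd ℂ) (transform n p ħ g u) * transform n p ħ h u ∂mMeasure n p ħ := by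
  rw [L2.inner_def]
  refine integral_congr_ae ?_
  filter_upwards [transformCLM_coeFn hn hp hħ g, transformCLM_coeFn hn hp hħ h] with u hg hh
  rw [hg, hh, RCLike.inner_apply']

/-- The transform preserves inner products on the closed span of the coherent states. -/
theorem integral_transform {n : ℕ} (hn : 0 < n) {p ħ : ℝ} (hp : -(n : ℝ) < p)
    (hħ : 0 < ħ) {g h : L2Sph n} (hg : g ∈ cohSpan n p ħ) (hh : h ∈ cohSpan n p ħ) :
    ∫ u, (starRingEnd ℂ) (transform n p ħ g u) * transform n p ħ h u ∂mMeasure n p ħ =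
      inner ℂ g h := by
  have hcont := (transformCLM hn hp hħ).continuous
  set D : Set (cohSpan n p ħ) :=
    {g | (g : L2Sph n) ∈ Submodule.span ℂ (Set.range (cohL2 n p ħ))} with hD
  have hdense : Dense D := by
    intro g
    rw [closure_subtype]
    refine closure_mono ?_ g.2
    exact fun x hx => ⟨⟨x, Submodule.le_topologicalClosure _ hx⟩, hx, rfl⟩
  have key : ∀ q : (cohSpan n p ħ) × (cohSpan n p ħ),
      inner ℂ (transformCLM hn hp hħ q.1) (transformCLM hn hp hħ q.2) =
        (inner ℂ (q.1 : L2Sph n) (q.2 : L2Sph n) : ℂ) := by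
    intro q
    refine (hdense.prod hdense).induction (P := fun q : (cohSpan n p ħ) × (cohSpan n p ħ) =>
      inner ℂ (transformCLM hn hp hħ q.1) (transformCLM hn hp hħ q.2) =
        (inner ℂ (q.1 : L2Sph n) (q.2 : L2Sph n) : ℂ)) ?_ ?_ q
    · rintro q ⟨h1, h2⟩
      rw [inner_transformCLM]
      exact integral_transform_of_mem_span hn hp hħ h1 h2
    · exact isClosed_eq (by fun_prop) (by fun_prop)
  rw [← inner_transformCLM hn hp hħ ⟨g, hg⟩ ⟨h, hh⟩]
  exact key (⟨g, hg⟩, ⟨h, hh⟩)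

/-! ### Completeness of the coherent states -/

theorem pairingCLM_apply {n : ℕ} (g : C(Sph n, ℂ)) (v : L2Sph n) :
    pairingCLM n g v = ∫ x, g x * v x ∂sphereMeasure n := by
  change inner ℂ (ContinuousMap.toLp 2 (sphereMeasure n) ℂ (star g)) v = _
  rw [L2.inner_def]
  refine integral_congr_ae ?_
  filter_upwards [ContinuousMap.coeFn_toLp (p := 2) (𝕜 := ℂ) (sphereMeasure n) (star g)] with x hx
  rw [hx, RCLike.inner_apply']
  simp

/-- A function orthogonal to all coherent states is orthogonal to their homogeneous components. -/
theorem integral_cdot_pow_eq_zero {n : ℕ} (hn : 0 < n) {p ħ : ℝ} (hp : -(n : ℝ) < p)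
    (hħ : 0 < ħ) {v : L2Sph n} (hv : transform n p ħ v = 0) (y : Cn n) (l : ℕ) :
    ∫ x : Sph n, cdot y x ^ l * v x ∂sphereMeasure n = 0 := by
  set d : ℕ → ℂ := fun k => cohSeriesCoeff n p k * pairingCLM n (cdotCLM n ħ y ^ k) v with hd
  have h1 : ∀ t : ℂ, HasSum (fun k => t ^ k • d k) 0 := by
    intro t
    have h := (cohSeriesCoeff_expType n p).hasFPowerSeriesOnBall C(Sph n, ℂ)
    have h1 := h.hasSum (y := cdotCLM n ħ (t • y)) (by simp)
    rw [zero_add] at h1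
    have h2 := (h1.mapL (pairingCLM n)).mapL (ContinuousLinearMap.apply ℂ ℂ v)
    have h3 : (ContinuousLinearMap.apply ℂ ℂ v) (pairingCLM n (FormalMultilinearSeries.ofScalarsSum
        (cohSeriesCoeff n p) (cdotCLM n ħ (t • y)))) = 0 := by
      have h4 := congrFun hv (t • y)
      have h5 : transform n p ħ v (t • y) = innerSL ℂ (cohL2 n p ħ (t • y)) v := rfl
      rw [h5, innerSL_cohL2] at h4
      exact h4
    rw [h3] at h2
    refine h2.congr_fun fun k => ?_
    simp only [hd, FormalMultilinearSeries.ofScalars_apply_eq, map_smul, smul_pow, smul_eq_mul,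
      ContinuousLinearMap.apply_apply]
    ring
  have h2 : HasFPowerSeriesAt (0 : ℂ → ℂ) (FormalMultilinearSeries.ofScalars ℂ d) 0 := by
    rw [hasFPowerSeriesAt_iff]
    refine Eventually.of_forall fun t => ?_
    simp only [FormalMultilinearSeries.coeff_ofScalars]
    exact h1 t
  have h3 : d l = 0 := by
    rw [← FormalMultilinearSeries.coeff_ofScalars (p := d), h2.eq_zero]
    rfl
  have h4 : cohSeriesCoeff n p l ≠ 0 := by
    rw [cohSeriesCoeff]
    exact_mod_cast (div_pos (cohCoeff_pos hn hp l) (by positivity)).ne'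
  have h5 := (mul_eq_zero.1 h3).resolve_left h4
  rw [pairingCLM_apply] at h5
  have h6 : ∀ x : Sph n, (cdotCLM n ħ y ^ l) x * v x = ((ħ : ℂ) ^ l)⁻¹ * (cdot y x ^ l * v x) := by
    intro x
    rw [ContinuousMap.pow_apply, cdotCLM_apply, div_pow]
    ring
  simp only [h6] at h5
  rw [integral_const_mul] at h5
  refine (mul_eq_zero.1 h5).resolve_left ?_
  have : (ħ : ℂ) ≠ 0 := by exact_mod_cast hħ.ne'
  positivity

/-- The dilate `u ↦ G (r u)` of a function on the unit ball, continued radially constantly outside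
of the unit ball. -/
def dilate {n : ℕ} (G : Cn n → ℂ) (r : ℝ) (u : Cn n) : ℂ := G ((r / max 1 ‖u‖) • u)

theorem norm_dilate_arg_le {n : ℕ} {r : ℝ} (hr : 0 < r) (u : Cn n) :
    ‖(r / max 1 ‖u‖) • u‖ ≤ r := by
  have h : 0 < max 1 ‖u‖ := lt_of_lt_of_le one_pos (le_max_left _ _)
  rw [norm_smul, Real.norm_of_nonneg (by positivity), div_mul_eq_mul_div, div_le_iff₀ h]
  exact mul_le_mul_of_nonneg_left (le_max_right _ _) hr.le

theorem dilate_eq {n : ℕ} (G : Cn n → ℂ) (r : ℝ) {u : Cn n} (hu : ‖u‖ ≤ 1) :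
    dilate G r u = G (r • u) := by
  rw [dilate, max_eq_left hu, div_one]

theorem continuous_dilate {n : ℕ} {G : Cn n → ℂ} (hG : DifferentiableOn ℂ G (Metric.ball 0 1))
    {r : ℝ} (hr : 0 < r) (hr1 : r < 1) : Continuous (dilate G r) := by
  refine hG.continuousOn.comp_continuous ?_ fun u => ?_
  · refine Continuous.smul (Continuous.div continuous_const
      (continuous_const.max continuous_norm) fun u => ?_) continuous_id
    exact (lt_of_lt_of_le one_pos (le_max_left _ _)).ne'
  · rw [mem_ball_zero_iff]
    exact (norm_dilate_arg_le hr u).trans_lt hr1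

theorem exists_norm_dilate_le {n : ℕ} {G : Cn n → ℂ}
    (hG : DifferentiableOn ℂ G (Metric.ball 0 1)) {r : ℝ} (hr : 0 < r) (hr1 : r < 1) :
    ∃ C, 0 ≤ C ∧ ∀ u, ‖dilate G r u‖ ≤ C := by
  obtain ⟨C, hC⟩ := (isCompact_closedBall (0 : Cn n) r).exists_bound_of_continuousOn
    (hG.continuousOn.mono (Metric.closedBall_subset_ball hr1))
  have h : ∀ u, ‖dilate G r u‖ ≤ C := fun u => hC _ (mem_closedBall_zero_iff.2
    (norm_dilate_arg_le hr u))
  exact ⟨C, (norm_nonneg _).trans (h 0), h⟩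

theorem norm_slice_le {n : ℕ} {e u : Cn n} (he : ‖e‖ = 1) {c : ℂ} (hc : ‖c‖ ≤ 1) :
    ‖c • u + (1 - c) • (cdot u e • e)‖ ≤ ‖u‖ := by
  set w := u - cdot u e • e with hw
  have horth : inner ℂ w (cdot u e • e) = 0 := by
    have h : inner ℂ e e = (1 : ℂ) := by rw [inner_self_eq_norm_sq_to_K, he]; simp
    rw [hw, inner_smul_right, inner_sub_left, inner_smul_left, h, mul_one, cdot_eq_inner,
      inner_conj_symm, sub_self, mul_zero]
  have h1 : c • u + (1 - c) • (cdot u e • e) = c • w + cdot u e • e := by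
    rw [hw]
    module
  have h2 : u = w + cdot u e • e := by simp [hw]
  rw [h1]
  conv_rhs => rw [h2]
  refine le_of_sq_le_sq ?_ (norm_nonneg _)
  rw [sq, sq, norm_add_sq_eq_norm_sq_add_norm_sq_of_inner_eq_zero _ _ horth,
    norm_add_sq_eq_norm_sq_add_norm_sq_of_inner_eq_zero _ _ (by
      rw [inner_smul_left, horth, mul_zero]), norm_smul]
  have : ‖c‖ * ‖w‖ ≤ ‖w‖ := mul_le_of_le_one_left (norm_nonneg _) hc
  have := mul_self_le_mul_self (by positivity) this
  linarith

/-- The homogeneous components of a holomorphic function, recovered from its values on a sphere. -/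
theorem hasSum_slice {n : ℕ} (hn : 0 < n) {G : Cn n → ℂ}
    (hG : DifferentiableOn ℂ G (Metric.ball 0 1)) {r : ℝ} (hr : 0 < r) (hr1 : r < 1) {ρ : ℝ}
    (hρ : 0 ≤ ρ) (hρ1 : ρ < 1) {x : Cn n} (hx : ‖x‖ = 1) :
    HasSum (fun l : ℕ => ((ρ ^ l * (poch n l / l.factorial) : ℝ) : ℂ) *
      ∫ y, dilate G r y * (starRingEnd ℂ) (cdot y x) ^ l ∂sphereMeasure' n)
      (G ((ρ * r) • x)) := by
  have hprob := isProbabilityMeasure_sphereMeasure hn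
  have hfin : IsFiniteMeasure (sphereMeasure' n) := by
    unfold sphereMeasure'; infer_instance
  obtain ⟨C, hC0, hC⟩ := exists_norm_dilate_le hG hr hr1
  have hGc := continuous_dilate hG hr hr1
  have hcx := continuous_cdot_left x
  set g : ℂ → ℂ := fun t => G (t • (r • x)) with hg
  have hrx : ‖r • x‖ = r := by rw [norm_smul, hx, mul_one, Real.norm_of_nonneg hr.le]
  -- the slice `g` is holomorphic on a disc of radius greater than one
  obtain ⟨R, hR⟩ : ∃ R : NNReal, (R : ℝ) = (1 + r⁻¹) / 2 := ⟨⟨(1 + r⁻¹) / 2, by positivity⟩, rfl⟩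
  have hr' : 1 < r⁻¹ := (one_lt_inv₀ hr).2 hr1
  have hR1 : (1 : ℝ) < R := by
    rw [hR]
    linarith
  have hR2 : (R : ℝ) * r < 1 := by
    rw [hR, div_mul_eq_mul_div, add_mul, inv_mul_cancel₀ hr.ne']
    linarith
  have hmem : ∀ t : ℂ, ‖t‖ ≤ R → t • (r • x) ∈ Metric.ball (0 : Cn n) 1 := fun t ht => by
    rw [mem_ball_zero_iff, norm_smul, hrx]
    exact (mul_le_mul_of_nonneg_right ht hr.le).trans_lt hR2
  have hgd : DifferentiableOn ℂ g (Metric.closedBall 0 R) :=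
    hG.comp (by fun_prop) fun t ht => hmem t (mem_closedBall_zero_iff.1 ht)
  have hps := hgd.hasFPowerSeriesOnBall (by exact_mod_cast one_pos.trans hR1)
  set P := cauchyPowerSeries g 0 R
  have hsum : ∀ t : ℂ, ‖t‖ ≤ 1 → HasSum (fun k => t ^ k * P.coeff k) (g t) := by
    intro t ht
    have := hps.hasSum (y := t) (by
      rw [Metric.mem_eball, edist_zero_right, ← ofReal_norm, ENNReal.ofReal_lt_coe_iff (norm_nonneg _)]
      exact ht.trans_lt hR1)
    simpa [FormalMultilinearSeries.apply_eq_pow_smul_coeff] using this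
  have hsummable : Summable fun k => ‖P.coeff k‖ := by
    have := P.summable_norm_mul_pow (r := 1) (lt_of_lt_of_le (by exact_mod_cast hR1) hps.r_le)
    simpa [FormalMultilinearSeries.norm_apply_eq_norm_coef] using this
  have hae : ∀ᵐ y ∂sphereMeasure' n, ‖cdot y x‖ ≤ 1 := by
    filter_upwards [ae_sphereMeasure' n] with y hy
    exact (norm_cdot_le y x).trans (by rw [hy, hx, one_mul])
  -- averaging reduces the integral to the slice, where the powers `(y ⬝ x) ^ k` are orthogonal
  have hmom : ∀ l : ℕ, ∫ y, dilate G r y * (starRingEnd ℂ) (cdot y x) ^ l ∂sphereMeasure' n =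
      P.coeff l * ((l.factorial / poch n l : ℝ) : ℂ) := by
    intro l
    rw [(unitaryInvariant_sphereMeasure' hn).integral_slice hx hGc
      (φ := fun t => (starRingEnd ℂ) t ^ l) (by fun_prop) ?_ (B := fun _ => C)
      (integrable_const _) ?_]
    · have h1 := hasSum_integral_of_dominated_convergence (μ := sphereMeasure' n)
        (F := fun k y => P.coeff k * (cdot y x ^ k * (starRingEnd ℂ) (cdot y x) ^ l))
        (f := fun y => dilate G r (cdot y x • x) * (starRingEnd ℂ) (cdot y x) ^ l)
        (fun k _ => ‖P.coeff k‖) (fun k => Continuous.aestronglyMeasurable (by fun_prop))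
        (fun k => by
          filter_upwards [hae] with y hy
          rw [norm_mul, norm_mul, norm_pow, norm_pow, RCLike.norm_conj]
          exact mul_le_of_le_one_right (norm_nonneg _)
            (mul_le_one₀ (pow_le_one₀ (norm_nonneg _) hy) (by positivity)
              (pow_le_one₀ (norm_nonneg _) hy)))
        (ae_of_all _ fun _ => hsummable) (integrable_const _) (by
          filter_upwards [hae] with y hy
          rw [dilate_eq G r (by rw [norm_smul, hx, mul_one]; exact hy)]
          have h := (hsum _ hy).mul_right ((starRingEnd ℂ) (cdot y x) ^ l)
          simp only [hg, smul_comm _ r x] at h ⊢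
          exact h.congr_fun fun k => by ring)
      refine h1.unique ?_
      have h2 : ∀ k, ∫ y, P.coeff k * (cdot y x ^ k * (starRingEnd ℂ) (cdot y x) ^ l)
          ∂sphereMeasure' n = if k = l then P.coeff l * ((l.factorial / poch n l : ℝ) : ℂ)
            else 0 := by
        intro k
        rw [integral_const_mul]
        split_ifs with hkl
        · subst hkl
          rw [(unitaryInvariant_sphereMeasure' hn).integral_cdot_self hn hx,
            coordMoment_sphereMeasure' hn]
        · rw [(unitaryInvariant_sphereMeasure' hn).integral_cdot_of_ne x hkl, mul_zero]
      simp only [h2]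
      exact hasSum_ite_eq l _
    · filter_upwards [ae_sphereMeasure' n] with y hy
      have hmem' : ∀ c : ℂ, ‖c‖ ≤ 1 → r • (c • y + (1 - c) • (cdot y x • x)) ∈
          Metric.ball (0 : Cn n) 1 := fun c hc => by
        rw [mem_ball_zero_iff, norm_smul, Real.norm_of_nonneg hr.le]
        have := norm_slice_le (u := y) hx hc
        rw [hy] at this
        nlinarith
      have hdiff : ∀ c : ℂ, ‖c‖ ≤ 1 → DifferentiableAt ℂ
          (fun c : ℂ => G (r • (c • y + (1 - c) • (cdot y x • x)))) c := fun c hc => by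
        refine (hG.differentiableAt (Metric.isOpen_ball.mem_nhds (hmem' c hc))).comp c ?_
        fun_prop
      have heq : Set.EqOn (fun c : ℂ => dilate G r (c • y + (1 - c) • (cdot y x • x)))
          (fun c : ℂ => G (r • (c • y + (1 - c) • (cdot y x • x)))) (Metric.closedBall 0 1) := by
        intro c hc
        exact dilate_eq G r ((norm_slice_le hx (mem_closedBall_zero_iff.1 hc)).trans hy.le)
      rw [abs_one]
      refine DifferentiableOn.diffContOnCl ?_
      rw [closure_ball _ one_ne_zero]
      refine DifferentiableOn.congr (fun c hc => ?_) heq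
      exact (hdiff c (mem_closedBall_zero_iff.1 hc)).differentiableWithinAt
    · filter_upwards [hae] with y hy c hc
      rw [norm_mul, norm_pow, RCLike.norm_conj]
      exact (mul_le_of_le_one_right (norm_nonneg _) (pow_le_one₀ (norm_nonneg _) hy)).trans (hC _)
  have hfinal := hsum ρ (by
    rw [Complex.norm_real, Real.norm_of_nonneg hρ]
    exact hρ1.le)
  have hval : g ρ = G ((ρ * r) • x) := by
    simp only [hg]
    rw [Complex.coe_smul, smul_smul]
  rw [hval] at hfinal
  refine hfinal.congr_fun fun l => ?_
  rw [hmom]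
  have h1 := (poch_pos (b := (n : ℝ)) (by exact_mod_cast hn) l).ne'
  have h2 : (poch n l / l.factorial) * (l.factorial / poch n l) = 1 := by field_simp
  have h3 : ((poch n l / l.factorial : ℝ) : ℂ) * ((l.factorial / poch n l : ℝ) : ℂ) = 1 := by
    exact_mod_cast h2
  rw [Complex.ofReal_mul]
  push_cast at h3 ⊢
  linear_combination ((ρ : ℂ) ^ l * P.coeff l) * h3

theorem summable_pow_mul_poch {n : ℕ} (hn : 0 < n) {ρ : ℝ} (hρ : 0 < ρ) (hρ1 : ρ < 1) :
    Summable fun l : ℕ => ρ ^ l * (poch n l / l.factorial) := by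
  have hn' : (0 : ℝ) < n := by exact_mod_cast hn
  have hpos : ∀ l : ℕ, 0 < ρ ^ l * (poch n l / l.factorial) := fun l => by
    have := poch_pos hn' l
    positivity
  refine summable_of_ratio_test_tendsto_lt_one hρ1 (Eventually.of_forall fun l => (hpos l).ne') ?_
  have h1 : Tendsto (fun l : ℕ => ρ * (1 + ((n : ℝ) - 1) / ((l : ℝ) + 1))) atTop (𝓝 (ρ * (1 + 0))) :=
    (tendsto_const_nhds.add (tendsto_const_nhds.div_atTop
      (tendsto_atTop_add_const_right _ _ tendsto_natCast_atTop_atTop))).const_mul _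
  rw [add_zero, mul_one] at h1
  refine h1.congr fun l => ?_
  rw [Real.norm_of_nonneg (hpos _).le, Real.norm_of_nonneg (hpos _).le, poch_succ,
    Nat.factorial_succ]
  have := (poch_pos hn' l).ne'
  push_cast
  field_simp
  ring

/-- A function orthogonal to all coherent states is orthogonal to the dilates of holomorphic
functions. -/
theorem integral_conj_holomorphic_eq_zero {n : ℕ} (hn : 0 < n) {p ħ : ℝ} (hp : -(n : ℝ) < p)
    (hħ : 0 < ħ) {v : L2Sph n} (hv : transform n p ħ v = 0) {G : Cn n → ℂ}
    (hG : DifferentiableOn ℂ G (Metric.ball 0 1)) {s : ℝ} (hs : 0 < s) (hs1 : s < 1) :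
    ∫ x : Sph n, (starRingEnd ℂ) (G (s • (x : Cn n))) * v x ∂sphereMeasure n = 0 := by
  have hprob := isProbabilityMeasure_sphereMeasure hn
  have hfin : IsFiniteMeasure (sphereMeasure' n) := by
    unfold sphereMeasure'; infer_instance
  -- `s = √s * √s`: one factor for the dilate, the other one for the convergence of the series
  have hr : 0 < √s := Real.sqrt_pos.2 hs
  have hr1 : √s < 1 := by
    rw [Real.sqrt_lt' one_pos]
    simpa using hs1
  obtain ⟨C, hC0, hC⟩ := exists_norm_dilate_le hG hr hr1
  have hGc := continuous_dilate hG hr hr1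
  have hvi : Integrable v (sphereMeasure n) := (Lp.memLp v).integrable one_le_two
  have hcd : Continuous fun q : Sph n × Cn n => cdot q.2 (q.1 : Cn n) := by
    simp only [cdot_eq_inner]
    fun_prop
  set A : ℕ → Sph n → ℂ := fun l x =>
    ∫ y, dilate G √s y * (starRingEnd ℂ) (cdot y (x : Cn n)) ^ l ∂sphereMeasure' n with hA
  have hae : ∀ (x : Sph n), ∀ᵐ y ∂sphereMeasure' n, ‖cdot y (x : Cn n)‖ ≤ 1 := fun x => by
    filter_upwards [ae_sphereMeasure' n] with y hy
    have hx : ‖(x : Cn n)‖ = 1 := by simp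
    exact (norm_cdot_le y x).trans (by rw [hy, hx, one_mul])
  have hAle : ∀ l x, ‖A l x‖ ≤ C * (sphereMeasure' n).real Set.univ := fun l x => by
    refine norm_integral_le_of_norm_le_const ?_
    filter_upwards [hae x] with y hy
    rw [norm_mul, norm_pow, RCLike.norm_conj]
    exact (mul_le_of_le_one_right (norm_nonneg _) (pow_le_one₀ (norm_nonneg _) hy)).trans (hC _)
  have hAm : ∀ l, AEStronglyMeasurable (A l) (sphereMeasure n) := fun l => by
    have : StronglyMeasurable (Function.uncurry fun (x : Sph n) (y : Cn n) =>
        dilate G √s y * (starRingEnd ℂ) (cdot y (x : Cn n)) ^ l) := by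
      refine Continuous.stronglyMeasurable ?_
      exact (hGc.comp continuous_snd).mul ((Complex.continuous_conj.comp hcd).pow l)
    exact this.integral_prod_right.aestronglyMeasurable
  -- by Fubini, the homogeneous components of `G` are superpositions of the functions `(x ⬝ y) ^ l`
  have hzero : ∀ l, ∫ x, (starRingEnd ℂ) (A l x) * v x ∂sphereMeasure n = 0 := by
    intro l
    have h1 : ∀ x : Sph n, (starRingEnd ℂ) (A l x) * v x = ∫ y,
        (starRingEnd ℂ) (dilate G √s y) * (cdot y (x : Cn n) ^ l * v x) ∂sphereMeasure' n := by
      intro x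
      simp only [hA]
      rw [← integral_conj, ← integral_mul_const]
      refine integral_congr_ae (ae_of_all _ fun y => ?_)
      simp only [map_mul, map_pow, Complex.conj_conj]
      ring
    simp only [h1]
    rw [integral_integral_swap]
    · have h2 : ∀ y, ∫ x : Sph n, (starRingEnd ℂ) (dilate G √s y) * (cdot y (x : Cn n) ^ l * v x)
          ∂sphereMeasure n = 0 := fun y => by
        rw [integral_const_mul, integral_cdot_pow_eq_zero hn hp hħ hv, mul_zero]
      simp only [h2, integral_zero]
    · refine ((hvi.norm.comp_fst (sphereMeasure' n)).const_mul C).mono' ?_ ?_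
      · refine AEStronglyMeasurable.mul (Continuous.aestronglyMeasurable ?_)
          (AEStronglyMeasurable.mul (Continuous.aestronglyMeasurable ?_)
            (hvi.aestronglyMeasurable.comp_fst))
        · exact Complex.continuous_conj.comp (hGc.comp continuous_snd)
        · exact hcd.pow l
      · filter_upwards [Measure.quasiMeasurePreserving_snd.ae (ae_sphereMeasure' n)] with q hq
        have hx : ‖(q.1 : Cn n)‖ = 1 := by simp
        have h3 : ‖cdot q.2 (q.1 : Cn n)‖ ≤ 1 :=
          (norm_cdot_le _ _).trans (by rw [hq, hx, one_mul])
        simp only [Function.uncurry]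
        rw [norm_mul, norm_mul, RCLike.norm_conj, norm_pow]
        exact mul_le_mul (hC _) (mul_le_of_le_one_left (norm_nonneg _)
          (pow_le_one₀ (norm_nonneg _) h3)) (by positivity) hC0
  have hsum := hasSum_integral_of_dominated_convergence (μ := sphereMeasure n)
    (F := fun l x => ((√s ^ l * (poch n l / l.factorial) : ℝ) : ℂ) *
      ((starRingEnd ℂ) (A l x) * v x))
    (f := fun x : Sph n => (starRingEnd ℂ) (G (s • (x : Cn n))) * v x)
    (fun l x => √s ^ l * (poch n l / l.factorial) * (C * (sphereMeasure' n).real Set.univ * ‖v x‖))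
    (fun l => ((Complex.continuous_conj.comp_aestronglyMeasurable (hAm l)).mul
      hvi.aestronglyMeasurable).const_mul _)
    (fun l => ae_of_all _ fun x => by
      have h0 : 0 ≤ √s ^ l * (poch n l / l.factorial) := by
        have := poch_pos (b := (n : ℝ)) (by exact_mod_cast hn) l
        positivity
      rw [norm_mul, norm_mul, RCLike.norm_conj, Complex.norm_real, Real.norm_of_nonneg h0]
      exact mul_le_mul_of_nonneg_left (mul_le_mul_of_nonneg_right (hAle l x) (norm_nonneg _)) h0)
    (ae_of_all _ fun x => (summable_pow_mul_poch hn hr hr1).mul_right _)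
    (by
      simp only [tsum_mul_right]
      exact (hvi.norm.const_mul _).const_mul _)
    (ae_of_all _ fun x => by
      have h1 := hasSum_slice hn hG hr hr1 hr.le hr1 (x := (x : Cn n)) (by simp)
      rw [Real.mul_self_sqrt hs.le] at h1
      refine ((h1.map (starRingEnd ℂ) Complex.continuous_conj).mul_right (v x)).congr_fun
        fun l => ?_
      simp only [Function.comp_apply, map_mul, Complex.conj_ofReal, hA]
      ring)
  refine hsum.unique ?_
  simp only [integral_const_mul, hzero, mul_zero]
  exact hasSum_zero

/-- The Hilbert space `𝒪` is contained in the closed span of the coherent states. -/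
theorem holSpace_le_cohSpan {n : ℕ} (hn : 0 < n) {p ħ : ℝ} (hp : -(n : ℝ) < p) (hħ : 0 < ħ) :
    HolSpace n ≤ cohSpan n p ħ := by
  rintro f ⟨F, hF, hlim⟩
  have hclosed : IsClosed (cohSpan n p ħ : Set (L2Sph n)) :=
    Submodule.isClosed_topologicalClosure _
  have hcomplete : CompleteSpace (cohSpan n p ħ) := hclosed.completeSpace_coe
  rw [← Submodule.orthogonal_orthogonal (cohSpan n p ħ), Submodule.mem_orthogonal']
  intro v hv
  have hv' : transform n p ħ v = 0 := by
    funext u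
    exact (Submodule.mem_orthogonal _ _).1 hv _ (cohL2_mem_cohSpan n p ħ u)
  have hbound : ∀ r : ℝ, 0 < r → r < 1 → ENNReal.ofReal ‖(inner ℂ f v : ℂ)‖ ≤
      eLpNorm (fun x : Sph n => F (r • (x : Cn n)) - f x) 2 (sphereMeasure n) *
        ENNReal.ofReal ‖v‖ := by
    intro r h0 h1
    have hmem : MemLp (fun x : Sph n => F (r • (x : Cn n))) 2 (sphereMeasure n) := by
      have hc : Continuous (fun x : Sph n => F (r • (x : Cn n))) := by
        refine hF.continuousOn.comp_continuous (by fun_prop) fun x => ?_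
        have hx : ‖(x : Cn n)‖ = 1 := by simp
        simp [norm_smul, hx, abs_of_pos h0, h1]
      obtain ⟨C, hC⟩ := (isCompact_univ (X := Sph n)).exists_bound_of_continuousOn hc.continuousOn
      exact MemLp.of_bound hc.aestronglyMeasurable C (ae_of_all _ fun x => hC x trivial)
    have h2 : inner ℂ (hmem.toLp _) v = (0 : ℂ) := by
      rw [L2.inner_def, ← integral_conj_holomorphic_eq_zero hn hp hħ hv' hF h0 h1]
      refine integral_congr_ae ?_
      filter_upwards [hmem.coeFn_toLp] with x hx
      rw [hx, RCLike.inner_apply']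
    have h3 : (inner ℂ f v : ℂ) = -inner ℂ (hmem.toLp _ - f) v := by
      rw [inner_sub_left, h2]
      ring
    have h4 : ENNReal.ofReal ‖hmem.toLp _ - f‖ =
        eLpNorm (fun x : Sph n => F (r • (x : Cn n)) - f x) 2 (sphereMeasure n) := by
      rw [Lp.norm_def, ENNReal.ofReal_toReal (Lp.eLpNorm_ne_top _)]
      refine eLpNorm_congr_ae ?_
      filter_upwards [hmem.coeFn_toLp, Lp.coeFn_sub (hmem.toLp _) f] with x hx hx'
      rw [hx', Pi.sub_apply, hx]
    rw [← h4, ← ENNReal.ofReal_mul (norm_nonneg _), h3, norm_neg]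
    exact ENNReal.ofReal_le_ofReal (norm_inner_le_norm _ _)
  have h5 := ENNReal.Tendsto.mul_const (b := ENNReal.ofReal ‖v‖) hlim
    (Or.inr ENNReal.ofReal_ne_top)
  rw [zero_mul] at h5
  have h6 : ENNReal.ofReal ‖(inner ℂ f v : ℂ)‖ ≤ 0 := by
    refine ge_of_tendsto h5 ?_
    filter_upwards [eventually_mem_Ioo] with r hr
    exact hbound r hr.1 hr.2
  have h7 := ENNReal.ofReal_eq_zero.1 (le_antisymm h6 zero_le)
  exact norm_le_zero_iff.1 h7

/-! ### The star product and composition of operators -/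

theorem cdot_surjective {n : ℕ} {z : Cn n} (hz : z ≠ 0) :
    Function.Surjective (innerSL ℂ z : Cn n →L[ℂ] ℂ) := by
  intro c
  refine ⟨(c / (‖z‖ ^ 2 : ℝ)) • z, ?_⟩
  have : ((‖z‖ ^ 2 : ℝ) : ℂ) ≠ 0 := by
    exact_mod_cast pow_ne_zero 2 (norm_ne_zero_iff.2 hz)
  rw [innerSL_apply_apply, inner_smul_right, ← cdot_eq_inner, cdot_self, div_mul_cancel₀ _ this]

theorem countable_theta_zeros {b : ℝ} (hb : 0 < b) : {t : ℂ | theta b t = 0}.Countable := by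
  have h1 : AnalyticOnNhd ℂ (theta b) Set.univ :=
    (differentiable_theta hb).differentiableOn.analyticOnNhd isOpen_univ
  have h0 : theta b 0 ≠ 0 := by
    have := theta_ofReal b 0
    rw [Complex.ofReal_zero, thetaR_zero] at this
    simp [this]
  have h2 := h1.preimage_zero_mem_codiscrete h0
  have h3 := isDiscrete_of_codiscreteWithin h2
  have h4 := (HereditarilyLindelofSpace.isLindelof _).countable_of_isDiscrete h3
  refine h4.mono fun t ht => ?_
  exact ⟨ht, trivial⟩

/-- The exceptional set of the extended symbols is a null set: it is the preimage of a countable set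
under a nonzero linear functional. -/
theorem ae_kernelT_ne_zero {n : ℕ} {p ħ : ℝ} (hp : -(n : ℝ) < p) (z : Cn n) :
    ∀ᵐ u ∂mMeasure n p ħ, kernelT n p ħ u z ≠ 0 := by
  by_cases hzħ : z = 0 ∨ ħ = 0
  · refine ae_of_all _ fun u => ?_
    have h0 : cdot u z / (ħ : ℂ) ^ 2 = ((0 : ℝ) : ℂ) := by
      rcases hzħ with rfl | rfl
      · simp [cdot]
      · simp
    rw [kernelT_eq, h0, theta_ofReal, thetaR_zero]
    simp
  · push Not at hzħ
    have hħ : (ħ : ℂ) ^ 2 ≠ 0 := pow_ne_zero _ (by exact_mod_cast hzħ.2)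
    have hcount : {y : ℂ | theta (n + p) (y / (ħ : ℂ) ^ 2) = 0}.Countable := by
      have := (countable_theta_zeros (add_pos_of_neg_lt hp)).preimage
        (f := fun y : ℂ => y / (ħ : ℂ) ^ 2) (fun x y h => (div_left_inj' hħ).1 h)
      exact this
    have h1 : ∀ᵐ y : ℂ, y ∈ {y : ℂ | theta (n + p) (y / (ħ : ℂ) ^ 2) = 0}ᶜ :=
      compl_mem_ae_iff.2 (hcount.measure_zero _)
    have h2 := (ae_comp_linearMap_mem_iff
      (L := ((innerSL ℂ z : Cn n →L[ℂ] ℂ).restrictScalars ℝ : Cn n →ₗ[ℝ] ℂ)) volume volume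
      (cdot_surjective hzħ.1) hcount.measurableSet.compl).2 h1
    refine (withDensity_absolutelyContinuous _ _).ae_le ?_
    filter_upwards [h2] with u hu
    rw [kernelT_eq, cdot_eq_inner]
    exact hu

theorem completeSpace_cohSpan (n : ℕ) (p ħ : ℝ) : CompleteSpace (cohSpan n p ħ) :=
  (Submodule.isClosed_topologicalClosure _).completeSpace_coe

/-- A bounded operator on `𝒪` has an adjoint with values in the closure of `𝒪`. -/
theorem exists_adjoint_vector {n : ℕ} (hn : 0 < n) {p ħ : ℝ} (hp : -(n : ℝ) < p) (hħ : 0 < ħ)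
    (A : HolSpace n →L[ℂ] HolSpace n) (z : Cn n) : ∃ v ∈ cohSpan n p ħ,
      ∀ h : HolSpace n, inner ℂ v (h : L2Sph n) = (inner ℂ (coh n p ħ z) (A h) : ℂ) := by
  have hcomplete := completeSpace_cohSpan n p ħ
  obtain ⟨g, hg, -⟩ := exists_extension_norm_eq (HolSpace n)
    ((innerSL ℂ (coh n p ħ z) : HolSpace n →L[ℂ] ℂ).comp A)
  set v := (InnerProductSpace.toDual ℂ (cohSpan n p ħ)).symm
    (g.comp (cohSpan n p ħ).subtypeL) with hv
  refine ⟨v, v.2, fun h => ?_⟩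
  have h1 : inner ℂ v (⟨h, holSpace_le_cohSpan hn hp hħ h.2⟩ : cohSpan n p ħ) =
      (g h : ℂ) := by
    rw [hv, InnerProductSpace.toDual_symm_apply]
    rfl
  refine h1.trans ((hg h).trans ?_)
  rfl

/-- The data entering the star product at `z`: vectors `h₁`, `h₂` with
`⟪h₁, K(·, u)⟫ = ⟪K(·, z), A₁ K(·, u)⟫` and `h₂ = A₂ K(·, z)`. -/
theorem exists_star_vectors {n : ℕ} (hn : 0 < n) {p ħ : ℝ} (hp : -(n : ℝ) < p) (hħ : 0 < ħ)
    (A₁ A₂ : HolSpace n →L[ℂ] HolSpace n) (z : Cn n) :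
    ∃ h₁ ∈ cohSpan n p ħ, ∃ h₂ ∈ cohSpan n p ħ,
      (∀ u, extSymbol n p ħ A₁ u z = (starRingEnd ℂ) (transform n p ħ h₁ u / kernelT n p ħ u z)) ∧
      (∀ u, extSymbol n p ħ A₂ z u = transform n p ħ h₂ u / kernelT n p ħ u z) ∧
      inner ℂ h₁ h₂ = (inner ℂ (coh n p ħ z) (A₁ (A₂ (coh n p ħ z))) : ℂ) := by
  obtain ⟨v, hv, hvA⟩ := exists_adjoint_vector hn hp hħ A₁ z
  refine ⟨v, hv, A₂ (coh n p ħ z), holSpace_le_cohSpan hn hp hħ (A₂ (coh n p ħ z)).2,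
    fun u => ?_, fun u => ?_, hvA _⟩
  · rw [extSymbol, ← hvA, inner_coh hn hp hħ, map_div₀, kernelT_conj, transform, inner_conj_symm]
    rfl
  · rw [extSymbol, inner_coh hn hp hħ]
    rfl

/-- The integral defining the star product is the inner product of two transforms in `L²(m)`. -/
theorem star_extSymbol {n : ℕ} (hn : 0 < n) {p ħ : ℝ} (hp : -(n : ℝ) < p) (hħ : 0 < ħ)
    {h₁ h₂ : L2Sph n} (hh₁ : h₁ ∈ cohSpan n p ħ) (hh₂ : h₂ ∈ cohSpan n p ħ) {F₁ F₂ : Cn n → ℂ}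
    {z : Cn n}
    (hF₁ : ∀ u, F₁ u = (starRingEnd ℂ) (transform n p ħ h₁ u / kernelT n p ħ u z))
    (hF₂ : ∀ u, F₂ u = transform n p ħ h₂ u / kernelT n p ħ u z) :
    Integrable (fun u => F₁ u * F₂ u *
      (kernelT n p ħ u z * kernelT n p ħ z u / kernelT n p ħ z z)) (mMeasure n p ħ) ∧
    ∫ u, F₁ u * F₂ u * (kernelT n p ħ u z * kernelT n p ħ z u / kernelT n p ħ z z)
      ∂mMeasure n p ħ = inner ℂ h₁ h₂ / kernelT n p ħ z z := by
  have hae : (fun u => (starRingEnd ℂ) (transform n p ħ h₁ u) * transform n p ħ h₂ u /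
      kernelT n p ħ z z) =ᵐ[mMeasure n p ħ] fun u => F₁ u * F₂ u *
      (kernelT n p ħ u z * kernelT n p ħ z u / kernelT n p ħ z z) := by
    filter_upwards [ae_kernelT_ne_zero hp z] with u hu
    have hu' : kernelT n p ħ z u ≠ 0 := by
      rw [← kernelT_conj]
      exact (map_ne_zero _).2 hu
    rw [hF₁, hF₂, map_div₀, kernelT_conj]
    field_simp
  refine ⟨((integrable_conj_mul (memLp_transform_of_mem_cohSpan hn hp hħ hh₁)
    (memLp_transform_of_mem_cohSpan hn hp hħ hh₂)).div_const _).congr hae, ?_⟩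
  rw [← integral_congr_ae hae, integral_div, integral_transform hn hp hħ hh₁ hh₂]

/-! ### The symbol determines the extended symbol -/

theorem eq_zero_of_ofReal {f : ℂ → ℂ} (hf : Differentiable ℂ f) (h : ∀ x : ℝ, f x = 0) :
    f = 0 := by
  have h1 : AnalyticOnNhd ℂ f Set.univ := hf.differentiableOn.analyticOnNhd isOpen_univ
  refine h1.eq_of_frequently_eq (z₀ := 0) (fun _ _ => analyticAt_const) ?_
  have h2 : Tendsto (fun k : ℕ => ((1 / ((k : ℝ) + 1) : ℝ) : ℂ)) atTop (𝓝[≠] 0) := by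
    refine tendsto_nhdsWithin_iff.2 ⟨?_, Eventually.of_forall fun k => ?_⟩
    · have := (Complex.continuous_ofReal.tendsto 0).comp
        (tendsto_one_div_add_atTop_nhds_zero_nat (𝕜 := ℝ))
      rwa [Complex.ofReal_zero] at this
    · have : (0 : ℝ) < 1 / ((k : ℝ) + 1) := by positivity
      exact Complex.ofReal_ne_zero.2 this.ne'
  exact h2.frequently (Frequently.of_forall fun k => h _)

/-- An operator on `𝒪` extends to an operator on `L²(S)`. -/
theorem exists_extension_operator (n : ℕ) (A : HolSpace n →L[ℂ] HolSpace n) :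
    ∃ B : L2Sph n →L[ℂ] L2Sph n, ∀ h : HolSpace n, B h = A h := by
  set O := (HolSpace n).topologicalClosure
  have hcomplete : CompleteSpace O :=
    (Submodule.isClosed_topologicalClosure _).completeSpace_coe
  set e : HolSpace n →L[ℂ] O :=
    (HolSpace n).subtypeL.codRestrict O fun h => Submodule.le_topologicalClosure _ h.2 with he
  have hdense : DenseRange e := by
    intro g
    rw [closure_subtype]
    refine closure_mono ?_ g.2
    exact fun x hx => ⟨e ⟨x, hx⟩, ⟨⟨x, hx⟩, rfl⟩, rfl⟩
  have hind : IsUniformInducing e :=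
    (AddMonoidHomClass.isometry_of_norm e fun h => rfl).isUniformInducing
  refine ⟨(((HolSpace n).subtypeL.comp A).extend e).comp O.orthogonalProjectionOnto, fun h => ?_⟩
  have h1 : O.orthogonalProjectionOnto (h : L2Sph n) = e h :=
    Submodule.orthogonalProjectionOnto_mem_subspace_eq_self (e h)
  rw [ContinuousLinearMap.comp_apply, h1, ContinuousLinearMap.extend_eq _ hdense hind]
  rfl

/-- By analytic continuation from the antidiagonal, an operator with vanishing diagonal matrix
elements between coherent states has vanishing matrix elements between coherent states. -/
theorem inner_coh_eq_zero_of_diag (n : ℕ) (p ħ : ℝ) (B : L2Sph n →L[ℂ] L2Sph n)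
    (hB : ∀ z, inner ℂ (cohL2 n p ħ z) (B (cohL2 n p ħ z)) = (0 : ℂ)) (w z : Cn n) :
    inner ℂ (cohL2 n p ħ w) (B (cohL2 n p ħ z)) = (0 : ℂ) := by
  -- on the line through `z` and `w`, the matrix element is a holomorphic function of two variables
  -- that vanishes for `s = conj t`; the value sought is `ψ 0 1`
  set ψ : ℂ → ℂ → ℂ := fun s t =>
    innerSL ℂ (cohL2 n p ħ (z + t • (w - z)))
      (B (cohL2 n p ħ (z + (starRingEnd ℂ) s • (w - z)))) with hψ
  have hdiff : ∀ a b c d : ℂ, Differentiable ℂ fun x => ψ (a + b * x) (c + d * x) := by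
    intro a b c d
    have h1 := (contDiff_innerSL_cohL2 n p ħ).differentiable (by simp)
    have h2 := (contDiff_cohL2_line n p ħ z (w - z)).differentiable (by simp)
    have h3 : Differentiable ℂ fun x : ℂ =>
        (innerSL ℂ (cohL2 n p ħ (z + (c + d * x) • (w - z))) : L2Sph n →L[ℂ] ℂ) :=
      h1.comp (f := fun x : ℂ => z + (c + d * x) • (w - z)) (by fun_prop)
    have h4 : Differentiable ℂ fun x : ℂ =>
        cohL2 n p ħ (z + (starRingEnd ℂ) (a + b * x) • (w - z)) :=
      h2.comp (f := fun x : ℂ => a + b * x) (by fun_prop)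
    exact h3.clm_apply (B.differentiable.comp h4)
  have hreal : ∀ α β : ℝ, ψ (α + -Complex.I * β) (α + Complex.I * β) = 0 := by
    intro α β
    have : (starRingEnd ℂ) (α + -Complex.I * β) = α + Complex.I * β := by simp
    simp only [hψ, this]
    exact hB _
  -- in the coordinates `s = α - i β`, `t = α + i β` it vanishes for real `α` and `β`; continue in one
  -- variable after the other
  have h1 : ∀ (β : ℝ) (α : ℂ), ψ (α + -Complex.I * β) (α + Complex.I * β) = 0 := by
    intro β
    have h := eq_zero_of_ofReal (f := fun α : ℂ => ψ (-Complex.I * β + 1 * α)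
      (Complex.I * β + 1 * α)) (hdiff _ _ _ _) fun x => by
        rw [one_mul, add_comm, add_comm (Complex.I * β)]
        exact hreal x β
    intro α
    have := congrFun h α
    simp only [one_mul] at this
    rw [add_comm, add_comm α]
    exact this
  have h2 : ∀ α β : ℂ, ψ (α + -Complex.I * β) (α + Complex.I * β) = 0 := fun α β =>
    congrFun (eq_zero_of_ofReal (f := fun β : ℂ => ψ (α + -Complex.I * β) (α + Complex.I * β))
      (hdiff _ _ _ _) fun x => h1 x α) β
  have h3 := h2 (1 / 2) (-Complex.I / 2)
  have e1 : (1 / 2 : ℂ) + -Complex.I * (-Complex.I / 2) = 0 := by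
    linear_combination (1 / 2 : ℂ) * Complex.I_mul_I
  have e2 : (1 / 2 : ℂ) + Complex.I * (-Complex.I / 2) = 1 := by
    linear_combination (-1 / 2 : ℂ) * Complex.I_mul_I
  rw [e1, e2] at h3
  simpa [hψ] using h3

theorem extSymbol_eq_of_symbol_eq {n : ℕ} (hn : 0 < n) {p ħ : ℝ} (hp : -(n : ℝ) < p) (hħ : 0 < ħ)
    {A B : HolSpace n →L[ℂ] HolSpace n} (h : symbol n p ħ A = symbol n p ħ B) :
    extSymbol n p ħ A = extSymbol n p ħ B := by
  obtain ⟨D, hD⟩ := exists_extension_operator n (A - B)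
  have h1 : ∀ w z, inner ℂ (cohL2 n p ħ w) (D (cohL2 n p ħ z)) =
      (inner ℂ (coh n p ħ w) (A (coh n p ħ z)) - inner ℂ (coh n p ħ w) (B (coh n p ħ z)) : ℂ) := by
    intro w z
    refine Eq.trans ?_ (inner_sub_right (𝕜 := ℂ) (coh n p ħ w) (A (coh n p ħ z))
      (B (coh n p ħ z)))
    rw [cohL2, cohL2, hD]
    rfl
  have h2 := inner_coh_eq_zero_of_diag n p ħ D fun z => by
    have h3 := congrFun h z
    rw [symbol, symbol, extSymbol, extSymbol, inner_coh hn hp hħ,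
      div_left_inj' (kernelT_self_ne_zero hp ħ z)] at h3
    rw [h1, h3, sub_self]
  funext z w
  rw [extSymbol, extSymbol, sub_eq_zero.1 ((h1 w z).symm.trans (h2 w z))]

theorem ext_symbol {n : ℕ} (hn : 0 < n) {p ħ : ℝ} (hp : -(n : ℝ) < p) (hħ : 0 < ħ)
    (A : HolSpace n →L[ℂ] HolSpace n) : ext n p ħ (symbol n p ħ A) = extSymbol n p ħ A := by
  have h : ∃ B, symbol n p ħ B = symbol n p ħ A := ⟨A, rfl⟩
  rw [ext, dif_pos h]
  exact extSymbol_eq_of_symbol_eq hn hp hħ h.choose_spec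

/-- The star product of symbols is the symbol of the composition. -/
theorem starProd_symbol {n : ℕ} (hn : 0 < n) {p ħ : ℝ} (hp : -(n : ℝ) < p) (hħ : 0 < ħ)
    (A₁ A₂ : HolSpace n →L[ℂ] HolSpace n) :
    (∀ z, Integrable (starIntegrand n p ħ (symbol n p ħ A₁) (symbol n p ħ A₂) z)
      (mMeasure n p ħ)) ∧
    starProd n p ħ (symbol n p ħ A₁) (symbol n p ħ A₂) = symbol n p ħ (A₁.comp A₂) := by
  have key : ∀ z, Integrable (starIntegrand n p ħ (symbol n p ħ A₁) (symbol n p ħ A₂) z)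
      (mMeasure n p ħ) ∧ starProd n p ħ (symbol n p ħ A₁) (symbol n p ħ A₂) z =
        symbol n p ħ (A₁.comp A₂) z := by
    intro z
    obtain ⟨h₁, hh₁, h₂, hh₂, e₁, e₂, e₃⟩ := exists_star_vectors hn hp hħ A₁ A₂ z
    have h := star_extSymbol hn hp hħ hh₁ hh₂ e₁ e₂
    rw [e₃] at h
    rw [starProd, symbol, extSymbol, inner_coh hn hp hħ]
    unfold starIntegrand
    rw [ext_symbol hn hp hħ, ext_symbol hn hp hħ]
    exact h
  exact ⟨fun z => (key z).1, funext fun z => (key z).2⟩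

theorem symbol_id {n : ℕ} (hn : 0 < n) {p ħ : ℝ} (hp : -(n : ℝ) < p) (hħ : 0 < ħ) :
    symbol n p ħ (ContinuousLinearMap.id ℂ (HolSpace n)) = 1 := by
  funext z
  rw [symbol, extSymbol, ContinuousLinearMap.id_apply, inner_coh hn hp hħ,
    div_self (kernelT_self_ne_zero hp ħ z), Pi.one_apply]

/-! ### Differential operators and multiplication operators -/

/-- The operator `H ↦ (b - 1) H + E H`, where `E H (u) = dH(u) u` is the Euler operator. The
Bessel differential equation says that `ħ²` times the derivative of this function is adjoint to
multiplication by a linear function. -/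
def radialOp {n : ℕ} {W : Type*} [NormedAddCommGroup W] [NormedSpace ℂ W] (b : ℝ) (H : Cn n → W)
    (u : Cn n) : W := ((b : ℂ) - 1) • H u + fderiv ℂ H u u

theorem hasFDerivAt_cdot_div {n : ℕ} (ħ : ℝ) (u w : Cn n) :
    HasFDerivAt (fun w => cdot w u / (ħ : ℂ) ^ 2) (((ħ : ℂ) ^ 2)⁻¹ • (innerSL ℂ u : Cn n →L[ℂ] ℂ)) w := by
  have h : (fun w => cdot w u / (ħ : ℂ) ^ 2) =
      fun w => (((ħ : ℂ) ^ 2)⁻¹ • (innerSL ℂ u : Cn n →L[ℂ] ℂ)) w := by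
    funext w
    rw [cdot_eq_inner, smul_apply, smul_eq_mul, innerSL_apply_apply, div_eq_inv_mul]
  rw [h]
  exact ContinuousLinearMap.hasFDerivAt _

theorem hasFDerivAt_kernelT {n : ℕ} {p : ℝ} (hp : -(n : ℝ) < p) (ħ : ℝ) (u w : Cn n) :
    HasFDerivAt (fun w => kernelT n p ħ w u)
      ((theta (n + p + 1) (cdot w u / (ħ : ℂ) ^ 2) / ((n + p : ℝ) : ℂ)) •
        ((ħ : ℂ) ^ 2)⁻¹ • (innerSL ℂ u : Cn n →L[ℂ] ℂ)) w :=
  (hasDerivAt_theta (add_pos_of_neg_lt hp) _).comp_hasFDerivAt w (hasFDerivAt_cdot_div ħ u w)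

theorem fderiv_kernelT_apply {n : ℕ} {p : ℝ} (hp : -(n : ℝ) < p) (ħ : ℝ) (u w c : Cn n) :
    fderiv ℂ (fun w => kernelT n p ħ w u) w c =
      theta (n + p + 1) (cdot w u / (ħ : ℂ) ^ 2) / ((n + p : ℝ) : ℂ) * (cdot c u / (ħ : ℂ) ^ 2) := by
  rw [(hasFDerivAt_kernelT hp ħ u w).fderiv]
  simp only [smul_apply, smul_eq_mul, innerSL_apply_apply, ← cdot_eq_inner]
  ring

theorem radialOp_kernelT {n : ℕ} {p : ℝ} (hp : -(n : ℝ) < p) (ħ : ℝ) (u w : Cn n) :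
    radialOp (n + p) (fun w => kernelT n p ħ w u) w =
      (((n + p : ℝ) : ℂ) - 1) * theta (n + p) (cdot w u / (ħ : ℂ) ^ 2) +
      cdot w u / (ħ : ℂ) ^ 2 * theta (n + p + 1) (cdot w u / (ħ : ℂ) ^ 2) / ((n + p : ℝ) : ℂ) := by
  rw [radialOp, fderiv_kernelT_apply hp, kernelT_eq, smul_eq_mul]
  ring

theorem hasFDerivAt_radialOp_kernelT {n : ℕ} {p : ℝ} (hp : -(n : ℝ) < p) (ħ : ℝ) (u w : Cn n) :
    HasFDerivAt (radialOp (n + p) fun w => kernelT n p ħ w u)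
      (kernelT n p ħ w u • ((ħ : ℂ) ^ 2)⁻¹ • (innerSL ℂ u : Cn n →L[ℂ] ℂ)) w := by
  have hb := add_pos_of_neg_lt hp
  have hb1 : 0 < (n : ℝ) + p + 1 := by linarith
  have h1 : ∀ t : ℂ, HasDerivAt (fun t => (((n + p : ℝ) : ℂ) - 1) * theta (n + p) t +
      t * theta (n + p + 1) t / ((n + p : ℝ) : ℂ)) (theta (n + p) t) t := by
    intro t
    have h2 := ((hasDerivAt_theta hb t).const_mul (((n + p : ℝ) : ℂ) - 1)).add
      (((hasDerivAt_id t).mul (hasDerivAt_theta hb1 t)).div_const ((n + p : ℝ) : ℂ))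
    refine h2.congr_deriv ?_
    have hb' : ((n + p : ℝ) : ℂ) ≠ 0 := by exact_mod_cast hb.ne'
    have hb1' : ((n + p + 1 : ℝ) : ℂ) ≠ 0 := by exact_mod_cast hb1.ne'
    rw [← theta_contiguous hb t]
    simp only [id]
    push_cast at hb' hb1' ⊢
    field_simp
    ring
  have h3 := (h1 (cdot w u / (ħ : ℂ) ^ 2)).comp_hasFDerivAt w (hasFDerivAt_cdot_div ħ u w)
  have h4 : (radialOp (n + p) fun w => kernelT n p ħ w u) = fun w =>
      (((n + p : ℝ) : ℂ) - 1) * theta (n + p) (cdot w u / (ħ : ℂ) ^ 2) +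
      cdot w u / (ħ : ℂ) ^ 2 * theta (n + p + 1) (cdot w u / (ħ : ℂ) ^ 2) / ((n + p : ℝ) : ℂ) :=
    funext fun w => radialOp_kernelT hp ħ u w
  rw [h4, kernelT_eq]
  exact h3

theorem fderiv_radialOp_kernelT_apply {n : ℕ} {p : ℝ} (hp : -(n : ℝ) < p) (ħ : ℝ)
    (u w c : Cn n) : fderiv ℂ (radialOp (n + p) fun w => kernelT n p ħ w u) w c =
      kernelT n p ħ w u * (cdot c u / (ħ : ℂ) ^ 2) := by
  rw [(hasFDerivAt_radialOp_kernelT hp ħ u w).fderiv]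
  simp only [smul_apply, smul_eq_mul, innerSL_apply_apply, ← cdot_eq_inner]
  ring

theorem contDiff_radialOp {n : ℕ} {W : Type*} [NormedAddCommGroup W] [NormedSpace ℂ W] (b : ℝ)
    {H : Cn n → W} (hH : ContDiff ℂ ⊤ H) : ContDiff ℂ 1 (radialOp b H) := by
  have h1 : ContDiff ℂ 1 H := hH.of_le le_top
  have h2 : ContDiff ℂ 1 (fderiv ℂ H) := hH.fderiv_right (m := 1) le_top
  exact (contDiff_const.smul h1).add (h2.clm_apply contDiff_id)

/-- For every `c` there is a vector whose transform is `(u ⬝ c) T(u, z)`; pairing with it amounts to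
applying a differential operator at `z`. -/
theorem exists_gradient_vector {n : ℕ} (hn : 0 < n) {p ħ : ℝ} (hp : -(n : ℝ) < p) (hħ : 0 < ħ)
    (z c : Cn n) : ∃ e ∈ cohSpan n p ħ,
      (∀ h ∈ cohSpan n p ħ, inner ℂ e h =
        (ħ : ℂ) ^ 2 * fderiv ℂ (radialOp (n + p) (transform n p ħ h)) z c) ∧
      ∀ u, transform n p ħ e u = cdot u c * kernelT n p ħ u z := by
  have hcomplete := completeSpace_cohSpan n p ħ
  set Ψ : Cn n → L2Sph n →L[ℂ] ℂ := fun u => innerSL ℂ (cohL2 n p ħ u) with hΨ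
  have hΨc : ContDiff ℂ ⊤ Ψ := contDiff_innerSL_cohL2 n p ħ
  -- the vector represents the functional `h ↦ ħ² ∂_c (radialOp h) (z)`
  set g : L2Sph n →L[ℂ] ℂ := (ħ : ℂ) ^ 2 • fderiv ℂ (radialOp (n + p) Ψ) z c with hg
  have happ : ∀ h, g h = (ħ : ℂ) ^ 2 * fderiv ℂ (radialOp (n + p) (transform n p ħ h)) z c := by
    intro h
    have h1 : ∀ u, radialOp (n + p) (transform n p ħ h) u = radialOp (n + p) Ψ u h := by
      intro u
      have h2 : HasFDerivAt (transform n p ħ h)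
          ((ContinuousLinearMap.apply ℂ ℂ h).comp (fderiv ℂ Ψ u)) u :=
        (ContinuousLinearMap.apply ℂ ℂ h).hasFDerivAt.comp u
          (hΨc.differentiable (by simp) u).hasFDerivAt
      rw [radialOp, radialOp, h2.fderiv]
      rfl
    have h3 : HasFDerivAt (fun u => radialOp (n + p) Ψ u h)
        ((ContinuousLinearMap.apply ℂ ℂ h).comp (fderiv ℂ (radialOp (n + p) Ψ) z)) z :=
      (ContinuousLinearMap.apply ℂ ℂ h).hasFDerivAt.comp z
        ((contDiff_radialOp (n + p) hΨc).differentiable (by simp) z).hasFDerivAt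
    rw [funext h1, h3.fderiv]
    rfl
  set v := (InnerProductSpace.toDual ℂ (cohSpan n p ħ)).symm
    (g.comp (cohSpan n p ħ).subtypeL) with hv
  have hinner : ∀ h ∈ cohSpan n p ħ, inner ℂ (v : L2Sph n) h = g h := by
    intro h hh
    have h1 : inner ℂ v (⟨h, hh⟩ : cohSpan n p ħ) = (g h : ℂ) := by
      rw [hv, InnerProductSpace.toDual_symm_apply]
      rfl
    exact h1
  refine ⟨v, v.2, fun h hh => (hinner h hh).trans (happ h), fun u => ?_⟩
  have hħ' : (ħ : ℂ) ^ 2 ≠ 0 := pow_ne_zero 2 (by exact_mod_cast hħ.ne')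
  rw [transform, ← inner_conj_symm, hinner _ (cohL2_mem_cohSpan n p ħ u), happ,
    transform_cohL2' hn hp hħ, fderiv_radialOp_kernelT_apply hp, mul_comm (kernelT n p ħ z u),
    ← mul_assoc, mul_div_cancel₀ _ hħ', map_mul, cdot_conj, kernelT_conj]

theorem fderiv_radialOp_mul {n : ℕ} {p : ℝ} (hp : -(n : ℝ) < p) (ħ : ℝ) {z : Cn n}
    {F H : Cn n → ℂ} (hF : ContDiffAt ℂ 2 F z) (hH : H =ᶠ[𝓝 z] fun u => F u * kernelT n p ħ u z)
    (c : Cn n) : fderiv ℂ (radialOp (n + p) H) z c =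
      fderiv ℂ (fun u => fderiv ℂ F u u) z c * kernelT n p ħ z z +
      fderiv ℂ F z z * fderiv ℂ (fun w => kernelT n p ħ w z) z c +
      fderiv ℂ F z c * radialOp (n + p) (fun w => kernelT n p ħ w z) z +
      F z * (kernelT n p ħ z z * (cdot c z / (ħ : ℂ) ^ 2)) := by
  set T : Cn n → ℂ := fun w => kernelT n p ħ w z with hT
  have hTd : Differentiable ℂ T := fun w => (hasFDerivAt_kernelT hp ħ z w).differentiableAt
  have hFd : ∀ᶠ u in 𝓝 z, DifferentiableAt ℂ F u := by
    filter_upwards [hF.eventually (by simp)] with u hu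
    exact hu.differentiableAt (by simp)
  have h1 : radialOp (n + p) H =ᶠ[𝓝 z] fun u => fderiv ℂ F u u * T u +
      F u * radialOp (n + p) T u := by
    filter_upwards [hH.eventually_nhds, hFd] with u hu hu'
    have h2 : fderiv ℂ H u = F u • fderiv ℂ T u + T u • fderiv ℂ F u := by
      have hu2 : H =ᶠ[𝓝 u] fun u => F u * T u := hu
      rw [hu2.fderiv_eq]
      exact fderiv_fun_mul hu' (hTd u)
    rw [radialOp, radialOp, h2, Eventually.self_of_nhds hu]
    simp only [add_apply, smul_apply, smul_eq_mul, hT]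
    ring
  have hE : DifferentiableAt ℂ (fun u => fderiv ℂ F u u) z := by
    have h2 : ContDiffAt ℂ 1 (fderiv ℂ F) z := hF.fderiv_right (by norm_num)
    exact (h2.differentiableAt (by simp)).clm_apply differentiableAt_id
  have hR := hasFDerivAt_radialOp_kernelT hp ħ z z
  have h2 := ((hE.hasFDerivAt.mul (hTd z).hasFDerivAt).add
    (hFd.self_of_nhds.hasFDerivAt.mul hR.differentiableAt.hasFDerivAt)).fderiv
  rw [h1.fderiv_eq]
  refine (congrArg (fun L : Cn n →L[ℂ] ℂ => L c) h2).trans ?_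
  simp only [add_apply, smul_apply, smul_eq_mul]
  rw [fderiv_radialOp_kernelT_apply hp]
  ring

/-- The quotient `τ Θ'(τ) / Θ(τ)` at `τ = x²`. -/
def eulerRatio (b x : ℝ) : ℝ := x ^ 2 * thetaR (b + 1) (x ^ 2) / (b * thetaR b (x ^ 2))

theorem exists_eulerRatio {b : ℝ} (hb : 0 < b) :
    ∃ K, 0 ≤ K ∧ ∀ x : ℝ, 1 ≤ x → |eulerRatio b x - x| ≤ K := by
  obtain ⟨K, hK0, hK⟩ := exists_besselMean hb
  have hb1 : 0 < b + 1 := by linarith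
  refine ⟨K, hK0, fun x hx => ?_⟩
  have hT : 0 < thetaR b (x ^ 2) := zero_lt_one.trans_le (one_le_thetaR_sq hb x)
  have h1 : besselSum hb (x ^ 2) Polynomial.X = x ^ 2 * thetaR (b + 1) (x ^ 2) / b := by
    have h2 := besselSum_hasSum hb (x ^ 2) Polynomial.X
    rw [← hasSum_nat_add_iff' 1] at h2
    simp only [Finset.range_one, Finset.sum_singleton, Nat.cast_zero, Polynomial.eval_X, mul_zero,
      sub_zero] at h2
    have h3 := ((summable_theta_norm hb1 (x ^ 2)).hasSum).mul_left (x ^ 2 / b)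
    have h4 := h2.unique (h3.congr_fun fun l => by
      have := thetaCoeff_succ hb l
      push_cast
      have e : thetaCoeff b (l + 1) * ((l : ℝ) + 1) = thetaCoeff (b + 1) l / b := by
        rw [← this]
        ring
      rw [pow_succ]
      linear_combination ((x ^ 2) ^ l * x ^ 2) * e)
    rw [h4, thetaR]
    ring
  have h5 := hK x hx
  rw [h1] at h5
  have h6 : eulerRatio b x - x =
      (x ^ 2 * thetaR (b + 1) (x ^ 2) / b - x * thetaR b (x ^ 2)) / thetaR b (x ^ 2) := by
    rw [eulerRatio]
    field_simp
  rw [h6, abs_div, abs_of_pos hT, div_le_iff₀ hT]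
  exact h5

theorem fderiv_kernelT_self {n : ℕ} {p : ℝ} (hp : -(n : ℝ) < p) {ħ : ℝ} (hħ : 0 < ħ) {z : Cn n}
    (hz : z ≠ 0) (c : Cn n) : fderiv ℂ (fun w => kernelT n p ħ w z) z c =
      kernelT n p ħ z z * (eulerRatio (n + p) (‖z‖ / ħ) * (cdot c z / ((‖z‖ ^ 2 : ℝ) : ℂ))) := by
  have hb := add_pos_of_neg_lt hp
  have hT : thetaR (n + p) ((‖z‖ / ħ) ^ 2) ≠ 0 :=
    (zero_lt_one.trans_le (one_le_thetaR_sq hb _)).ne'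
  have h1 : cdot z z / (ħ : ℂ) ^ 2 = (((‖z‖ / ħ) ^ 2 : ℝ) : ℂ) := by
    rw [cdot_self]
    push_cast
    rw [div_pow]
  have hz' : (‖z‖ : ℂ) ≠ 0 := by exact_mod_cast norm_ne_zero_iff.2 hz
  have hħ' : (ħ : ℂ) ≠ 0 := by exact_mod_cast hħ.ne'
  have hT' : (thetaR (n + p) ((‖z‖ / ħ) ^ 2) : ℂ) ≠ 0 := by exact_mod_cast hT
  have hb' : ((n + p : ℝ) : ℂ) ≠ 0 := by exact_mod_cast hb.ne'
  rw [fderiv_kernelT_apply hp, h1, theta_ofReal, kernelT_self, eulerRatio]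
  generalize thetaR (n + p) ((‖z‖ / ħ) ^ 2) = A at *
  generalize thetaR (n + p + 1) ((‖z‖ / ħ) ^ 2) = B at *
  push_cast at hb' hT' ⊢
  field_simp

theorem radialOp_kernelT_self {n : ℕ} {p : ℝ} (hp : -(n : ℝ) < p) (ħ : ℝ) (z : Cn n) :
    radialOp (n + p) (fun w => kernelT n p ħ w z) z =
      kernelT n p ħ z z * ((n + p - 1 + eulerRatio (n + p) (‖z‖ / ħ) : ℝ) : ℂ) := by
  have hb := add_pos_of_neg_lt hp
  have hT : thetaR (n + p) ((‖z‖ / ħ) ^ 2) ≠ 0 :=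
    (zero_lt_one.trans_le (one_le_thetaR_sq hb _)).ne'
  have h1 : cdot z z / (ħ : ℂ) ^ 2 = (((‖z‖ / ħ) ^ 2 : ℝ) : ℂ) := by
    rw [cdot_self]
    push_cast
    rw [div_pow]
  have hT' : (thetaR (n + p) ((‖z‖ / ħ) ^ 2) : ℂ) ≠ 0 := by exact_mod_cast hT
  have hb' : ((n + p : ℝ) : ℂ) ≠ 0 := by exact_mod_cast hb.ne'
  rw [radialOp_kernelT hp, h1, theta_ofReal, theta_ofReal, kernelT_self, eulerRatio]
  generalize thetaR (n + p) ((‖z‖ / ħ) ^ 2) = A at *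
  generalize thetaR (n + p + 1) ((‖z‖ / ħ) ^ 2) = B at *
  push_cast at hb' hT' ⊢
  field_simp

/-! ### Taylor remainders of bounded holomorphic functions -/

/-- The first order Taylor remainder of `F` at `z`. -/
def taylorRem {n : ℕ} (F : Cn n → ℂ) (z u : Cn n) : ℂ := F u - F z - fderiv ℂ F z (u - z)

theorem taylorRem_self {n : ℕ} (F : Cn n → ℂ) (z : Cn n) : taylorRem F z z = 0 := by
  simp [taylorRem]

theorem hasFDerivAt_taylorRem {n : ℕ} {F : Cn n → ℂ} {z u : Cn n}
    (hF : DifferentiableAt ℂ F u) :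
    HasFDerivAt (taylorRem F z) (fderiv ℂ F u - fderiv ℂ F z) u :=
  (hF.hasFDerivAt.sub_const (F z)).sub
    ((fderiv ℂ F z).hasFDerivAt.comp u ((hasFDerivAt_id u).sub_const z))

theorem contDiffAt_taylorRem {n : ℕ} {F : Cn n → ℂ} {z u : Cn n} (hF : ContDiffAt ℂ 2 F u) :
    ContDiffAt ℂ 2 (taylorRem F z) u :=
  (hF.sub contDiffAt_const).sub ((fderiv ℂ F z).contDiff.contDiffAt.comp u
    (contDiffAt_id.sub contDiffAt_const))

theorem norm_fderiv_le_of_bound {n : ℕ} {F : Cn n → ℂ} {z : Cn n} {r M : ℝ} (hr : 0 < r)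
    (hF : DifferentiableOn ℂ F (Metric.ball z r)) (hM : ∀ u ∈ Metric.ball z r, ‖F u‖ ≤ M) :
    ‖fderiv ℂ F z‖ ≤ 2 * M / r := by
  refine Complex.norm_fderiv_le_div_of_mapsTo_ball hF (fun u hu => ?_) hr
  rw [mem_closedBall_iff_norm]
  have h1 := hM u hu
  have h2 := hM z (Metric.mem_ball_self hr)
  linarith [norm_sub_le (F u) (F z)]

section

variable {n : ℕ} {F : Cn n → ℂ} {z : Cn n} {r M : ℝ}

theorem norm_taylorRem_le_const (hr : 0 < r)
    (hF : DifferentiableOn ℂ F (Metric.ball z r)) (hM : ∀ u ∈ Metric.ball z r, ‖F u‖ ≤ M)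
    {u : Cn n} (hu : u ∈ Metric.ball z r) : ‖taylorRem F z u‖ ≤ 4 * M := by
  have h1 := hM u hu
  have h2 := hM z (Metric.mem_ball_self hr)
  have hM0 : 0 ≤ M := (norm_nonneg _).trans h1
  have h3 := norm_fderiv_le_of_bound hr hF hM
  have h4 : ‖u - z‖ ≤ r := (mem_ball_iff_norm.1 hu).le
  have h5 : ‖fderiv ℂ F z (u - z)‖ ≤ 2 * M := by
    calc _ ≤ ‖fderiv ℂ F z‖ * ‖u - z‖ := ContinuousLinearMap.le_opNorm _ _
      _ ≤ 2 * M / r * r := by gcongr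
      _ = 2 * M := by field_simp
  have h6 := norm_sub_le (F u - F z) (fderiv ℂ F z (u - z))
  have h7 := norm_sub_le (F u) (F z)
  rw [taylorRem]
  linarith

theorem norm_taylorRem_le (hr : 0 < r)
    (hF : DifferentiableOn ℂ F (Metric.ball z r)) (hM : ∀ u ∈ Metric.ball z r, ‖F u‖ ≤ M)
    {u : Cn n} (hu : u ∈ Metric.ball z r) :
    ‖taylorRem F z u‖ ≤ 4 * M * (‖u - z‖ / r) ^ 2 := by
  have hd : DifferentiableOn ℂ (taylorRem F z) (Metric.ball z r) := fun w hw =>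
    (hasFDerivAt_taylorRem (hF.differentiableAt
      (Metric.isOpen_ball.mem_nhds hw))).differentiableAt.differentiableWithinAt
  have h := Complex.dist_le_mul_div_pow_of_mapsTo_ball_of_isLittleO (n := 1) (R₂ := 4 * M) hd
    (fun w hw => by
      rw [taylorRem_self, mem_closedBall_zero_iff]
      exact norm_taylorRem_le_const hr hF hM hw) (by
      have h1 := (hF.differentiableAt (Metric.isOpen_ball.mem_nhds
        (Metric.mem_ball_self hr))).hasFDerivAt.isLittleO
      simp only [taylorRem_self, sub_zero, pow_one]
      exact h1.norm_right) hu
  rwa [taylorRem_self, dist_zero_right, dist_eq_norm] at h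

/-- Cauchy estimate for the second derivatives entering `radialOp` of the remainder. -/
theorem norm_fderiv_euler_taylorRem_le (hr : 0 < r)
    (hF : ∀ u ∈ Metric.ball z r, ContDiffAt ℂ 2 F u) (hM : ∀ u ∈ Metric.ball z r, ‖F u‖ ≤ M) :
    ‖fderiv ℂ (fun u => fderiv ℂ (taylorRem F z) u u) z‖ ≤
      64 * M * (‖z‖ + r) / r ^ 2 := by
  have hFd : DifferentiableOn ℂ F (Metric.ball z r) := fun w hw =>
    ((hF w hw).differentiableAt (by simp)).differentiableWithinAt
  have hM0 : 0 ≤ M := (norm_nonneg _).trans (hM z (Metric.mem_ball_self hr))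
  have hr2 : 0 < r / 2 := half_pos hr
  -- two Cauchy estimates, on balls of radius `r / 2`
  have hsub : ∀ u ∈ Metric.ball z (r / 2), Metric.ball u (r / 2) ⊆ Metric.ball z r := by
    intro u hu w hw
    rw [Metric.mem_ball] at *
    linarith [dist_triangle w u z]
  have hd : ∀ u ∈ Metric.ball z r, DifferentiableAt ℂ (taylorRem F z) u := fun u hu =>
    (contDiffAt_taylorRem (hF u hu)).differentiableAt (by simp)
  have h1 : ∀ u ∈ Metric.ball z (r / 2), ‖fderiv ℂ (taylorRem F z) u‖ ≤
      2 * (4 * M) / (r / 2) := fun u hu =>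
    norm_fderiv_le_of_bound hr2 (fun w hw => (hd w (hsub u hu hw)).differentiableWithinAt)
      fun w hw => norm_taylorRem_le_const hr hFd hM (hsub u hu hw)
  have h2 := norm_fderiv_le_of_bound (F := fun u => fderiv ℂ (taylorRem F z) u u) (z := z)
    (M := 2 * (4 * M) / (r / 2) * (‖z‖ + r)) hr2 (fun u hu => by
      have hu' : u ∈ Metric.ball z r := Metric.ball_subset_ball (by linarith) hu
      have h3 : ContDiffAt ℂ 1 (fderiv ℂ (taylorRem F z)) u :=
        (contDiffAt_taylorRem (hF u hu')).fderiv_right (by norm_num)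
      exact ((h3.differentiableAt (by simp)).clm_apply differentiableAt_id).differentiableWithinAt)
    (fun u hu => by
      have h3 : ‖u‖ ≤ ‖z‖ + r := by
        have := mem_ball_iff_norm.1 hu
        linarith [norm_le_norm_add_norm_sub z u, norm_sub_rev z u]
      exact (ContinuousLinearMap.le_opNorm _ _).trans
        (mul_le_mul (h1 u hu) h3 (norm_nonneg _) (by positivity)))
  refine h2.trans (le_of_eq ?_)
  field_simp
  ring

end

/-! ### Lower bounds and exponentially small terms -/

theorem eventually_pos : ∀ᶠ ħ : ℝ in 𝓝[>] 0, 0 < ħ := self_mem_nhdsWithin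

theorem eventually_le {a : ℝ} (ha : 0 < a) : ∀ᶠ ħ : ℝ in 𝓝[>] 0, ħ ≤ a := by
  filter_upwards [Ioc_mem_nhdsGT ha] with ħ h using h.2

theorem exists_between_theta {θ : ℝ} (hθ : θ < 1) : ∃ η, 0 < η ∧ η < 1 ∧ θ < η :=
  ⟨(1 + max θ 0) / 2, by positivity, by
    have : max θ 0 < 1 := max_lt hθ one_pos
    linarith, by
    have : max θ 0 < 1 := max_lt hθ one_pos
    have := le_max_left θ 0
    linarith⟩

/-- Near `u = z`, the kernel `T(u, z)` is almost as large as `T(z, z) ^ (1/2)`. -/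
theorem eventually_exp_le_norm_kernelT {n : ℕ} {p : ℝ} (hp : -(n : ℝ) < p) {z : Cn n}
    (hz : z ≠ 0) {θ : ℝ} (hθ : θ < 1) : ∀ᶠ ħ : ℝ in 𝓝[>] 0, ∀ u ∈ Metric.ball z (‖z‖ / 2),
      Real.exp (θ * ‖z‖ / ħ) ≤ ‖kernelT n p ħ u z‖ := by
  have hb := add_pos_of_neg_lt hp
  obtain ⟨η, hη0, hη1, hθη⟩ := exists_between_theta hθ
  obtain ⟨c, hc, hcT⟩ := exists_le_thetaR hb hη0 hη1
  have hz' : 0 < ‖z‖ := norm_pos_iff.2 hz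
  have hlim : Tendsto (fun ħ : ℝ => (η - θ) * ‖z‖ * ħ⁻¹) (𝓝[>] 0) atTop :=
    tendsto_inv_nhdsGT_zero.const_mul_atTop (mul_pos (sub_pos.2 hθη) hz')
  filter_upwards [eventually_pos, hlim.eventually_ge_atTop (-Real.log c)] with ħ hħ hbig u hu
  -- on this ball `Re (u ⬝ z) ≥ |z|² / 2`; the weaker bound `|z|² / 4` suffices, because
  -- `₀F₁(b; y²)` grows like `exp (2 y)` and `2 y = |z| / ħ` for `y = |z| / (2 ħ)`
  have hre : (‖z‖ / 2) ^ 2 ≤ (cdot u z).re := by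
    have h1 : cdot u z = cdot z z + cdot (u - z) z := by
      rw [cdot_sub_left]
      ring
    have h2 : ‖cdot (u - z) z‖ ≤ ‖z‖ / 2 * ‖z‖ :=
      (norm_cdot_le _ _).trans
        (mul_le_mul_of_nonneg_right (mem_ball_iff_norm.1 hu).le (norm_nonneg _))
    have h3 := (abs_le.1 (Complex.abs_re_le_norm (cdot (u - z) z))).1
    rw [h1, Complex.add_re, cdot_self, Complex.ofReal_re]
    nlinarith
  have hre' : (cdot u z / (ħ : ℂ) ^ 2).re = (cdot u z).re / ħ ^ 2 := by
    rw [← Complex.ofReal_pow, Complex.div_ofReal_re]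
  have h4 : ((‖z‖ / 2) / ħ) ^ 2 ≤ (cdot u z / (ħ : ℂ) ^ 2).re := by
    rw [hre', div_pow]
    gcongr
  have h5 := norm_theta_re_le hb (cdot u z / (ħ : ℂ) ^ 2)
  have h6 := thetaR_mono hb (by positivity) h4
  rw [theta_ofReal, Complex.norm_real, Real.norm_of_nonneg
    ((zero_le_one.trans (one_le_thetaR_sq hb _)).trans h6)] at h5
  rw [kernelT_eq]
  refine le_trans ?_ ((hcT _).trans (h6.trans h5))
  rw [← Real.exp_log hc, ← Real.exp_add]
  refine Real.exp_le_exp.2 ?_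
  have e1 : 2 * η * (‖z‖ / 2 / ħ) = (η - θ) * ‖z‖ * ħ⁻¹ + θ * ‖z‖ / ħ := by
    field_simp
    ring
  rw [e1]
  linarith

theorem exp_neg_div_le {a ħ : ℝ} (ha : 0 < a) (hħ : 0 < ħ) :
    Real.exp (-(a / ħ)) ≤ 2 / a ^ 2 * ħ ^ 2 := by
  have h1 : (a / ħ) ^ 2 / 2 ≤ Real.exp (a / ħ) := by
    have := Real.pow_div_factorial_le_exp (a / ħ) (by positivity) 2
    simpa using this
  rw [Real.exp_neg, inv_le_comm₀ (Real.exp_pos _) (by positivity)]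
  refine le_trans (le_of_eq ?_) h1
  field_simp

/-- The error terms `exp (2 θ r / ħ)` and `exp (-1 / ħ)` are `O(ħ²)` relative to `T(z, z)`, `|z| = r`. -/
theorem exists_exp_le_thetaR {b : ℝ} (hb : 0 < b) {r : ℝ} (hr : 0 < r) {θ : ℝ} (hθ : θ < 1) :
    ∃ K, 0 ≤ K ∧ ∀ ħ : ℝ, 0 < ħ → Real.exp (2 * (θ * r / ħ)) + Real.exp (-(1 / ħ)) ≤
      K * ħ ^ 2 * thetaR b ((r / ħ) ^ 2) := by
  obtain ⟨η, hη0, hη1, hθη⟩ := exists_between_theta hθ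
  obtain ⟨c, hc, hcT⟩ := exists_le_thetaR hb hη0 hη1
  have ha : 0 < 2 * (η - θ) * r := mul_pos (mul_pos two_pos (sub_pos.2 hθη)) hr
  refine ⟨2 / (2 * (η - θ) * r) ^ 2 / c + 2, by positivity, fun ħ hħ => ?_⟩
  have h1 := exp_neg_div_le ha hħ
  have h2 := exp_neg_div_le one_pos hħ
  have h3 := hcT (r / ħ)
  have h4 := one_le_thetaR_sq hb (r / ħ)
  have h5 : Real.exp (2 * (θ * r / ħ)) =
      Real.exp (-(2 * (η - θ) * r / ħ)) * Real.exp (2 * η * (r / ħ)) := by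
    rw [← Real.exp_add]
    congr 1
    field_simp
    ring
  have h6 : Real.exp (2 * η * (r / ħ)) ≤ thetaR b ((r / ħ) ^ 2) / c := by
    rw [le_div_iff₀ hc]
    linarith
  have h7 : Real.exp (2 * (θ * r / ħ)) ≤
      2 / (2 * (η - θ) * r) ^ 2 * ħ ^ 2 * (thetaR b ((r / ħ) ^ 2) / c) := by
    rw [h5]
    exact mul_le_mul h1 h6 (Real.exp_pos _).le (by positivity)
  have h8 : Real.exp (-(1 / ħ)) ≤ 2 * ħ ^ 2 * thetaR b ((r / ħ) ^ 2) := by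
    refine h2.trans ?_
    rw [one_pow, div_one]
    exact le_mul_of_one_le_right (by positivity) h4
  refine (add_le_add h7 h8).trans (le_of_eq ?_)
  ring

/-! ### The remainder estimate -/

theorem integrable_exp_norm {n : ℕ} (hn : 0 < n) {p ħ : ℝ} (hp : -(n : ℝ) < p) (hħ : 0 < ħ) :
    Integrable (fun u : Cn n => Real.exp (‖u‖ / ħ)) (mMeasure n p ħ) ∧
      ∫ u : Cn n, Real.exp (‖u‖ / ħ) ∂mMeasure n p ħ ≤ 2 ^ n * 2 ^ ((n : ℝ) + p) := by
  have h0 := lintegral_mMeasure_exp_le hn hp hħ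
  have hc : Continuous fun u : Cn n => Real.exp (‖u‖ / ħ) := by fun_prop
  refine ⟨⟨hc.aestronglyMeasurable, ?_⟩, ?_⟩
  · rw [hasFiniteIntegral_iff_ofReal (ae_of_all _ fun u => by positivity)]
    exact h0.trans_lt ENNReal.ofReal_lt_top
  · rw [integral_eq_lintegral_of_nonneg_ae (ae_of_all _ fun u => by positivity)
      hc.aestronglyMeasurable]
    exact ENNReal.toReal_le_of_le_ofReal (by positivity) h0

theorem norm_sq_eq_integral {n : ℕ} (hn : 0 < n) {p ħ : ℝ} (hp : -(n : ℝ) < p) (hħ : 0 < ħ)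
    {h : L2Sph n} (hh : h ∈ cohSpan n p ħ) :
    ‖h‖ ^ 2 = ∫ u, ‖transform n p ħ h u‖ ^ 2 ∂mMeasure n p ħ := by
  have h1 := integral_transform hn hp hħ hh hh
  have h2 : ∀ u, (starRingEnd ℂ) (transform n p ħ h u) * transform n p ħ h u =
      ((‖transform n p ħ h u‖ ^ 2 : ℝ) : ℂ) := fun u => by
    rw [Complex.conj_mul']
    push_cast
    rfl
  simp only [h2] at h1
  rw [integral_complex_ofReal, inner_self_eq_norm_sq_to_K] at h1
  refine (Complex.ofReal_injective (h1.trans ?_)).symm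
  simp

/-- The growth condition on the transform `h` of a vector, relative to the kernel `T(·, z)`. -/
def KernelGrowth (n : ℕ) (p ħ : ℝ) (z : Cn n) (C θ : ℝ) (h : L2Sph n) : Prop :=
  ∀ u, kernelT n p ħ u z ≠ 0 → ‖transform n p ħ h u‖ ≤
    C * Real.exp (C * ‖u‖) * (‖kernelT n p ħ u z‖ + Real.exp (θ * ‖z‖ / ħ))

/-- Away from `z`, a function growing at most exponentially relative to `T(·, z)` is dominated by
`|u - z| ⁴ |T(u, z)|²` and an exponentially small multiple of `exp (|u| / ħ)`. -/
theorem exists_far_bound {n : ℕ} {p : ℝ} (hp : -(n : ℝ) < p) {z : Cn n} (hz : z ≠ 0) {D B : ℝ}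
    (hD : 0 ≤ D) (hB : 0 ≤ B) (θ : ℝ) : ∃ K, 0 ≤ K ∧ ∀ᶠ ħ : ℝ in 𝓝[>] 0, ∀ u : Cn n,
      u ∉ Metric.ball z (‖z‖ / 2) →
      B * Real.exp (D * ‖u‖) * (‖kernelT n p ħ u z‖ ^ 2 + Real.exp (2 * (θ * ‖z‖ / ħ))) ≤
        K * (‖u - z‖ ^ 4 * ‖kernelT n p ħ u z‖ ^ 2) +
        B * (Real.exp (2 * (θ * ‖z‖ / ħ)) + Real.exp (-(1 / ħ))) * Real.exp (‖u‖ / ħ) := by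
  have hb := add_pos_of_neg_lt hp
  have hz' : 0 < ‖z‖ := norm_pos_iff.2 hz
  have hβ : 0 < (min ((n : ℝ) + p) 1)⁻¹ := inv_pos.2 (lt_min hb one_pos)
  set β := (min ((n : ℝ) + p) 1)⁻¹ with hβd
  set R : ℝ := 2 + 32 * β * ‖z‖ with hR
  refine ⟨B * Real.exp (D * R) / (‖z‖ / 2) ^ 4, by positivity, ?_⟩
  have hD4 : (0 : ℝ) < 1 / (4 * (D + 1)) := by positivity
  filter_upwards [eventually_pos, eventually_le hD4] with ħ hħ hħD u hu
  have hDħ : D * ‖u‖ ≤ ‖u‖ / (4 * ħ) := by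
    rw [le_div_iff₀ (by positivity)]
    have h1 : ħ * (4 * (D + 1)) ≤ 1 := by
      rwa [le_div_iff₀ (by positivity)] at hħD
    have h2 : D * (4 * ħ) ≤ 1 := by nlinarith
    nlinarith [norm_nonneg u]
  have hDħ' : D * ‖u‖ ≤ ‖u‖ / ħ := hDħ.trans
    (div_le_div_of_nonneg_left (norm_nonneg _) hħ (by linarith))
  have hd : ‖z‖ / 2 ≤ ‖u - z‖ := not_lt.1 fun h => hu (mem_ball_iff_norm.2 h)
  set T := ‖kernelT n p ħ u z‖ with hT
  have hT0 : 0 ≤ T := norm_nonneg _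
  set E := Real.exp (2 * (θ * ‖z‖ / ħ)) with hE
  have hE0 : 0 < E := Real.exp_pos _
  have h1 : B * Real.exp (D * ‖u‖) * E ≤ B * E * Real.exp (‖u‖ / ħ) := by
    rw [mul_right_comm]
    exact mul_le_mul_of_nonneg_left (Real.exp_le_exp.2 hDħ') (by positivity)
  have h2 : B * Real.exp (D * ‖u‖) * T ^ 2 ≤
      B * Real.exp (D * R) / (‖z‖ / 2) ^ 4 * (‖u - z‖ ^ 4 * T ^ 2) +
        B * Real.exp (-(1 / ħ)) * Real.exp (‖u‖ / ħ) := by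
    rcases le_or_gt ‖u‖ R with hle | hgt
    · have h3 : B * Real.exp (D * ‖u‖) * T ^ 2 ≤
          B * Real.exp (D * R) / (‖z‖ / 2) ^ 4 * (‖u - z‖ ^ 4 * T ^ 2) := by
        calc B * Real.exp (D * ‖u‖) * T ^ 2 ≤ B * Real.exp (D * R) * T ^ 2 := by gcongr
          _ = B * Real.exp (D * R) / (‖z‖ / 2) ^ 4 * ((‖z‖ / 2) ^ 4 * T ^ 2) := by field_simp
          _ ≤ _ := by gcongr
      have h4 : 0 ≤ B * Real.exp (-(1 / ħ)) * Real.exp (‖u‖ / ħ) := by positivity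
      linarith
    · have h3 : T ≤ Real.exp (1 / 8 * ‖u‖ / ħ + β * (‖z‖ / (1 / 8 * ħ))) :=
        norm_kernelT_le hp hħ (by norm_num) u z
      have h4 : Real.exp (D * ‖u‖) * T ^ 2 ≤ Real.exp (-(1 / ħ)) * Real.exp (‖u‖ / ħ) := by
        have h5 := pow_le_pow_left₀ hT0 h3 2
        rw [← Real.exp_nat_mul] at h5
        refine (mul_le_mul (Real.exp_le_exp.2 hDħ) h5 (by positivity) (by positivity)).trans ?_
        rw [← Real.exp_add, ← Real.exp_add]
        refine Real.exp_le_exp.2 ?_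
        have h6 : ‖u‖ / (4 * ħ) + ((2 : ℕ) : ℝ) * (1 / 8 * ‖u‖ / ħ + β * (‖z‖ / (1 / 8 * ħ))) =
            (‖u‖ / 2 + 16 * β * ‖z‖) / ħ := by
          push_cast
          field_simp
          ring
        rw [h6, ← sub_nonneg]
        have h7 : -(1 / ħ) + ‖u‖ / ħ - (‖u‖ / 2 + 16 * β * ‖z‖) / ħ =
            (‖u‖ - R) / 2 / ħ := by
          rw [hR]
          field_simp
          ring
        rw [h7]
        have : 0 < ‖u‖ - R := sub_pos.2 hgt
        positivity
      have h5 : 0 ≤ B * Real.exp (D * R) / (‖z‖ / 2) ^ 4 * (‖u - z‖ ^ 4 * T ^ 2) := by positivity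
      have h6 := mul_le_mul_of_nonneg_left h4 hB
      linarith
  calc _ = B * Real.exp (D * ‖u‖) * T ^ 2 + B * Real.exp (D * ‖u‖) * E := by ring
    _ ≤ _ := add_le_add h2 h1
    _ = _ := by ring

/-- A pointwise bound of the transform by `|u - z|² |T(u, z)|` and an exponentially small term gives
a bound of the norm, by the fourth moment estimate for `|T(u, z)|²`. -/
theorem exists_norm_sq_le {n : ℕ} (hn : 0 < n) {p : ℝ} (hp : -(n : ℝ) < p) {z : Cn n} (hz : z ≠ 0)
    {θ : ℝ} (hθ : θ < 1) {K₁ K₂ : ℝ} (hK₁ : 0 ≤ K₁) (hK₂ : 0 ≤ K₂) :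
    ∃ K, 0 ≤ K ∧ ∀ᶠ ħ : ℝ in 𝓝[>] 0, ∀ h ∈ cohSpan n p ħ,
      (∀ u, kernelT n p ħ u z ≠ 0 → ‖transform n p ħ h u‖ ^ 2 ≤
        K₁ * (‖u - z‖ ^ 4 * ‖kernelT n p ħ u z‖ ^ 2) +
        K₂ * (Real.exp (2 * (θ * ‖z‖ / ħ)) + Real.exp (-(1 / ħ))) * Real.exp (‖u‖ / ħ)) →
      ‖h‖ ^ 2 ≤ K * ħ ^ 2 * thetaR (n + p) ((‖z‖ / ħ) ^ 2) := by
  have hz' : 0 < ‖z‖ := norm_pos_iff.2 hz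
  obtain ⟨A, hA0, hA⟩ := exists_integral_norm_sub_pow_four_le hn hp
  obtain ⟨L, hL0, hL⟩ := exists_exp_le_thetaR (add_pos_of_neg_lt hp) hz' hθ
  refine ⟨K₁ * (A * ‖z‖ ^ 2) + K₂ * L * (2 ^ n * 2 ^ ((n : ℝ) + p)), by positivity, ?_⟩
  filter_upwards [eventually_pos, eventually_le hz'] with ħ hħ hħz h hh hbound
  obtain ⟨hi1, hI1⟩ := hA ħ hħ z hħz
  obtain ⟨hi2, hI2⟩ := integrable_exp_norm hn hp hħ
  set ε := Real.exp (2 * (θ * ‖z‖ / ħ)) + Real.exp (-(1 / ħ)) with hε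
  have hε0 : 0 ≤ ε := by positivity
  rw [norm_sq_eq_integral hn hp hħ hh]
  calc _ ≤ ∫ u, (K₁ * (‖u - z‖ ^ 4 * ‖kernelT n p ħ u z‖ ^ 2) +
        K₂ * ε * Real.exp (‖u‖ / ħ)) ∂mMeasure n p ħ := by
        refine integral_mono_ae ((memLp_two_iff_integrable_sq_norm
          (memLp_transform_of_mem_cohSpan hn hp hħ hh).1).1
          (memLp_transform_of_mem_cohSpan hn hp hħ hh))
          ((hi1.const_mul K₁).add (hi2.const_mul (K₂ * ε))) ?_
        filter_upwards [ae_kernelT_ne_zero hp z] with u hu using hbound u hu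
    _ = K₁ * ∫ u, ‖u - z‖ ^ 4 * ‖kernelT n p ħ u z‖ ^ 2 ∂mMeasure n p ħ +
        K₂ * ε * ∫ u : Cn n, Real.exp (‖u‖ / ħ) ∂mMeasure n p ħ := by
        rw [integral_add (hi1.const_mul K₁) (hi2.const_mul (K₂ * ε)), integral_const_mul,
          integral_const_mul]
    _ ≤ K₁ * (A * ħ ^ 2 * ‖z‖ ^ 2 * thetaR (n + p) ((‖z‖ / ħ) ^ 2)) +
        K₂ * (L * ħ ^ 2 * thetaR (n + p) ((‖z‖ / ħ) ^ 2)) * (2 ^ n * 2 ^ ((n : ℝ) + p)) := by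
        have h1 := hL ħ hħ
        refine add_le_add (mul_le_mul_of_nonneg_left hI1 hK₁) ?_
        exact mul_le_mul (mul_le_mul_of_nonneg_left h1 hK₂) hI2
          (integral_nonneg fun u => by positivity)
          (mul_nonneg hK₂ (hε0.trans h1))
    _ = _ := by ring

/-- The quotient of the transform of `h` by the kernel `T(·, z)`. -/
def symbolFun (n : ℕ) (p ħ : ℝ) (h : L2Sph n) (z u : Cn n) : ℂ :=
  transform n p ħ h u / kernelT n p ħ u z

theorem contDiff_kernelT_left {n : ℕ} (hn : 0 < n) {p ħ : ℝ} (hp : -(n : ℝ) < p) (hħ : 0 < ħ)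
    (z : Cn n) : ContDiff ℂ ⊤ fun u => kernelT n p ħ u z := by
  rw [← transform_cohL2' hn hp hħ]
  exact contDiff_transform n p ħ _

theorem contDiffAt_symbolFun {n : ℕ} (hn : 0 < n) {p ħ : ℝ} (hp : -(n : ℝ) < p) (hħ : 0 < ħ)
    (h : L2Sph n) {z u : Cn n} (hu : kernelT n p ħ u z ≠ 0) :
    ContDiffAt ℂ 2 (symbolFun n p ħ h z) u :=
  ((contDiff_transform n p ħ h).of_le le_top).contDiffAt.div
    ((contDiff_kernelT_left hn hp hħ z).of_le le_top).contDiffAt hu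

/-- Near `z`, the growth condition gives uniform bounds. -/
theorem eventually_symbolFun_le {n : ℕ} {p : ℝ} (hp : -(n : ℝ) < p) {z : Cn n}
    (hz : z ≠ 0) {C θ : ℝ} (hC : 0 ≤ C) (hθ : θ < 1) : ∀ᶠ ħ : ℝ in 𝓝[>] 0, ∀ h,
      KernelGrowth n p ħ z C θ h → ∀ u ∈ Metric.ball z (‖z‖ / 2),
        kernelT n p ħ u z ≠ 0 ∧
          ‖symbolFun n p ħ h z u‖ ≤ 2 * C * Real.exp (C * (2 * ‖z‖)) := by
  filter_upwards [eventually_exp_le_norm_kernelT hp hz hθ] with ħ hT h hh u hu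
  have h1 := hT u hu
  have h2 : 0 < ‖kernelT n p ħ u z‖ := (Real.exp_pos _).trans_le h1
  have h3 : kernelT n p ħ u z ≠ 0 := norm_pos_iff.1 h2
  refine ⟨h3, ?_⟩
  have hu' : ‖u‖ ≤ 2 * ‖z‖ := by
    have := mem_ball_iff_norm.1 hu
    have := norm_le_norm_add_norm_sub z u
    rw [norm_sub_rev] at this
    linarith [norm_nonneg z]
  rw [symbolFun, norm_div, div_le_iff₀ h2]
  calc _ ≤ C * Real.exp (C * ‖u‖) * (‖kernelT n p ħ u z‖ + Real.exp (θ * ‖z‖ / ħ)) := hh u h3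
    _ ≤ C * Real.exp (C * (2 * ‖z‖)) * (‖kernelT n p ħ u z‖ + ‖kernelT n p ħ u z‖) := by
      gcongr
    _ = _ := by ring

/-- The gradient of a function at `z`: the vector `a` with `dF(z) v = v ⬝ a`. -/
def gradAt {n : ℕ} (F : Cn n → ℂ) (z : Cn n) : Cn n :=
  (InnerProductSpace.toDual ℂ (Cn n)).symm (fderiv ℂ F z)

theorem cdot_gradAt {n : ℕ} (F : Cn n → ℂ) (z v : Cn n) :
    cdot v (gradAt F z) = fderiv ℂ F z v := by
  rw [cdot_eq_inner, gradAt, InnerProductSpace.toDual_symm_apply]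

theorem norm_gradAt {n : ℕ} (F : Cn n → ℂ) (z : Cn n) : ‖gradAt F z‖ = ‖fderiv ℂ F z‖ := by
  rw [gradAt, LinearIsometryEquiv.norm_map]

/-- The condition on a vector `r` that its transform is the remainder of the first order Taylor expansion, at `z`, of the
transform of `h` relative to the kernel `T(·, z)`. -/
def IsRemainder (n : ℕ) (p ħ : ℝ) (z : Cn n) (h r : L2Sph n) : Prop :=
  ∀ u, transform n p ħ r u = transform n p ħ h u - (symbolFun n p ħ h z z +
    cdot (u - z) (gradAt (symbolFun n p ħ h z) z)) * kernelT n p ħ u z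

theorem IsRemainder.transform_eq {n : ℕ} {p ħ : ℝ} {z : Cn n} {h r : L2Sph n}
    (hr : IsRemainder n p ħ z h r) {u : Cn n} (hu : kernelT n p ħ u z ≠ 0) :
    transform n p ħ r u = taylorRem (symbolFun n p ħ h z) z u * kernelT n p ħ u z := by
  rw [hr u, taylorRem, cdot_gradAt]
  have : transform n p ħ h u = symbolFun n p ħ h z u * kernelT n p ħ u z := by
    rw [symbolFun, div_mul_cancel₀ _ hu]
  rw [this]
  ring

/-- The remainder grows no faster than the vector itself, up to constants. -/
theorem norm_sq_transform_remainder_le {n : ℕ} {p ħ : ℝ} {z : Cn n} {h r : L2Sph n}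
    {C θ M M' C₃ : ℝ} (hC : 0 ≤ C) (hM : 0 ≤ M) (hM' : 0 ≤ M') (hh : KernelGrowth n p ħ z C θ h)
    (hrem : IsRemainder n p ħ z h r) (h4 : ‖symbolFun n p ħ h z z‖ ≤ M)
    (h5 : ‖gradAt (symbolFun n p ħ h z) z‖ ≤ M') (hC₃ : C + (M + M' * ‖z‖ + M') + 1 ≤ C₃)
    {u : Cn n} (hu : kernelT n p ħ u z ≠ 0) :
    ‖transform n p ħ r u‖ ^ 2 ≤ 2 * C₃ ^ 2 * Real.exp (2 * C₃ * ‖u‖) *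
        (‖kernelT n p ħ u z‖ ^ 2 + Real.exp (2 * (θ * ‖z‖ / ħ))) := by
  have hN : 0 ≤ M + M' * ‖z‖ + M' := by positivity
  have hC₃1 : 1 ≤ C₃ := by linarith
  have hC₃C : C ≤ C₃ := by linarith
  have hsum : C + (M + M' * ‖z‖ + M') ≤ C₃ := by linarith
  have h6 : ‖symbolFun n p ħ h z z + cdot (u - z) (gradAt (symbolFun n p ħ h z) z)‖ ≤
      (M + M' * ‖z‖ + M') * Real.exp (C₃ * ‖u‖) := by
    have h7 : ‖u - z‖ ≤ ‖u‖ + ‖z‖ := norm_sub_le _ _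
    have h8 : ‖cdot (u - z) (gradAt (symbolFun n p ħ h z) z)‖ ≤ (‖u‖ + ‖z‖) * M' :=
      (norm_cdot_le _ _).trans (mul_le_mul h7 h5 (norm_nonneg _) (by positivity))
    have h9 : ‖u‖ + 1 ≤ Real.exp (C₃ * ‖u‖) := by
      have h10 := Real.add_one_le_exp (C₃ * ‖u‖)
      have h11 : ‖u‖ ≤ C₃ * ‖u‖ := le_mul_of_one_le_left (norm_nonneg _) hC₃1
      linarith
    calc _ ≤ M + (‖u‖ + ‖z‖) * M' := (norm_add_le _ _).trans (add_le_add h4 h8)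
      _ ≤ (M + M' * ‖z‖ + M') * (‖u‖ + 1) := by
        have h12 : 0 ≤ M * ‖u‖ := by positivity
        have h13 : 0 ≤ M' * ‖z‖ * ‖u‖ := by positivity
        linarith
      _ ≤ _ := mul_le_mul_of_nonneg_left h9 hN
  have h7 := (hh u hu)
  have h8 := hrem u
  generalize kernelT n p ħ u z = k at *
  generalize symbolFun n p ħ h z z + cdot (u - z) (gradAt (symbolFun n p ħ h z) z) = q at *
  generalize M + M' * ‖z‖ + M' = N at *
  set E := Real.exp (θ * ‖z‖ / ħ) with hE
  have hE0 : 0 < E := Real.exp_pos _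
  have h7' : ‖transform n p ħ h u‖ ≤ C * Real.exp (C₃ * ‖u‖) * (‖k‖ + E) := by
    refine h7.trans ?_
    gcongr
  have h9 : ‖transform n p ħ r u‖ ≤ C₃ * Real.exp (C₃ * ‖u‖) * (‖k‖ + E) := by
    rw [h8]
    refine (norm_sub_le _ _).trans ?_
    rw [norm_mul]
    have h9 : ‖q‖ * ‖k‖ ≤ N * Real.exp (C₃ * ‖u‖) * (‖k‖ + E) :=
      mul_le_mul h6 (le_add_of_nonneg_right hE0.le) (norm_nonneg _) (by positivity)
    calc _ ≤ (C + N) * (Real.exp (C₃ * ‖u‖) * (‖k‖ + E)) := by linarith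
      _ ≤ C₃ * (Real.exp (C₃ * ‖u‖) * (‖k‖ + E)) :=
        mul_le_mul_of_nonneg_right hsum (by positivity)
      _ = _ := by ring
  refine (pow_le_pow_left₀ (norm_nonneg _) h9 2).trans ?_
  have h10 : Real.exp (2 * C₃ * ‖u‖) = Real.exp (C₃ * ‖u‖) ^ 2 := by
    rw [← Real.exp_nat_mul]
    congr 1
    push_cast
    ring
  have h11 : Real.exp (2 * (θ * ‖z‖ / ħ)) = E ^ 2 := by
    rw [hE, ← Real.exp_nat_mul]
    congr 1
  rw [h10, h11, mul_pow, mul_pow]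
  have h12 : (‖k‖ + E) ^ 2 ≤ 2 * (‖k‖ ^ 2 + E ^ 2) := by
    linarith [sq_nonneg (‖k‖ - E)]
  calc _ ≤ C₃ ^ 2 * Real.exp (C₃ * ‖u‖) ^ 2 * (2 * (‖k‖ ^ 2 + E ^ 2)) := by gcongr
    _ = _ := by ring

/-- The remainder of the first order expansion has norm `O(ħ)` relative to `K(·, z)`. -/
theorem exists_norm_sq_remainder_le {n : ℕ} (hn : 0 < n) {p : ℝ} (hp : -(n : ℝ) < p) {z : Cn n}
    (hz : z ≠ 0) {C θ : ℝ} (hC : 0 ≤ C) (hθ : θ < 1) : ∃ K, 0 ≤ K ∧ ∀ᶠ ħ : ℝ in 𝓝[>] 0,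
      ∀ h, KernelGrowth n p ħ z C θ h → ∀ r ∈ cohSpan n p ħ, IsRemainder n p ħ z h r →
        ‖r‖ ^ 2 ≤ K * ħ ^ 2 * thetaR (n + p) ((‖z‖ / ħ) ^ 2) := by
  have hz' : 0 < ‖z‖ := norm_pos_iff.2 hz
  have hz2 : 0 < ‖z‖ / 2 := half_pos hz'
  set M : ℝ := 2 * C * Real.exp (C * (2 * ‖z‖)) with hM
  have hM0 : 0 ≤ M := by positivity
  set M' : ℝ := 2 * M / (‖z‖ / 2) with hM'
  have hM'0 : 0 ≤ M' := by positivity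
  set C₃ : ℝ := C + (M + M' * ‖z‖ + M') + 1 with hC₃
  have hC₃0 : 0 ≤ C₃ := by positivity
  obtain ⟨K₁, hK₁, hfar⟩ := exists_far_bound hp hz (D := 2 * C₃) (B := 2 * C₃ ^ 2) (by positivity)
    (by positivity) θ
  obtain ⟨K, hK, hfinal⟩ := exists_norm_sq_le hn hp hz hθ
    (K₁ := K₁ + (4 * M / (‖z‖ / 2) ^ 2) ^ 2) (K₂ := 2 * C₃ ^ 2) (by positivity) (by positivity)
  refine ⟨K, hK, ?_⟩
  filter_upwards [eventually_pos, hfar, hfinal, eventually_symbolFun_le hp hz hC hθ] with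
    ħ hħ hfar hfinal hloc h hh r hr hrem
  have hloc : ∀ u ∈ Metric.ball z (‖z‖ / 2),
      kernelT n p ħ u z ≠ 0 ∧ ‖symbolFun n p ħ h z u‖ ≤ M := hloc h hh
  have hcd : ∀ u ∈ Metric.ball z (‖z‖ / 2), ContDiffAt ℂ 2 (symbolFun n p ħ h z) u :=
    fun u hu => contDiffAt_symbolFun hn hp hħ h (hloc u hu).1
  have hdiff : DifferentiableOn ℂ (symbolFun n p ħ h z) (Metric.ball z (‖z‖ / 2)) := fun u hu =>
    ((hcd u hu).differentiableAt (by simp)).differentiableWithinAt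
  refine hfinal r hr fun u hu => ?_
  set ε := Real.exp (2 * (θ * ‖z‖ / ħ)) + Real.exp (-(1 / ħ)) with hε
  have hε0 : 0 ≤ ε := by positivity
  set T := ‖kernelT n p ħ u z‖ with hT
  by_cases hball : u ∈ Metric.ball z (‖z‖ / 2)
  · have h1 := norm_taylorRem_le hz2 hdiff (fun w hw => (hloc w hw).2) hball
    have h2 : ‖transform n p ħ r u‖ ^ 2 ≤
        (4 * M / (‖z‖ / 2) ^ 2) ^ 2 * (‖u - z‖ ^ 4 * T ^ 2) := by
      rw [hrem.transform_eq hu, norm_mul, mul_pow]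
      calc _ ≤ (4 * M * (‖u - z‖ / (‖z‖ / 2)) ^ 2) ^ 2 * T ^ 2 := by gcongr
        _ = _ := by
          rw [div_pow]
          ring
    have h3 : 0 ≤ K₁ * (‖u - z‖ ^ 4 * T ^ 2) := by positivity
    have h4 : 0 ≤ 2 * C₃ ^ 2 * ε * Real.exp (‖u‖ / ħ) := by positivity
    linarith
  · have h1 := hfar u hball
    have h3 : 0 ≤ (4 * M / (‖z‖ / 2) ^ 2) ^ 2 * (‖u - z‖ ^ 4 * T ^ 2) := by positivity
    have hzb := Metric.mem_ball_self (x := z) hz2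
    have h5 : ‖gradAt (symbolFun n p ħ h z) z‖ ≤ M' := by
      rw [norm_gradAt]
      exact norm_fderiv_le_of_bound hz2 hdiff fun w hw => (hloc w hw).2
    have h2 := norm_sq_transform_remainder_le hC hM0 hM'0 hh hrem (hloc z hzb).2 h5 hC₃.ge hu
    linarith

/-- The remainder is almost orthogonal to the gradient vectors: its inner products with them are `ħ²`
times the derivatives bounded here. -/
theorem exists_inner_gradient_remainder_le {n : ℕ} (hn : 0 < n) {p : ℝ} (hp : -(n : ℝ) < p)
    {z : Cn n} (hz : z ≠ 0) {C θ : ℝ} (hC : 0 ≤ C) (hθ : θ < 1) :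
    ∃ K, 0 ≤ K ∧ ∀ᶠ ħ : ℝ in 𝓝[>] 0, ∀ h, KernelGrowth n p ħ z C θ h →
      ‖symbolFun n p ħ h z z‖ ≤ K ∧ ‖gradAt (symbolFun n p ħ h z) z‖ ≤ K ∧
      ∀ r, IsRemainder n p ħ z h r → ∀ c,
        ‖fderiv ℂ (radialOp (n + p) (transform n p ħ r)) z c‖ ≤
          K * ‖c‖ * thetaR (n + p) ((‖z‖ / ħ) ^ 2) := by
  have hz' : 0 < ‖z‖ := norm_pos_iff.2 hz
  have hz2 : 0 < ‖z‖ / 2 := half_pos hz'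
  set M : ℝ := 2 * C * Real.exp (C * (2 * ‖z‖)) with hM
  have hM0 : 0 ≤ M := by positivity
  set K₁ := 2 * M / (‖z‖ / 2)
  set K₂ := 64 * M * (‖z‖ + ‖z‖ / 2) / (‖z‖ / 2) ^ 2
  have hK₁ : 0 ≤ K₁ := by positivity
  have hK₂ : 0 ≤ K₂ := by positivity
  refine ⟨M + K₁ + K₂, by positivity, ?_⟩
  filter_upwards [eventually_pos, eventually_symbolFun_le hp hz hC hθ] with ħ hħ hloc h hh
  have hloc : ∀ u ∈ Metric.ball z (‖z‖ / 2),
      kernelT n p ħ u z ≠ 0 ∧ ‖symbolFun n p ħ h z u‖ ≤ M := hloc h hh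
  have hcd : ∀ u ∈ Metric.ball z (‖z‖ / 2), ContDiffAt ℂ 2 (symbolFun n p ħ h z) u :=
    fun u hu => contDiffAt_symbolFun hn hp hħ h (hloc u hu).1
  have hdiff : DifferentiableOn ℂ (symbolFun n p ħ h z) (Metric.ball z (‖z‖ / 2)) := fun u hu =>
    ((hcd u hu).differentiableAt (by simp)).differentiableWithinAt
  have hzb := Metric.mem_ball_self (x := z) hz2
  have h1 : ‖fderiv ℂ (symbolFun n p ħ h z) z‖ ≤ K₁ :=
    norm_fderiv_le_of_bound hz2 hdiff fun w hw => (hloc w hw).2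
  refine ⟨(hloc z hzb).2.trans (by linarith), by rw [norm_gradAt]; linarith, fun r hr c => ?_⟩
  have h2 : transform n p ħ r =ᶠ[𝓝 z] fun u =>
      taylorRem (symbolFun n p ħ h z) z u * kernelT n p ħ u z := by
    filter_upwards [Metric.isOpen_ball.mem_nhds hzb] with u hu
    exact hr.transform_eq (hloc u hu).1
  have h3 : fderiv ℂ (taylorRem (symbolFun n p ħ h z) z) z = 0 := by
    rw [(hasFDerivAt_taylorRem ((hcd z hzb).differentiableAt (by simp))).fderiv, sub_self]
  rw [fderiv_radialOp_mul hp ħ (contDiffAt_taylorRem (hcd z hzb)) h2, h3, taylorRem_self]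
  simp only [zero_apply, zero_mul, add_zero]
  have h4 : ‖fderiv ℂ (fun u => fderiv ℂ (taylorRem (symbolFun n p ħ h z) z) u u) z‖ ≤ K₂ :=
    norm_fderiv_euler_taylorRem_le hz2 hcd fun w hw => (hloc w hw).2
  have h5 : 0 ≤ thetaR (n + p) ((‖z‖ / ħ) ^ 2) :=
    zero_le_one.trans (one_le_thetaR_sq (add_pos_of_neg_lt hp) _)
  rw [norm_mul, kernelT_self, Complex.norm_real, Real.norm_of_nonneg h5]
  refine mul_le_mul_of_nonneg_right ?_ h5
  refine (ContinuousLinearMap.le_opNorm _ _).trans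
    (mul_le_mul_of_nonneg_right (h4.trans ?_) (norm_nonneg _))
  linarith

/-! ### Expansion of the inner product -/

theorem transform_self {n : ℕ} {p ħ : ℝ} (hp : -(n : ℝ) < p) (h : L2Sph n) (z : Cn n) :
    transform n p ħ h z = symbolFun n p ħ h z z * kernelT n p ħ z z := by
  rw [symbolFun, div_mul_cancel₀ _ (kernelT_self_ne_zero hp ħ z)]

theorem IsRemainder.transform_self {n : ℕ} {p ħ : ℝ} (hp : -(n : ℝ) < p) {z : Cn n}
    {h r : L2Sph n} (hr : IsRemainder n p ħ z h r) : transform n p ħ r z = 0 := by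
  rw [hr.transform_eq (kernelT_self_ne_zero hp ħ z), taylorRem_self, zero_mul]

/-- The decomposition of a vector into a multiple of the coherent state at `z`, a gradient vector
and a remainder. -/
theorem exists_decomposition {n : ℕ} (hn : 0 < n) {p ħ : ℝ} (hp : -(n : ℝ) < p) (hħ : 0 < ħ)
    (z : Cn n) {h : L2Sph n} (hh : h ∈ cohSpan n p ħ) : ∃ e ∈ cohSpan n p ħ, ∃ r ∈ cohSpan n p ħ,
      h = (symbolFun n p ħ h z z - cdot z (gradAt (symbolFun n p ħ h z) z)) • cohL2 n p ħ z +
        e + r ∧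
      (∀ h' ∈ cohSpan n p ħ, inner ℂ e h' = (ħ : ℂ) ^ 2 *
        fderiv ℂ (radialOp (n + p) (transform n p ħ h')) z (gradAt (symbolFun n p ħ h z) z)) ∧
      (∀ u, transform n p ħ e u =
        cdot u (gradAt (symbolFun n p ħ h z) z) * kernelT n p ħ u z) ∧
      IsRemainder n p ħ z h r := by
  obtain ⟨e, he, he1, he2⟩ := exists_gradient_vector hn hp hħ z (gradAt (symbolFun n p ħ h z) z)
  set g := symbolFun n p ħ h z z - cdot z (gradAt (symbolFun n p ħ h z) z) with hg
  refine ⟨e, he, h - (g • cohL2 n p ħ z + e), Submodule.sub_mem _ hh (Submodule.add_mem _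
    (Submodule.smul_mem _ _ (cohL2_mem_cohSpan n p ħ z)) he), by abel, he1, he2, fun u => ?_⟩
  rw [transform_sub, transform_add, transform_smul, Pi.sub_apply, Pi.add_apply, Pi.smul_apply, he2,
    transform_cohL2 hn hp hħ, cdot_sub_left, smul_eq_mul]
  ring

/-- The inner product with a gradient vector, for a vector whose transform is an affine function
times the kernel. -/
theorem fderiv_radialOp_affine {n : ℕ} {p ħ : ℝ} (hp : -(n : ℝ) < p) (hħ : 0 < ħ) {z : Cn n}
    (hz : z ≠ 0) {q : L2Sph n} {g : ℂ} {a : Cn n}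
    (hq : ∀ u, transform n p ħ q u = (g + cdot u a) * kernelT n p ħ u z) (c : Cn n) :
    (ħ : ℂ) ^ 2 * fderiv ℂ (radialOp (n + p) (transform n p ħ q)) z c =
      kernelT n p ħ z z * ((g + cdot z a) * cdot c z +
        (ħ : ℂ) ^ 2 * (cdot c a * ((n + p + eulerRatio (n + p) (‖z‖ / ħ) : ℝ) : ℂ) +
          (eulerRatio (n + p) (‖z‖ / ħ) : ℂ) *
            (cdot z a * cdot c z / ((‖z‖ ^ 2 : ℝ) : ℂ)))) := by
  have hlin : (fun u : Cn n => cdot u a) = (innerSL ℂ a : Cn n →L[ℂ] ℂ) := by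
    funext u
    rw [cdot_eq_inner, innerSL_apply_apply]
  have hF : ContDiff ℂ 2 fun u : Cn n => g + cdot u a := by
    rw [show (fun u : Cn n => g + cdot u a) = fun u => g + (innerSL ℂ a : Cn n →L[ℂ] ℂ) u from
      funext fun u => by rw [← hlin]]
    fun_prop
  have hd : ∀ w v : Cn n, fderiv ℂ (fun u : Cn n => g + cdot u a) w v = cdot v a := fun w v => by
    rw [fderiv_const_add, hlin, ContinuousLinearMap.fderiv, ← hlin]
  have hd2 : fderiv ℂ (fun u : Cn n => cdot u a) z c = cdot c a := by
    rw [hlin, ContinuousLinearMap.fderiv, ← hlin]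
  have hħ' : (ħ : ℂ) ≠ 0 := Complex.ofReal_ne_zero.2 hħ.ne'
  rw [fderiv_radialOp_mul hp ħ hF.contDiffAt (Eventually.of_forall hq)]
  simp only [hd, hd2]
  rw [fderiv_kernelT_self hp hħ hz, radialOp_kernelT_self hp]
  push_cast
  field_simp
  ring

/-- The inner product of two vectors in terms of the values and gradients of the quotients of their
transforms by the kernel, up to remainders. -/
theorem exists_inner_eq {n : ℕ} (hn : 0 < n) {p ħ : ℝ} (hp : -(n : ℝ) < p) (hħ : 0 < ħ)
    {z : Cn n} (hz : z ≠ 0) {h₁ h₂ : L2Sph n} (hh₁ : h₁ ∈ cohSpan n p ħ)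
    (hh₂ : h₂ ∈ cohSpan n p ħ) {a₁ a₂ : Cn n} (ha₁ : gradAt (symbolFun n p ħ h₁ z) z = a₁)
    (ha₂ : gradAt (symbolFun n p ħ h₂ z) z = a₂) :
    ∃ r₁ ∈ cohSpan n p ħ, ∃ r₂ ∈ cohSpan n p ħ,
      IsRemainder n p ħ z h₁ r₁ ∧ IsRemainder n p ħ z h₂ r₂ ∧
      inner ℂ h₁ h₂ =
        kernelT n p ħ z z * ((starRingEnd ℂ) (symbolFun n p ħ h₁ z z) * symbolFun n p ħ h₂ z z +
          (ħ : ℂ) ^ 2 * (cdot a₁ a₂ * ((n + p + eulerRatio (n + p) (‖z‖ / ħ) : ℝ) : ℂ) +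
          (eulerRatio (n + p) (‖z‖ / ħ) : ℂ) *
            (cdot z a₂ * cdot a₁ z / ((‖z‖ ^ 2 : ℝ) : ℂ)))) +
        ((ħ : ℂ) ^ 2 * fderiv ℂ (radialOp (n + p) (transform n p ħ r₂)) z a₁ +
          (starRingEnd ℂ) ((ħ : ℂ) ^ 2 *
            fderiv ℂ (radialOp (n + p) (transform n p ħ r₁)) z a₂) + inner ℂ r₁ r₂) := by
  obtain ⟨e₁, he₁, r₁, hr₁, hd₁, hi₁, ht₁, hR₁⟩ := exists_decomposition hn hp hħ z hh₁
  obtain ⟨e₂, he₂, r₂, hr₂, hd₂, hi₂, ht₂, hR₂⟩ := exists_decomposition hn hp hħ z hh₂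
  rw [ha₁] at hd₁ hi₁ ht₁
  rw [ha₂] at hd₂ hi₂ ht₂
  refine ⟨r₁, hr₁, r₂, hr₂, hR₁, hR₂, ?_⟩
  set f₁ := symbolFun n p ħ h₁ z z
  set f₂ := symbolFun n p ħ h₂ z z with hf₂
  set κ := cohL2 n p ħ z with hκ
  set q := (f₂ - cdot z a₂) • κ + e₂ with hq
  have hqm : q ∈ cohSpan n p ħ := Submodule.add_mem _
    (Submodule.smul_mem _ _ (cohL2_mem_cohSpan n p ħ z)) he₂
  have htq : ∀ u, transform n p ħ q u = (f₂ - cdot z a₂ + cdot u a₂) * kernelT n p ħ u z := by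
    intro u
    rw [hq, transform_add, transform_smul, Pi.add_apply, Pi.smul_apply, ht₂, hκ,
      transform_cohL2 hn hp hħ, smul_eq_mul]
    ring
  have h1 : inner ℂ κ h₂ = f₂ * kernelT n p ħ z z := transform_self hp h₂ z
  -- the transform of a remainder vanishes at `z`
  have h2 : inner ℂ r₁ κ = 0 := by
    rw [← inner_conj_symm]
    have : inner ℂ κ r₁ = 0 := hR₁.transform_self hp
    rw [this, map_zero]
  have h3 : inner ℂ r₁ e₂ = (starRingEnd ℂ) ((ħ : ℂ) ^ 2 *
      fderiv ℂ (radialOp (n + p) (transform n p ħ r₁)) z a₂) := by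
    rw [← inner_conj_symm, hi₂ r₁ hr₁]
  have h4 : inner ℂ e₁ r₂ = (ħ : ℂ) ^ 2 *
      fderiv ℂ (radialOp (n + p) (transform n p ħ r₂)) z a₁ := hi₁ r₂ hr₂
  have h5 := hi₁ q hqm
  rw [fderiv_radialOp_affine hp hħ hz htq] at h5
  have h6 : inner ℂ r₁ q = inner ℂ r₁ e₂ := by
    rw [hq, inner_add_right, inner_smul_right, h2, mul_zero, zero_add]
  have h7 : inner ℂ h₁ h₂ = (starRingEnd ℂ) (f₁ - cdot z a₁) * inner ℂ κ h₂ +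
      (inner ℂ e₁ q + inner ℂ e₁ r₂) + (inner ℂ r₁ q + inner ℂ r₁ r₂) := by
    rw [← inner_add_right, ← inner_add_right, ← hd₂]
    conv_lhs => rw [hd₁]
    rw [inner_add_left, inner_add_left, inner_smul_left]
  rw [h7, h6, h1, h3, h4, h5, map_sub, cdot_conj]
  ring

/-- The expansion, to first order in `ħ`, of the inner product of two vectors of uniform growth. -/
theorem exists_norm_inner_sub_le {n : ℕ} (hn : 0 < n) {p : ℝ} (hp : -(n : ℝ) < p) {z : Cn n}
    (hz : z ≠ 0) {C₁ θ₁ C₂ θ₂ : ℝ} (hC₁ : 0 ≤ C₁) (hθ₁ : θ₁ < 1) (hC₂ : 0 ≤ C₂) (hθ₂ : θ₂ < 1) :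
    ∃ K, ∀ᶠ ħ : ℝ in 𝓝[>] 0, ∀ h₁ ∈ cohSpan n p ħ, ∀ h₂ ∈ cohSpan n p ħ,
      KernelGrowth n p ħ z C₁ θ₁ h₁ → KernelGrowth n p ħ z C₂ θ₂ h₂ →
      ∀ a₁ a₂, gradAt (symbolFun n p ħ h₁ z) z = a₁ → gradAt (symbolFun n p ħ h₂ z) z = a₂ →
      ‖inner ℂ h₁ h₂ / kernelT n p ħ z z -
        ((starRingEnd ℂ) (symbolFun n p ħ h₁ z z) * symbolFun n p ħ h₂ z z +
          (ħ : ℂ) * (‖z‖ * (cdot a₁ a₂ + cdot z a₂ * cdot a₁ z / ((‖z‖ ^ 2 : ℝ) : ℂ))))‖ ≤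
        K * ħ ^ 2 := by
  have hb := add_pos_of_neg_lt hp
  have hz' : 0 < ‖z‖ := norm_pos_iff.2 hz
  obtain ⟨A₁, hA₁, hrem₁⟩ := exists_norm_sq_remainder_le hn hp hz hC₁ hθ₁
  obtain ⟨A₂, hA₂, hrem₂⟩ := exists_norm_sq_remainder_le hn hp hz hC₂ hθ₂
  obtain ⟨B₁, hB₁, hgrad₁⟩ := exists_inner_gradient_remainder_le hn hp hz hC₁ hθ₁
  obtain ⟨B₂, hB₂, hgrad₂⟩ := exists_inner_gradient_remainder_le hn hp hz hC₂ hθ₂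
  obtain ⟨E, hE, heuler⟩ := exists_eulerRatio hb
  refine ⟨B₁ * B₂ * (n + p) + E * (B₁ * B₂ + B₂ * B₁) + (B₂ * B₁ + B₁ * B₂ + (A₁ + A₂)), ?_⟩
  filter_upwards [eventually_pos, eventually_le hz', hrem₁, hrem₂, hgrad₁, hgrad₂] with
    ħ hħ hħz hrem₁ hrem₂ hgrad₁ hgrad₂ h₁ hh₁ h₂ hh₂ hg₁ hg₂ a₁ a₂ ha₁ ha₂
  obtain ⟨r₁, hr₁, r₂, hr₂, hR₁, hR₂, heq⟩ := exists_inner_eq hn hp hħ hz hh₁ hh₂ ha₁ ha₂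
  have n₁ := hrem₁ h₁ hg₁ r₁ hr₁ hR₁
  have n₂ := hrem₂ h₂ hg₂ r₂ hr₂ hR₂
  obtain ⟨-, m₁, d₁⟩ := hgrad₁ h₁ hg₁
  obtain ⟨-, m₂, d₂⟩ := hgrad₂ h₂ hg₂
  have d₁ := d₁ r₁ hR₁ a₂
  have d₂ := d₂ r₂ hR₂ a₁
  rw [ha₁] at m₁
  rw [ha₂] at m₂
  have hℰ := heuler (‖z‖ / ħ) ((one_le_div hħ).2 hħz)
  have hT : 0 < thetaR (n + p) ((‖z‖ / ħ) ^ 2) := zero_lt_one.trans_le (one_le_thetaR_sq hb _)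
  have hT' := kernelT_self_ne_zero hp ħ z
  have hTn : ‖kernelT n p ħ z z‖ = thetaR (n + p) ((‖z‖ / ħ) ^ 2) := by
    rw [kernelT_self, Complex.norm_real, Real.norm_of_nonneg hT.le]
  rw [heq]
  have hxa : ‖cdot a₁ a₂‖ ≤ B₁ * B₂ :=
    (norm_cdot_le _ _).trans (mul_le_mul m₁ m₂ (norm_nonneg _) hB₁)
  have hya : ‖cdot z a₂ * cdot a₁ z / ((‖z‖ ^ 2 : ℝ) : ℂ)‖ ≤ B₂ * B₁ := by
    rw [norm_div, norm_mul, Complex.norm_real, Real.norm_of_nonneg (by positivity),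
      div_le_iff₀ (by positivity)]
    calc _ ≤ (‖z‖ * B₂) * (B₁ * ‖z‖) := mul_le_mul
          ((norm_cdot_le _ _).trans (mul_le_mul_of_nonneg_left m₂ (norm_nonneg _)))
          ((norm_cdot_le _ _).trans (mul_le_mul_of_nonneg_right m₁ (norm_nonneg _)))
          (norm_nonneg _) (by positivity)
      _ = _ := by ring
  have hs₁ : ‖(ħ : ℂ) ^ 2 * fderiv ℂ (radialOp (n + p) (transform n p ħ r₂)) z a₁‖ ≤
      B₂ * B₁ * ħ ^ 2 * thetaR (n + p) ((‖z‖ / ħ) ^ 2) := by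
    rw [norm_mul, norm_pow, Complex.norm_real, Real.norm_of_nonneg hħ.le]
    calc _ ≤ ħ ^ 2 * (B₂ * B₁ * thetaR (n + p) ((‖z‖ / ħ) ^ 2)) :=
          mul_le_mul_of_nonneg_left (d₂.trans (by gcongr)) (by positivity)
      _ = _ := by ring
  have hs₂ : ‖(starRingEnd ℂ) ((ħ : ℂ) ^ 2 *
        fderiv ℂ (radialOp (n + p) (transform n p ħ r₁)) z a₂)‖ ≤
      B₁ * B₂ * ħ ^ 2 * thetaR (n + p) ((‖z‖ / ħ) ^ 2) := by
    rw [RCLike.norm_conj, norm_mul, norm_pow, Complex.norm_real, Real.norm_of_nonneg hħ.le]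
    calc _ ≤ ħ ^ 2 * (B₁ * B₂ * thetaR (n + p) ((‖z‖ / ħ) ^ 2)) :=
          mul_le_mul_of_nonneg_left (d₁.trans (by gcongr)) (by positivity)
      _ = _ := by ring
  have hs₃ : ‖(inner ℂ r₁ r₂ : ℂ)‖ ≤ (A₁ + A₂) * ħ ^ 2 * thetaR (n + p) ((‖z‖ / ħ) ^ 2) := by
    have h1 := norm_inner_le_norm (𝕜 := ℂ) r₁ r₂
    have h2 := two_mul_le_add_sq ‖r₁‖ ‖r₂‖
    have h3 : 0 ≤ ‖r₁‖ * ‖r₂‖ := by positivity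
    linarith
  generalize (ħ : ℂ) ^ 2 * fderiv ℂ (radialOp (n + p) (transform n p ħ r₂)) z a₁ = s₁ at *
  generalize (starRingEnd ℂ) ((ħ : ℂ) ^ 2 *
        fderiv ℂ (radialOp (n + p) (transform n p ħ r₁)) z a₂) = s₂ at *
  generalize (inner ℂ r₁ r₂ : ℂ) = s₃ at *
  generalize cdot z a₂ * cdot a₁ z / ((‖z‖ ^ 2 : ℝ) : ℂ) = y at *
  generalize cdot a₁ a₂ = x at *
  generalize (starRingEnd ℂ) (symbolFun n p ħ h₁ z z) * symbolFun n p ħ h₂ z z = f at *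
  generalize eulerRatio (n + p) (‖z‖ / ħ) = ℰ at *
  generalize thetaR (n + p) ((‖z‖ / ħ) ^ 2) = τ at *
  generalize kernelT n p ħ z z = T at *
  -- the first order term comes from `ħ² ℰ = ħ |z| + O(ħ²)`
  have key : (T * (f + (ħ : ℂ) ^ 2 * (x * ((n + p + ℰ : ℝ) : ℂ) + (ℰ : ℂ) * y)) +
      (s₁ + s₂ + s₃)) / T - (f + (ħ : ℂ) * (‖z‖ * (x + y))) =
      ((ħ ^ 2 * (n + p) : ℝ) : ℂ) * x + ((ħ ^ 2 * (ℰ - ‖z‖ / ħ) : ℝ) : ℂ) * (x + y) +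
        (s₁ + s₂ + s₃) / T := by
    have hħ' : (ħ : ℂ) ≠ 0 := Complex.ofReal_ne_zero.2 hħ.ne'
    push_cast
    field_simp
    ring
  rw [key]
  have k1 : ‖((ħ ^ 2 * (n + p) : ℝ) : ℂ) * x‖ ≤ ħ ^ 2 * (n + p) * (B₁ * B₂) := by
    rw [norm_mul, Complex.norm_real, Real.norm_of_nonneg (by positivity)]
    gcongr
  have k2 : ‖((ħ ^ 2 * (ℰ - ‖z‖ / ħ) : ℝ) : ℂ) * (x + y)‖ ≤
      ħ ^ 2 * E * (B₁ * B₂ + B₂ * B₁) := by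
    rw [norm_mul, Complex.norm_real, Real.norm_eq_abs, abs_mul, abs_of_nonneg (sq_nonneg ħ)]
    have := (norm_add_le x y).trans (add_le_add hxa hya)
    gcongr
  have k3 : ‖(s₁ + s₂ + s₃) / T‖ ≤ (B₂ * B₁ + B₁ * B₂ + (A₁ + A₂)) * ħ ^ 2 := by
    rw [norm_div, hTn, div_le_iff₀ hT]
    have := norm_add₃_le (a := s₁) (b := s₂) (c := s₃)
    linarith
  have := norm_add₃_le (a := ((ħ ^ 2 * (n + p) : ℝ) : ℂ) * x)
    (b := ((ħ ^ 2 * (ℰ - ‖z‖ / ħ) : ℝ) : ℂ) * (x + y)) (c := (s₁ + s₂ + s₃) / T)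
  linarith

/-! ### Wirtinger derivatives -/

section Wirtinger

variable {n : ℕ} {f g : Cn n → ℂ} {w : Cn n}

theorem dHol_congr (h : f =ᶠ[𝓝 w] g) (i : Fin n) : dHol i f w = dHol i g w := by
  rw [dHol, dHol, h.fderiv_eq]

theorem dBar_congr (h : f =ᶠ[𝓝 w] g) (i : Fin n) : dBar i f w = dBar i g w := by
  rw [dBar, dBar, h.fderiv_eq]

theorem dHol_mul (hf : DifferentiableAt ℝ f w) (hg : DifferentiableAt ℝ g w) (i : Fin n) :
    dHol i (fun v => f v * g v) w = dHol i f w * g w + f w * dHol i g w := by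
  simp only [dHol, fderiv_fun_mul hf hg, add_apply, smul_apply, smul_eq_mul]
  ring

theorem dBar_mul (hf : DifferentiableAt ℝ f w) (hg : DifferentiableAt ℝ g w) (i : Fin n) :
    dBar i (fun v => f v * g v) w = dBar i f w * g w + f w * dBar i g w := by
  simp only [dBar, fderiv_fun_mul hf hg, add_apply, smul_apply, smul_eq_mul]
  ring

theorem single_I (i : Fin n) :
    (EuclideanSpace.single i Complex.I : Cn n) = Complex.I • EuclideanSpace.single i 1 := by
  ext j
  by_cases h : j = i <;> simp [h]

theorem dHol_of_differentiableAt (hf : DifferentiableAt ℂ f w) (i : Fin n) :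
    dHol i f w = fderiv ℂ f w (EuclideanSpace.single i 1) := by
  rw [dHol, hf.fderiv_restrictScalars ℝ, ContinuousLinearMap.coe_restrictScalars', single_I,
    map_smul, smul_eq_mul, ← mul_assoc, Complex.I_mul_I]
  ring

theorem dBar_conj_of_differentiableAt (hf : DifferentiableAt ℂ f w) (i : Fin n) :
    dBar i (fun v => (starRingEnd ℂ) (f v)) w =
      (starRingEnd ℂ) (fderiv ℂ f w (EuclideanSpace.single i 1)) := by
  have h : HasFDerivAt (fun v => (starRingEnd ℂ) (f v))
      (((Complex.conjCLE : ℂ ≃L[ℝ] ℂ) : ℂ →L[ℝ] ℂ).comp ((fderiv ℂ f w).restrictScalars ℝ)) w :=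
    ((Complex.conjCLE : ℂ ≃L[ℝ] ℂ) : ℂ →L[ℝ] ℂ).hasFDerivAt.comp w
      (hf.hasFDerivAt.restrictScalars ℝ)
  rw [dBar, h.fderiv]
  simp only [ContinuousLinearMap.comp_apply, ContinuousLinearMap.coe_restrictScalars', single_I,
    map_smul, smul_eq_mul, ContinuousLinearEquiv.coe_coe, Complex.conjCLE_apply, map_mul,
    Complex.conj_I]
  rw [← mul_assoc, mul_neg, Complex.I_mul_I]
  ring

theorem hasFDerivAt_apply (j : Fin n) (w : Cn n) :
    HasFDerivAt (fun v : Cn n => v j) (EuclideanSpace.proj j : Cn n →L[ℂ] ℂ) w :=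
  (EuclideanSpace.proj j : Cn n →L[ℂ] ℂ).hasFDerivAt

theorem differentiableAt_apply (j : Fin n) (w : Cn n) :
    DifferentiableAt ℝ (fun v : Cn n => v j) w :=
  ((hasFDerivAt_apply j w).restrictScalars ℝ).differentiableAt

theorem differentiableAt_conj_apply (j : Fin n) (w : Cn n) :
    DifferentiableAt ℝ (fun v : Cn n => (starRingEnd ℂ) (v j)) w :=
  (((Complex.conjCLE : ℂ ≃L[ℝ] ℂ) : ℂ →L[ℝ] ℂ).hasFDerivAt.comp w
      ((hasFDerivAt_apply j w).restrictScalars ℝ)).differentiableAt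

theorem dHol_apply (i j : Fin n) (w : Cn n) :
    dHol i (fun v : Cn n => v j) w = if i = j then 1 else 0 := by
  rw [dHol_of_differentiableAt (hasFDerivAt_apply j w).differentiableAt,
    (hasFDerivAt_apply j w).fderiv]
  simp [eq_comm]

theorem dBar_conj_apply (i j : Fin n) (w : Cn n) :
    dBar i (fun v : Cn n => (starRingEnd ℂ) (v j)) w = if i = j then 1 else 0 := by
  rw [dBar_conj_of_differentiableAt (hasFDerivAt_apply j w).differentiableAt,
    (hasFDerivAt_apply j w).fderiv]
  simp [eq_comm]

/-- The real derivative of a radial function. -/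
theorem hasFDerivAt_radial (hw : w ≠ 0) {φ : ℝ → ℝ} {φ' : ℝ} (hφ : HasDerivAt φ φ' ‖w‖) :
    HasFDerivAt (fun v : Cn n => ((φ ‖v‖ : ℝ) : ℂ)) (Complex.ofRealCLM.comp (φ' • ‖w‖⁻¹ •
      Complex.reCLM.comp ((innerSL ℂ w : Cn n →L[ℂ] ℂ).restrictScalars ℝ))) w := by
  have hw' : 0 < ‖w‖ := norm_pos_iff.2 hw
  have h1 : HasFDerivAt (fun v : Cn n => (inner ℂ v v : ℂ)) _ w :=
    (hasFDerivAt_id w).inner ℂ (hasFDerivAt_id w)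
  have h2 : HasFDerivAt (fun v : Cn n => ‖v‖ ^ 2) ((2 : ℝ) •
      Complex.reCLM.comp ((innerSL ℂ w : Cn n →L[ℂ] ℂ).restrictScalars ℝ)) w := by
    have h3 := Complex.reCLM.hasFDerivAt.comp w h1
    refine (h3.congr_fderiv ?_).congr_of_eventuallyEq (Eventually.of_forall fun v => ?_)
    · ext v
      simp only [ContinuousLinearMap.comp_apply, smul_apply, ContinuousLinearMap.coe_restrictScalars',
        innerSL_apply_apply, Complex.reCLM_apply, smul_eq_mul, fderivInnerCLM_apply,
        ContinuousLinearMap.prod_apply, id, ContinuousLinearMap.id_apply, Complex.add_re]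
      rw [← inner_conj_symm v w, Complex.conj_re]
      ring
    · simp [← Complex.ofReal_pow]
  have h3 : HasFDerivAt (fun v : Cn n => ‖v‖) (‖w‖⁻¹ •
      Complex.reCLM.comp ((innerSL ℂ w : Cn n →L[ℂ] ℂ).restrictScalars ℝ)) w := by
    have h4 := h2.sqrt (by positivity)
    refine (h4.congr_fderiv ?_).congr_of_eventuallyEq (Eventually.of_forall fun v => ?_)
    · rw [smul_smul, Real.sqrt_sq hw'.le]
      congr 1
      field_simp
    · exact (Real.sqrt_sq (norm_nonneg v)).symm
  exact Complex.ofRealCLM.hasFDerivAt.comp w (hφ.comp_hasFDerivAt w h3)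

theorem dHol_radial (hw : w ≠ 0) {φ : ℝ → ℝ} {φ' : ℝ} (hφ : HasDerivAt φ φ' ‖w‖) (i : Fin n) :
    dHol i (fun v : Cn n => ((φ ‖v‖ : ℝ) : ℂ)) w =
      φ' / (2 * ‖w‖) * (starRingEnd ℂ) (w i) := by
  have hw' : (‖w‖ : ℂ) ≠ 0 := Complex.ofReal_ne_zero.2 (norm_ne_zero_iff.2 hw)
  rw [dHol, (hasFDerivAt_radial hw hφ).fderiv]
  simp only [ContinuousLinearMap.comp_apply, smul_apply, ContinuousLinearMap.coe_restrictScalars',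
    innerSL_apply_apply, Complex.reCLM_apply, smul_eq_mul, Complex.ofRealCLM_apply,
    EuclideanSpace.inner_single_right]
  rw [Complex.I_mul_re]
  conv_rhs => rw [← Complex.re_add_im ((starRingEnd ℂ) (w i))]
  push_cast
  field_simp
  ring

theorem dBar_radial (hw : w ≠ 0) {φ : ℝ → ℝ} {φ' : ℝ} (hφ : HasDerivAt φ φ' ‖w‖) (i : Fin n) :
    dBar i (fun v : Cn n => ((φ ‖v‖ : ℝ) : ℂ)) w = φ' / (2 * ‖w‖) * w i := by
  have hw' : (‖w‖ : ℂ) ≠ 0 := Complex.ofReal_ne_zero.2 (norm_ne_zero_iff.2 hw)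
  rw [dBar, (hasFDerivAt_radial hw hφ).fderiv]
  simp only [ContinuousLinearMap.comp_apply, smul_apply, ContinuousLinearMap.coe_restrictScalars',
    innerSL_apply_apply, Complex.reCLM_apply, smul_eq_mul, Complex.ofRealCLM_apply,
    EuclideanSpace.inner_single_right]
  rw [Complex.I_mul_re, Complex.conj_im, one_mul, Complex.conj_re]
  conv_rhs => rw [← Complex.re_add_im (w i)]
  push_cast
  field_simp

end Wirtinger

/-! ### Geometry of the potential `2 |w|` -/

theorem eventually_ne_zero {n : ℕ} {w : Cn n} (hw : w ≠ 0) : ∀ᶠ v in 𝓝 w, v ≠ 0 :=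
  isOpen_ne.mem_nhds hw

theorem kahlerMetric_apply {n : ℕ} {w : Cn n} (hw : w ≠ 0) (i j : Fin n) :
    kahlerMetric n w i j = (‖w‖ : ℂ)⁻¹ * ((if i = j then 1 else 0) -
      (starRingEnd ℂ) (w i) * w j / (2 * ‖w‖ ^ 2)) := by
  have hw' : (‖w‖ : ℂ) ≠ 0 := Complex.ofReal_ne_zero.2 (norm_ne_zero_iff.2 hw)
  have h1 : (dHol i fun v : Cn n => ((2 * ‖v‖ : ℝ) : ℂ)) =ᶠ[𝓝 w]
      fun v => (starRingEnd ℂ) (v i) * ((‖v‖⁻¹ : ℝ) : ℂ) := by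
    filter_upwards [eventually_ne_zero hw] with v hv
    have hv' : (‖v‖ : ℂ) ≠ 0 := Complex.ofReal_ne_zero.2 (norm_ne_zero_iff.2 hv)
    have h2 : HasDerivAt (fun r : ℝ => 2 * r) 2 ‖v‖ := by
      simpa using (hasDerivAt_id ‖v‖).const_mul (2 : ℝ)
    rw [dHol_radial hv h2]
    push_cast
    field_simp
  have h3 : HasDerivAt (fun r : ℝ => r⁻¹) (-(‖w‖ ^ 2)⁻¹) ‖w‖ :=
    hasDerivAt_inv (norm_ne_zero_iff.2 hw)
  rw [kahlerMetric, Matrix.of_apply, dBar_congr h1, dBar_mul (differentiableAt_conj_apply i w)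
    (hasFDerivAt_radial hw h3).differentiableAt, dBar_conj_apply, dBar_radial hw h3]
  simp only [eq_comm (a := j)]
  push_cast
  field_simp
  ring

theorem kahlerMetric_eq {n : ℕ} {w : Cn n} (hw : w ≠ 0) :
    kahlerMetric n w = (‖w‖ : ℂ)⁻¹ • (1 + Matrix.vecMulVec
      (fun i => (starRingEnd ℂ) (w i)) (fun j => -(w j / (2 * ‖w‖ ^ 2)))) := by
  ext i j
  rw [kahlerMetric_apply hw, Matrix.smul_apply, Matrix.add_apply, Matrix.one_apply,
    Matrix.vecMulVec_apply, smul_eq_mul]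
  ring

theorem dotProduct_conj_self {n : ℕ} (w : Cn n) :
    ∑ i, w i * (starRingEnd ℂ) (w i) = (‖w‖ : ℂ) ^ 2 := by
  have := cdot_self w
  push_cast at this
  exact this

theorem kahlerMetric_det {n : ℕ} {w : Cn n} (hw : w ≠ 0) :
    (kahlerMetric n w).det = (((‖w‖⁻¹) ^ n / 2 : ℝ) : ℂ) := by
  have hw' : (‖w‖ : ℂ) ≠ 0 := Complex.ofReal_ne_zero.2 (norm_ne_zero_iff.2 hw)
  rw [kahlerMetric_eq hw, Matrix.det_smul, Fintype.card_fin,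
    Matrix.vecMulVec_eq Unit, Matrix.det_one_add_replicateCol_mul_replicateRow]
  have h : (fun j => -(w j / (2 * (‖w‖ : ℂ) ^ 2))) ⬝ᵥ (fun i => (starRingEnd ℂ) (w i)) =
      -(1 / 2) := by
    simp only [dotProduct]
    calc _ = -(∑ i, w i * (starRingEnd ℂ) (w i)) / (2 * (‖w‖ : ℂ) ^ 2) := by
          rw [← Finset.sum_neg_distrib, Finset.sum_div]
          exact Finset.sum_congr rfl fun i _ => by ring
      _ = _ := by
          rw [dotProduct_conj_self]
          field_simp
  rw [h]
  push_cast
  ring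

theorem gInv_eq {n : ℕ} {w : Cn n} (hw : w ≠ 0) (j i : Fin n) :
    gInv n w j i = ‖w‖ * ((if j = i then 1 else 0) +
      (starRingEnd ℂ) (w j) * w i / ‖w‖ ^ 2) := by
  have hw' : (‖w‖ : ℂ) ≠ 0 := Complex.ofReal_ne_zero.2 (norm_ne_zero_iff.2 hw)
  have h : (kahlerMetric n w)⁻¹ = Matrix.of fun j i => (‖w‖ : ℂ) * ((if j = i then 1 else 0) +
      (starRingEnd ℂ) (w j) * w i / ‖w‖ ^ 2) := by
    refine Matrix.inv_eq_right_inv ?_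
    ext i k
    rw [Matrix.mul_apply, Matrix.one_apply]
    simp only [kahlerMetric_apply hw, Matrix.of_apply]
    calc _ = ∑ j, ((if i = j then (1 : ℂ) else 0) * (if j = k then 1 else 0) +
          (if i = j then (1 : ℂ) else 0) * ((starRingEnd ℂ) (w j) * w k / ‖w‖ ^ 2) -
          (if j = k then (1 : ℂ) else 0) * ((starRingEnd ℂ) (w i) * w j / (2 * ‖w‖ ^ 2)) -
          (w j * (starRingEnd ℂ) (w j)) *
            ((starRingEnd ℂ) (w i) * w k / (2 * ‖w‖ ^ 2 * ‖w‖ ^ 2))) :=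
          Finset.sum_congr rfl fun j _ => by
            field_simp
            ring
      _ = _ := by
          rw [Finset.sum_sub_distrib, Finset.sum_sub_distrib, Finset.sum_add_distrib,
            ← Finset.sum_mul, dotProduct_conj_self]
          simp only [ite_mul, one_mul, zero_mul, Finset.sum_ite_eq, Finset.sum_ite_eq',
            Finset.mem_univ, if_true]
          field_simp
          ring
  rw [gInv, h, Matrix.of_apply]

/-- Contraction of the inverse metric with a matrix of rank one. -/
theorem sum_gInv_mul {n : ℕ} {w : Cn n} (hw : w ≠ 0) (x y : Fin n → ℂ) :
    ∑ i, ∑ j, gInv n w j i * (x j * y i) =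
      ‖w‖ * (∑ i, x i * y i +
        (∑ j, (starRingEnd ℂ) (w j) * x j) * (∑ i, w i * y i) / ‖w‖ ^ 2) := by
  rw [Finset.sum_mul_sum, Finset.sum_comm, Finset.sum_div, ← Finset.sum_add_distrib,
    Finset.mul_sum]
  refine Finset.sum_congr rfl fun j _ => ?_
  simp only [gInv_eq hw]
  calc _ = ∑ i, ((if j = i then (1 : ℂ) else 0) * (‖w‖ * (x j * y i)) +
        ‖w‖ * ((starRingEnd ℂ) (w j) * x j * (w i * y i) / ‖w‖ ^ 2)) :=
        Finset.sum_congr rfl fun i _ => by ring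
    _ = _ := by
        rw [Finset.sum_add_distrib, ← Finset.mul_sum, ← Finset.sum_div]
        simp only [ite_mul, one_mul, zero_mul, Finset.sum_ite_eq, Finset.mem_univ, if_true]
        ring

/-- The trace of the inverse metric. -/
theorem sum_gInv_diag {n : ℕ} {w : Cn n} (hw : w ≠ 0) :
    ∑ i, ∑ j, gInv n w j i * (if i = j then 1 else 0) = ‖w‖ * (n + 1) := by
  have hw' : (‖w‖ : ℂ) ≠ 0 := Complex.ofReal_ne_zero.2 (norm_ne_zero_iff.2 hw)
  simp only [mul_ite, mul_one, mul_zero, Finset.sum_ite_eq, Finset.mem_univ, if_true, gInv_eq hw]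
  calc _ = ∑ i : Fin n, ((‖w‖ : ℂ) + (w i * (starRingEnd ℂ) (w i)) / ‖w‖) :=
        Finset.sum_congr rfl fun i _ => by field_simp
    _ = _ := by
        rw [Finset.sum_add_distrib, ← Finset.sum_div, dotProduct_conj_self]
        simp only [Finset.sum_const, Finset.card_univ, Fintype.card_fin, nsmul_eq_mul]
        field_simp

/-- The trace of the inverse metric with the matrix `w_j w̄_i - |w|² δ_{ij}`. -/
theorem sum_gInv_proj {n : ℕ} {w : Cn n} (hw : w ≠ 0) :
    ∑ i, ∑ j, gInv n w j i * (w j * (starRingEnd ℂ) (w i) -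
      (‖w‖ : ℂ) ^ 2 * if i = j then 1 else 0) = -((n : ℂ) - 1) * ‖w‖ ^ 3 := by
  have hw' : (‖w‖ : ℂ) ≠ 0 := Complex.ofReal_ne_zero.2 (norm_ne_zero_iff.2 hw)
  have h1 := sum_gInv_mul hw (fun j => w j) (fun i => (starRingEnd ℂ) (w i))
  have h2 := sum_gInv_diag hw
  simp only [mul_sub, Finset.sum_sub_distrib]
  rw [h1]
  simp only [mul_left_comm _ ((‖w‖ : ℂ) ^ 2), ← Finset.mul_sum]
  rw [h2]
  simp only [mul_comm ((starRingEnd ℂ) _), dotProduct_conj_self]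
  field_simp
  ring

theorem scalarCurv_eq {n : ℕ} {w : Cn n} (hw : w ≠ 0) :
    scalarCurv n w = -((n : ℂ) * (n - 1)) / (2 * ‖w‖) := by
  have hw' : (‖w‖ : ℂ) ≠ 0 := Complex.ofReal_ne_zero.2 (norm_ne_zero_iff.2 hw)
  have h1 : (fun v => Complex.log (kahlerMetric n v).det) =ᶠ[𝓝 w]
      fun v => ((-(n * Real.log ‖v‖) - Real.log 2 : ℝ) : ℂ) := by
    filter_upwards [eventually_ne_zero hw] with v hv
    have hv' : 0 < ‖v‖ := norm_pos_iff.2 hv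
    rw [kahlerMetric_det hv, ← Complex.ofReal_log (by positivity), Real.log_div (by positivity)
      (by norm_num), Real.log_pow, Real.log_inv]
    push_cast
    ring
  have h2 : ∀ j, (dBar j fun v => Complex.log (kahlerMetric n v).det) =ᶠ[𝓝 w]
      fun v => v j * ((-(n / 2 * (‖v‖ ^ 2)⁻¹) : ℝ) : ℂ) := by
    intro j
    filter_upwards [h1.eventually_nhds, eventually_ne_zero hw] with v hv1 hv
    have hv' : (‖v‖ : ℂ) ≠ 0 := Complex.ofReal_ne_zero.2 (norm_ne_zero_iff.2 hv)
    have h3 : HasDerivAt (fun r : ℝ => -(n * Real.log r) - Real.log 2) (-(n * ‖v‖⁻¹)) ‖v‖ :=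
      (((Real.hasDerivAt_log (norm_ne_zero_iff.2 hv)).const_mul (n : ℝ)).neg).sub_const _
    rw [dBar_congr hv1, dBar_radial hv h3]
    push_cast
    field_simp
  have h4 : HasDerivAt (fun r : ℝ => -(n / 2 * (r ^ 2)⁻¹)) (n * (‖w‖ ^ 3)⁻¹) ‖w‖ := by
    have hw0 := norm_ne_zero_iff.2 hw
    have h5 := (((hasDerivAt_pow 2 ‖w‖).inv (pow_ne_zero 2 hw0)).const_mul ((n : ℝ) / 2)).neg
    refine h5.congr_deriv ?_
    push_cast
    field_simp
  have h5 : ∀ i j, dHol i (dBar j fun v => Complex.log (kahlerMetric n v).det) w =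
      n / (2 * ‖w‖ ^ 4) * (w j * (starRingEnd ℂ) (w i) -
        (‖w‖ : ℂ) ^ 2 * if i = j then 1 else 0) := by
    intro i j
    rw [dHol_congr (h2 j), dHol_mul (differentiableAt_apply j w)
      (hasFDerivAt_radial hw h4).differentiableAt, dHol_apply, dHol_radial hw h4]
    push_cast
    field_simp
    ring
  simp only [scalarCurv, h5, mul_left_comm _ ((n : ℂ) / _), ← Finset.mul_sum]
  rw [sum_gInv_proj hw]
  field_simp

/-- The coefficient of `F₁(z, z) F₂(z, z)` vanishes identically, so that only the terms with
derivatives contribute to the first order. -/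
theorem firstOrder_eq {n : ℕ} (p : ℝ) (F₁ F₂ : Cn n → Cn n → ℂ) {z : Cn n} (hz : z ≠ 0) :
    firstOrder n p F₁ F₂ z =
      ‖z‖ * (∑ i, dBar i (fun w => F₁ w z) z * dHol i (fun w => F₂ z w) z +
        (∑ j, (starRingEnd ℂ) (z j) * dBar j (fun w => F₁ w z) z) *
          (∑ i, z i * dHol i (fun w => F₂ z w) z) / ‖z‖ ^ 2) := by
  have hz' : (‖z‖ : ℂ) ≠ 0 := Complex.ofReal_ne_zero.2 (norm_ne_zero_iff.2 hz)
  have h1 : ∑ i, ∑ j, gInv n z j i * ((-(p : ℂ) - n + 1 / 2) / (2 * (‖z‖ : ℂ) ^ 4)) *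
          (z j * (starRingEnd ℂ) (z i) - (‖z‖ : ℂ) ^ 2 * if i = j then 1 else 0) =
      ((-(p : ℂ) - n + 1 / 2) / (2 * (‖z‖ : ℂ) ^ 4)) * (-((n : ℂ) - 1) * ‖z‖ ^ 3) := by
    rw [← sum_gInv_proj hz]
    simp only [Finset.mul_sum]
    exact Finset.sum_congr rfl fun i _ => Finset.sum_congr rfl fun j _ => by ring
  rw [firstOrder, sum_gInv_mul hz, h1, scalarCurv_eq hz]
  have h2 : -(((n : ℂ) - 1) * ((n : ℂ) - 1 + 2 * p)) / (4 * (‖z‖ : ℂ)) +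
      -((n : ℂ) * (n - 1)) / (2 * ‖z‖) / 2 +
      ((-(p : ℂ) - n + 1 / 2) / (2 * (‖z‖ : ℂ) ^ 4)) * (-((n : ℂ) - 1) * ‖z‖ ^ 3) = 0 := by
    field_simp
    ring
  rw [h2, mul_zero, add_zero]

/-- The first order coefficient in terms of gradients. -/
theorem firstOrder_eq_cdot {n : ℕ} (p : ℝ) {F₁ F₂ : Cn n → Cn n → ℂ} {G₁ G₂ : Cn n → ℂ} {z : Cn n}
    (hz : z ≠ 0) (hF₁ : ∀ u, F₁ u z = (starRingEnd ℂ) (G₁ u)) (hF₂ : ∀ u, F₂ z u = G₂ u)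
    (hG₁ : DifferentiableAt ℂ G₁ z) (hG₂ : DifferentiableAt ℂ G₂ z) :
    firstOrder n p F₁ F₂ z = ‖z‖ * (cdot (gradAt G₁ z) (gradAt G₂ z) +
      cdot z (gradAt G₂ z) * cdot (gradAt G₁ z) z / ((‖z‖ ^ 2 : ℝ) : ℂ)) := by
  have hs : ∀ (a : Cn n) (i : Fin n),
      cdot (EuclideanSpace.single i 1) a = (starRingEnd ℂ) (a i) := fun a i => by
    rw [cdot_eq_inner, EuclideanSpace.inner_single_right, one_mul]
  have h1 : ∀ i, dBar i (fun w => F₁ w z) z = gradAt G₁ z i := fun i => by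
    rw [funext hF₁, dBar_conj_of_differentiableAt hG₁, ← cdot_gradAt, hs, Complex.conj_conj]
  have h2 : ∀ i, dHol i (fun w => F₂ z w) z = (starRingEnd ℂ) (gradAt G₂ z i) := fun i => by
    rw [funext hF₂, dHol_of_differentiableAt hG₂, ← cdot_gradAt, hs]
  rw [firstOrder_eq p F₁ F₂ hz]
  simp only [h1, h2, mul_comm ((starRingEnd ℂ) (z _))]
  push_cast
  rw [cdot, cdot, cdot]
  ring

/-! ### The semiclassical expansion -/

theorem kernelGrowth_of_norm_le {n : ℕ} {p ħ : ℝ} {z : Cn n} {C θ : ℝ} {h : L2Sph n} {F : Cn n → ℂ}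
    (hF : ∀ u, ‖F u‖ = ‖symbolFun n p ħ h z u‖)
    (hg : ∀ u, ‖F u‖ * ‖kernelT n p ħ u z‖ ≤
      C * Real.exp (C * ‖u‖) * (‖kernelT n p ħ u z‖ + Real.exp (θ * ‖z‖ / ħ))) :
    KernelGrowth n p ħ z |C| θ h := by
  intro u hu
  have h1 := hg u
  rw [hF, symbolFun, norm_div, div_mul_cancel₀ _ (norm_ne_zero_iff.2 hu)] at h1
  refine h1.trans (mul_le_mul_of_nonneg_right ?_ (by positivity))
  have h2 : C * ‖u‖ ≤ |C| * ‖u‖ := mul_le_mul_of_nonneg_right (le_abs_self C) (norm_nonneg u)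
  exact mul_le_mul (le_abs_self C) (Real.exp_le_exp.2 h2) (Real.exp_pos _).le (abs_nonneg C)

theorem isBigO_starProd {n : ℕ} (hn : 0 < n) {p : ℝ} (hp : -(n : ℝ) < p) {f₁ f₂ : ℝ → Cn n → ℂ}
    (hf : ∀ᶠ ħ in 𝓝[>] (0 : ℝ), f₁ ħ ∈ symbolAlgebra n p ħ ∧ f₂ ħ ∈ symbolAlgebra n p ħ)
    {z : Cn n} (hz : z ≠ 0) (hg₁ : UniformGrowth n p z fun ħ u => ext n p ħ (f₁ ħ) u z)
    (hg₂ : UniformGrowth n p z fun ħ u => ext n p ħ (f₂ ħ) z u) :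
    (fun ħ : ℝ => starProd n p ħ (f₁ ħ) (f₂ ħ) z - (f₁ ħ z * f₂ ħ z +
      (ħ : ℂ) * firstOrder n p (ext n p ħ (f₁ ħ)) (ext n p ħ (f₂ ħ)) z))
        =O[𝓝[>] (0 : ℝ)] (fun ħ : ℝ => ħ ^ 2) := by
  obtain ⟨C₁, θ₁, hθ₁, hg₁⟩ := hg₁
  obtain ⟨C₂, θ₂, hθ₂, hg₂⟩ := hg₂
  obtain ⟨K, hK⟩ := exists_norm_inner_sub_le hn hp hz (abs_nonneg C₁) hθ₁ (abs_nonneg C₂) hθ₂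
  refine IsBigO.of_bound K ?_
  filter_upwards [eventually_pos, hf, hg₁, hg₂, hK] with ħ hħ hf hg₁ hg₂ hK
  obtain ⟨⟨A₁, hA₁⟩, ⟨A₂, hA₂⟩⟩ := hf
  rw [← hA₁] at hg₁ ⊢
  rw [← hA₂] at hg₂ ⊢
  rw [ext_symbol hn hp hħ] at hg₁ hg₂
  rw [ext_symbol hn hp hħ, ext_symbol hn hp hħ]
  obtain ⟨h₁, hh₁, h₂, hh₂, e₁, e₂, e₃⟩ := exists_star_vectors hn hp hħ A₁ A₂ z
  have hz0 := kernelT_self_ne_zero hp ħ z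
  have d : ∀ h, DifferentiableAt ℂ (symbolFun n p ħ h z) z := fun h =>
    (contDiffAt_symbolFun hn hp hħ h hz0).differentiableAt (by simp)
  have h3 := hK h₁ hh₁ h₂ hh₂
    (kernelGrowth_of_norm_le (fun u => by rw [e₁, RCLike.norm_conj, symbolFun]) hg₁)
    (kernelGrowth_of_norm_le (fun u => by rw [e₂, symbolFun]) hg₂) _ _ rfl rfl
  rw [firstOrder_eq_cdot p hz e₁ e₂ (d h₁) (d h₂), (starProd_symbol hn hp hħ A₁ A₂).2, symbol,
    symbol, symbol, e₁, e₂, extSymbol, inner_coh hn hp hħ, ContinuousLinearMap.comp_apply, ← e₃,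
    Real.norm_of_nonneg (sq_nonneg ħ)]
  exact h3

end

end BerezinSphere

theorem mainTheorem3 (n : ℕ) (hn : 2 ≤ n) (p : ℝ) (hp : -(n : ℝ) < p) :
    (∀ ħ : ℝ, 0 < ħ →
      -- the extension of a symbol off the diagonal does not depend on the choice of the operator
      (∀ A : BerezinSphere.HolSpace n →L[ℂ] BerezinSphere.HolSpace n,
        BerezinSphere.ext n p ħ (BerezinSphere.symbol n p ħ A) =
          BerezinSphere.extSymbol n p ħ A) ∧
      -- the product is an absolutely convergent integral and stays in the algebra of symbols
      (∀ f₁ ∈ BerezinSphere.symbolAlgebra n p ħ, ∀ f₂ ∈ BerezinSphere.symbolAlgebra n p ħ,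
        (∀ z, Integrable (BerezinSphere.starIntegrand n p ħ f₁ f₂ z)
          (BerezinSphere.mMeasure n p ħ)) ∧
        BerezinSphere.starProd n p ħ f₁ f₂ ∈ BerezinSphere.symbolAlgebra n p ħ) ∧
      -- unit
      (1 : BerezinSphere.Cn n → ℂ) ∈ BerezinSphere.symbolAlgebra n p ħ ∧
      (∀ f ∈ BerezinSphere.symbolAlgebra n p ħ,
        BerezinSphere.starProd n p ħ f 1 = f ∧ BerezinSphere.starProd n p ħ 1 f = f) ∧
      -- associativity
      (∀ f₁ ∈ BerezinSphere.symbolAlgebra n p ħ, ∀ f₂ ∈ BerezinSphere.symbolAlgebra n p ħ,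
        ∀ f₃ ∈ BerezinSphere.symbolAlgebra n p ħ,
        BerezinSphere.starProd n p ħ (BerezinSphere.starProd n p ħ f₁ f₂) f₃ =
          BerezinSphere.starProd n p ħ f₁ (BerezinSphere.starProd n p ħ f₂ f₃))) ∧
    -- semiclassical expansion
    (∀ f₁ f₂ : ℝ → BerezinSphere.Cn n → ℂ,
      (∀ᶠ ħ in 𝓝[>] (0 : ℝ), f₁ ħ ∈ BerezinSphere.symbolAlgebra n p ħ ∧
        f₂ ħ ∈ BerezinSphere.symbolAlgebra n p ħ) →
      ∀ z : BerezinSphere.Cn n, z ≠ 0 →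
      BerezinSphere.UniformGrowth n p z (fun ħ u => BerezinSphere.ext n p ħ (f₁ ħ) u z) →
      BerezinSphere.UniformGrowth n p z (fun ħ u => BerezinSphere.ext n p ħ (f₂ ħ) z u) →
      (fun ħ : ℝ => BerezinSphere.starProd n p ħ (f₁ ħ) (f₂ ħ) z -
        (f₁ ħ z * f₂ ħ z + (ħ : ℂ) * BerezinSphere.firstOrder n p
          (BerezinSphere.ext n p ħ (f₁ ħ)) (BerezinSphere.ext n p ħ (f₂ ħ)) z))
        =O[𝓝[>] (0 : ℝ)] (fun ħ : ℝ => ħ ^ 2)) := by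
  have hn' : 0 < n := by omega
  refine ⟨fun ħ hħ => ⟨BerezinSphere.ext_symbol hn' hp hħ, ?_, ?_, ?_, ?_⟩,
    fun f₁ f₂ hf z hz hg₁ hg₂ => BerezinSphere.isBigO_starProd hn' hp hf hz hg₁ hg₂⟩
  · rintro _ ⟨A₁, rfl⟩ _ ⟨A₂, rfl⟩
    have h := BerezinSphere.starProd_symbol hn' hp hħ A₁ A₂
    exact ⟨h.1, A₁.comp A₂, h.2.symm⟩
  · exact ⟨_, BerezinSphere.symbol_id hn' hp hħ⟩
  · rintro _ ⟨A, rfl⟩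
    rw [← BerezinSphere.symbol_id hn' hp hħ, (BerezinSphere.starProd_symbol hn' hp hħ _ _).2,
      (BerezinSphere.starProd_symbol hn' hp hħ _ _).2, ContinuousLinearMap.comp_id,
      ContinuousLinearMap.id_comp]
    exact ⟨rfl, rfl⟩
  · rintro _ ⟨A₁, rfl⟩ _ ⟨A₂, rfl⟩ _ ⟨A₃, rfl⟩
    simp only [(BerezinSphere.starProd_symbol hn' hp hħ _ _).2, ContinuousLinearMap.comp_assoc]
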